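/- **Conventions.** All vector spaces are over $\mathbb{Q}$, graded by $\mathbb{Z}$, and cohomologically graded (differentials $\partial$ have degree $1$). Let $\Xi$ be a set of colors. A ($\Xi$-colored) collection $V$ assigns a graded vector space $V(\mathbf q)$ to every $\Xi$-colored corolla $\mathbf q$, functorially in isomorphisms of corollas. Let $\mathcal O$ be a $\Xi$-colored dg operad with suboperad of cocycles $\mathcal Z(\mathcal O)=\mathcal O\cap\ker\partial$, cohomology operad $\mathcal H=H^\bullet(\mathcal O)$ (with zero differential) and canonical projection $\pi_{\mathcal H}:\mathcal Z(\mathcal O)\to\mathcal H$. Let $P$ be a $\Xi$-colored dg pseudo-cooperad (a "cooperad without counit"), with comultiplications $\Delta_{\mathbf t}$ indexed by trees $\mathbf t$, and let $\mathrm{Cobar}(P^\diamondsuit)$ be its cobar construction: the free operad generated by the suspension $\mathbf s P$, with the differential induced by $\partial_P$ and by the comultiplications for trees with two nodal vertices. For a dg operad $\mathcal P$, $\mathrm{Conv}(P,\mathcal P)$ is the convolution dg Lie algebra: its degree $d$ vectors are the degree $d$ homomorphisms of collections $f:P\to\mathcal P$, its differential is $\partial f=\partial_{\mathcal P}\circ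 f-(-1)^{|f|}f\circ\partial_P$, and its bracket is $[f,g]=f\bullet g-(-1)^{|f||g|}g\bullet f$, where $f\bullet g$ is the pre-Lie product, the sum over trees with two nodal vertices of the compositions of the comultiplication of $P$, of $f\otimes g$ (with $f$ applied at the root vertex), and of the multiplication of $\mathcal P$. For $\alpha$ of degree $1$ put $\mathrm{Curv}(\alpha)=\partial\alpha+\tfrac12[\alpha,\alpha]$; $\alpha$ is a *Maurer–Cartan (MC) element* if $\mathrm{Curv}(\alpha)=0$. MC elements of $\mathrm{Conv}(P,\mathcal P)$ correspond bijectively to morphisms of dg operads $F_\alpha:\mathrm{Cobar}(P^\diamondsuit)\to\mathcal P$ via $F_\alpha(\mathbf sX)=\alpha(X)$. **Standing assumptions.** There is given a quasi-isomorphism of dg operads $\rho:\mathrm{Cobar}(P^\diamondsuit)\to\mathcal H$, and: * (C1) $P$ carries an additional grading by subcollections $P=\bigoplus_{k\ge1}\mathcal G^kP$ with $\partial_P(\mathcal G^kP)\subset\mathcal G^{k-1}P$ (where $\mathcal G^0P=0$) and $\Delta_{\mathbf t}(\mathcal G^mP)\subset\bigoplus_{r_1+\dots+r_q=m}\mathcal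 G^{r_1}P\otimes\dots\otimes\mathcal G^{r_q}P$ for every tree $\mathbf t$ with $q$ nodal vertices; * (C2) $\mathcal G^kP$ is finite dimensional for every $k$, and the graded components of $\mathcal O(\mathbf q)$ are finite dimensional for every corolla $\mathbf q$; * (C3) the operad $\mathcal H$ is generated by $\rho(\mathbf s\,\mathcal G^1P)$, and $\rho|_{\mathbf s\,\mathcal G^kP}=0$ for all $k\ge2$. Let $\alpha_{\mathcal H}\in\mathrm{Conv}(P,\mathcal H)$ be the MC element corresponding to $\rho$, i.e. $\alpha_{\mathcal H}(X)=\rho(\mathbf sX)$. Let $\mathbb K$ be a field extension of $\mathbb Q$; $\mathcal O\otimes\mathbb K$ is the dg operad obtained by extension of scalars, and $\mathrm{Hom}_{\mathsf{Coll}}(\mathcal G^kP,-)$ is identified with the homomorphisms $P\to -$ vanishing on $\mathcal G^jP$ for all $j\ne k$, so that every $f\in\mathrm{Conv}(P,\mathcal P)$ has components $f_k\in\mathrm{Hom}_{\mathsf{Coll}}(\mathcal G^kP,\mathcal P)$, $k\ge1$. A degree $1$ vector $\alpha\in\mathrm{Conv}(P,\mathcal O)$ is an *$n$-th MC-sprout*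 if $\mathrm{Curv}(\alpha)(X)=0$ for all $X\in\mathcal G^{k}P$, $k\le n$. **Proposition.** Let $n>m\ge2$ be integers and let $$\alpha=\sum_{k=1}^n\alpha_k,\qquad \alpha_k\in\mathrm{Hom}_{\mathsf{Coll}}(\mathcal G^kP,\mathcal O),$$ be an $n$-th MC-sprout in $\mathrm{Conv}(P,\mathcal O)$ such that $\alpha(\mathcal G^1P)\subset\mathcal Z(\mathcal O)$ and $\pi_{\mathcal H}\circ\alpha|_{\mathcal G^1P}=\alpha_{\mathcal H}|_{\mathcal G^1P}$. Let $\beta=\sum_{k\ge1}\beta_k$ be an MC element of $\mathrm{Conv}(P,\mathcal O\otimes\mathbb K)$ such that $\beta_k=\alpha_k$ for all $1\le k\le m-1$ (where $\alpha_k$ is regarded as a vector of $\mathrm{Conv}(P,\mathcal O\otimes\mathbb K)$ via $\mathcal O\to\mathcal O\otimes\mathbb K$). Then there exists an MC element $\tilde\beta=\sum_{k\ge1}\tilde\beta_k$ of $\mathrm{Conv}(P,\mathcal O\otimes\mathbb K)$ such that $\tilde\beta_k=\alpha_k$ for every $k\le m$. -/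

import Mathlib

noncomputable section

open scoped TensorProduct

universe u v w x y

namespace ColOp

/-! ### Corollas -/

/-- A `Ξ`-colored corolla: a finite set of input edges (leaves), each carrying a color, and a
colored output edge. -/
structure Corolla (Ξ : Type u) where
  leaf : Type
  [fin : Finite leaf]
  inp : leaf → Ξ
  out : Ξ

attribute [instance] Corolla.fin

namespace Corolla

variable {Ξ : Type u}

/-- Isomorphisms of colored corollas. -/
structure Iso (q r : Corolla Ξ) where
  toEquiv : q.leaf ≃ r.leaf
  inp_eq : ∀ i, r.inp (toEquiv i) = q.inp i
  out_eq : r.out = q.out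

namespace Iso

theorem ext' {q r : Corolla Ξ} {e f : q.Iso r} (h : ∀ i, e.toEquiv i = f.toEquiv i) : e = f := by
  obtain ⟨e, _, _⟩ := e
  obtain ⟨f, _, _⟩ := f
  have : e = f := Equiv.ext h
  subst this
  rfl

def refl (q : Corolla Ξ) : q.Iso q := ⟨Equiv.refl _, fun _ => rfl, rfl⟩

def symm {q r : Corolla Ξ} (e : q.Iso r) : r.Iso q :=
  ⟨e.toEquiv.symm, fun i => by simpa using (e.inp_eq (e.toEquiv.symm i)).symm, e.out_eq.symm⟩

def trans {q r s : Corolla Ξ} (e : q.Iso r) (f : r.Iso s) : q.Iso s :=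
  ⟨e.toEquiv.trans f.toEquiv, fun i => by simp [f.inp_eq, e.inp_eq], f.out_eq.trans e.out_eq⟩

@[simp] theorem refl_apply (q : Corolla Ξ) (i : q.leaf) : (refl q).toEquiv i = i := rfl

@[simp] theorem trans_apply {q r s : Corolla Ξ} (e : q.Iso r) (f : r.Iso s) (i : q.leaf) :
    (e.trans f).toEquiv i = f.toEquiv (e.toEquiv i) := rfl

theorem symm_trans {q r : Corolla Ξ} (e : q.Iso r) : e.symm.trans e = refl r :=
  ext' fun i => by simp [symm]

theorem trans_symm {q r : Corolla Ξ} (e : q.Iso r) : e.trans e.symm = refl q :=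
  ext' fun i => by simp [symm]

theorem trans_trans_symm {t q r : Corolla Ξ} (κ : t.Iso q) (e : q.Iso r) :
    e.trans (κ.trans e).symm = κ.symm :=
  ext' fun i => by simp [symm, trans]

theorem symm_trans_cancel {t q r : Corolla Ξ} (e : t.Iso q) (κ : q.Iso r) :
    (e.trans κ).symm.trans e = κ.symm :=
  ext' fun i => by simp [symm, trans]

theorem conj_symm {t s g g' : Corolla Ξ} {j : g.Iso t} {j' : g'.Iso s} {e : t.Iso s}
    {f : g.Iso g'} (h : j.trans e = f.trans j') : e.trans j'.symm = j.symm.trans f := by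
  refine ext' fun i => ?_
  have := congrArg (fun z : g.Iso s => z.toEquiv (j.toEquiv.symm i)) h
  simp only [trans_apply, Equiv.apply_symm_apply] at this
  simp [symm, this]

end Iso

/-- The corolla `q` with one extra input edge, of color `x`. -/
abbrev cons (q : Corolla Ξ) (x : Ξ) : Corolla Ξ where
  leaf := Option q.leaf
  inp o := o.elim x q.inp
  out := q.out

/-- The corolla obtained by contracting the internal edge of the tree with two nodal vertices
`q.cons r.out` (the lower one) and `r` (the upper one, attached to the extra input edge). -/
abbrev graft (q r : Corolla Ξ) : Corolla Ξ where
  leaf := q.leaf ⊕ r.leaf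
  inp := Sum.elim q.inp r.inp
  out := q.out

/-- The corolla without inputs and with the output color `x`. -/
abbrev nil (x : Ξ) : Corolla Ξ where
  leaf := Empty
  inp := Empty.elim
  out := x

def consIso {q r : Corolla Ξ} (e : q.Iso r) {x y : Ξ} (h : y = x) :
    (q.cons x).Iso (r.cons y) where
  toEquiv := Equiv.optionCongr e.toEquiv
  inp_eq := by
    rintro (_ | i)
    · exact h
    · exact e.inp_eq i
  out_eq := e.out_eq

def graftIso {q r q' r' : Corolla Ξ} (e : q.Iso q') (f : r.Iso r') :
    (q.graft r).Iso (q'.graft r') where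
  toEquiv := Equiv.sumCongr e.toEquiv f.toEquiv
  inp_eq := by
    rintro (i | i)
    · exact e.inp_eq i
    · exact f.inp_eq i
  out_eq := e.out_eq

/-- The canonical bijection `S ⊔ (T ⊔ {*}) ≃ (S ⊔ T) ⊔ {*}`. -/
def seqIso (q r : Corolla Ξ) (x : Ξ) : (q.graft (r.cons x)).Iso ((q.graft r).cons x) where
  toEquiv :=
    { toFun := fun i => match i with
        | Sum.inl i => some (Sum.inl i)
        | Sum.inr none => none
        | Sum.inr (some j) => some (Sum.inr j)
      invFun := fun i => match i with
        | some (Sum.inl i) => Sum.inl i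
        | none => Sum.inr none
        | some (Sum.inr j) => Sum.inr (some j)
      left_inv := by rintro (i | _ | i) <;> rfl
      right_inv := by rintro (_ | i | i) <;> rfl }
  inp_eq := by rintro (i | _ | i) <;> rfl
  out_eq := rfl

/-- The canonical bijection `(S ⊔ {*}) ⊔ T ≃ (S ⊔ T) ⊔ {*}`. -/
def parIso (q r : Corolla Ξ) (x : Ξ) : ((q.cons x).graft r).Iso ((q.graft r).cons x) where
  toEquiv :=
    { toFun := fun i => match i with
        | Sum.inl none => none
        | Sum.inl (some i) => some (Sum.inl i)
        | Sum.inr j => some (Sum.inr j)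
      invFun := fun i => match i with
        | none => Sum.inl none
        | some (Sum.inl i) => Sum.inl (some i)
        | some (Sum.inr j) => Sum.inr j
      left_inv := by rintro ((_ | i) | i) <;> rfl
      right_inv := by rintro (_ | i | i) <;> rfl }
  inp_eq := by rintro ((_ | i) | i) <;> rfl
  out_eq := rfl

/-- The exchange of two extra inputs. -/
def swapIso (q : Corolla Ξ) (x y : Ξ) : ((q.cons x).cons y).Iso ((q.cons y).cons x) where
  toEquiv :=
    { toFun := fun i => match i with
        | none => some none
        | some none => none
        | some (some i) => some (some i)
      invFun := fun i => match i with
        | none => some none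
        | some none => none
        | some (some i) => some (some i)
      left_inv := by rintro (_ | _ | i) <;> rfl
      right_inv := by rintro (_ | _ | i) <;> rfl }
  inp_eq := by rintro (_ | _ | i) <;> rfl
  out_eq := rfl

/-- The canonical bijection `(S ⊔ T) ⊔ U ≃ S ⊔ (T ⊔ U)`. -/
def assocIso (q r s : Corolla Ξ) : ((q.graft r).graft s).Iso (q.graft (r.graft s)) where
  toEquiv := Equiv.sumAssoc _ _ _
  inp_eq := by rintro ((i | i) | i) <;> rfl
  out_eq := rfl

/-- The canonical bijection `(S ⊔ T) ⊔ U ≃ (S ⊔ U) ⊔ T`. -/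
def commIso (q r s : Corolla Ξ) : ((q.graft r).graft s).Iso ((q.graft s).graft r) where
  toEquiv :=
    { toFun := fun i => match i with
        | Sum.inl (Sum.inl i) => Sum.inl (Sum.inl i)
        | Sum.inl (Sum.inr j) => Sum.inr j
        | Sum.inr k => Sum.inl (Sum.inr k)
      invFun := fun i => match i with
        | Sum.inl (Sum.inl i) => Sum.inl (Sum.inl i)
        | Sum.inr j => Sum.inl (Sum.inr j)
        | Sum.inl (Sum.inr k) => Sum.inr k
      left_inv := by rintro ((i | i) | i) <;> rfl
      right_inv := by rintro ((i | i) | i) <;> rfl }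
  inp_eq := by rintro ((i | i) | i) <;> rfl
  out_eq := rfl

/-- The canonical bijection `∅ ⊔ T ≃ T`. -/
def leftUnitIso (r : Corolla Ξ) : ((nil r.out).graft r).Iso r where
  toEquiv := Equiv.emptySum Empty r.leaf
  inp_eq := by rintro (i | i); exacts [i.elim, rfl]
  out_eq := rfl

/-- The canonical bijection `S ⊔ {*} ≃ S ⊔ {*}` for a unary vertex glued to the extra input. -/
def rightUnitIso (q : Corolla Ξ) (x : Ξ) : (q.graft ((nil x).cons x)).Iso (q.cons x) where
  toEquiv :=
    { toFun := fun i => match i with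
        | Sum.inl i => some i
        | Sum.inr _ => none
      invFun := fun i => match i with
        | none => Sum.inr none
        | some i => Sum.inl i
      left_inv := by rintro (i | _ | i); exacts [rfl, rfl, i.elim]
      right_inv := by rintro (_ | i) <;> rfl }
  inp_eq := by rintro (i | _ | i); exacts [rfl, rfl, i.elim]
  out_eq := rfl

/-- For a set `L` of leaves of `t`: the root vertex of the tree with two nodal vertices whose root
vertex carries the leaves in `L`, with the internal edge removed. -/
abbrev lower (t : Corolla Ξ) (L : Set t.leaf) : Corolla Ξ where
  leaf := {i // i ∈ L}
  inp i := t.inp i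
  out := t.out

/-- The upper vertex of the same tree; `x` is the color of the internal edge. -/
abbrev upper (t : Corolla Ξ) (L : Set t.leaf) (x : Ξ) : Corolla Ξ where
  leaf := {i // i ∉ L}
  inp i := t.inp i
  out := x

open Classical in
def joinIso (t : Corolla Ξ) (L : Set t.leaf) (x : Ξ) :
    ((t.lower L).graft (t.upper L x)).Iso t where
  toEquiv := Equiv.sumCompl (fun i => i ∈ L)
  inp_eq := by rintro (i | i) <;> rfl
  out_eq := rfl

/-- Every tree with two nodal vertices whose contraction is `t` is given by a set `L` of leaves
of `t` (those attached to the root vertex) and a color `x` (of the internal edge). -/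
def splitIso (t : Corolla Ξ) (L : Set t.leaf) (x : Ξ) :
    t.Iso ((t.lower L).graft (t.upper L x)) :=
  (t.joinIso L x).symm

def lowerIso {t s : Corolla Ξ} (e : t.Iso s) (L : Set t.leaf) :
    (t.lower L).Iso (s.lower (e.toEquiv '' L)) where
  toEquiv := e.toEquiv.subtypeEquiv fun _ => by simp
  inp_eq i := e.inp_eq i.1
  out_eq := e.out_eq

def upperIso {t s : Corolla Ξ} (e : t.Iso s) (L : Set t.leaf) (x : Ξ) :
    (t.upper L x).Iso (s.upper (e.toEquiv '' L) x) where
  toEquiv := e.toEquiv.subtypeEquiv fun _ => by simp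
  inp_eq i := e.inp_eq i.1
  out_eq := rfl

/-- The corolla with inputs `0, …, N - 1` of prescribed colors. -/
def std {N : ℕ} (c : Fin N → Ξ) (x : Ξ) : Corolla Ξ where
  leaf := Fin N
  inp := c
  out := x

end Corolla

open Corolla

/-! ### Graded collections and operads -/

/-- The Koszul sign `(-1) ^ n`, as an element of the base field. -/
def ks (k : Type w) [Field k] (n : ℤ) : k := ((n.negOnePow : ℤ) : k)

/-- A `Ξ`-colored collection of graded vector spaces: a graded vector space for every colored
corolla, functorially with respect to isomorphisms of corollas (in particular, the permutations
of inputs of the same color act). -/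
structure Coll (k : Type w) [Field k] (Ξ : Type u) where
  obj : Corolla Ξ → ℤ → Type v
  [grp : ∀ q a, AddCommGroup (obj q a)]
  [mod : ∀ q a, Module k (obj q a)]
  map : ∀ {q r : Corolla Ξ} (_ : q.Iso r) {a : ℤ}, obj q a →ₗ[k] obj r a
  map_refl : ∀ {q : Corolla Ξ} {a : ℤ} (u : obj q a), map (Iso.refl q) u = u
  map_trans : ∀ {q r s : Corolla Ξ} (e : q.Iso r) (f : r.Iso s) {a : ℤ} (u : obj q a),
    map (e.trans f) u = map f (map e u)

attribute [instance] Coll.grp Coll.mod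

/-- A collection of cochain complexes. The differential `d h : V(q)ᵃ → V(q)ᵇ` is indexed by
proofs `h : a + 1 = b`. -/
structure DGColl (k : Type w) [Field k] (Ξ : Type u) extends Coll.{u, v, w} k Ξ where
  d : ∀ {q : Corolla Ξ} {a b : ℤ} (_ : a + 1 = b), obj q a →ₗ[k] obj q b
  d_d : ∀ {q : Corolla Ξ} {a b c : ℤ} (h : a + 1 = b) (h' : b + 1 = c) (u : obj q a),
    d h' (d h u) = 0
  d_map : ∀ {q r : Corolla Ξ} (e : q.Iso r) {a b : ℤ} (h : a + 1 = b) (u : obj q a),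
    d h (map e u) = map e (d h u)

/-- A `Ξ`-colored operad in graded vector spaces, in terms of units and insertions:
`comp h u v` inserts `v` into the extra input of `u`. -/
structure Operad (k : Type w) [Field k] (Ξ : Type u) extends Coll.{u, v, w} k Ξ where
  one : ∀ x : Ξ, obj ((nil x).cons x) 0
  comp : ∀ {q r : Corolla Ξ} {a b c : ℤ} (_ : a + b = c),
    obj (q.cons r.out) a →ₗ[k] obj r b →ₗ[k] obj (q.graft r) c
  map_comp : ∀ {q r q' r' : Corolla Ξ} (e : q.Iso q') (f : r.Iso r') {a b c : ℤ} (h : a + b = c)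
    (u : obj (q.cons r.out) a) (v : obj r b),
    map (graftIso e f) (comp h u v) = comp h (map (consIso e f.out_eq) u) (map f v)
  comp_seq : ∀ {q r s : Corolla Ξ} {a b c ab bc abc : ℤ} (h₁ : a + b = ab) (h₂ : ab + c = abc)
    (h₃ : b + c = bc) (h₄ : a + bc = abc)
    (u : obj (q.cons r.out) a) (v : obj (r.cons s.out) b) (z : obj s c),
    map (assocIso q r s)
        (comp h₂ (map (seqIso q r s.out) (comp (r := r.cons s.out) h₁ u v)) z) =
      comp (r := r.graft s) h₄ u (comp h₃ v z)
  comp_par : ∀ {q r s : Corolla Ξ} {a b c ab ac abc : ℤ} (h₁ : a + b = ab) (h₂ : ab + c = abc)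
    (h₃ : a + c = ac) (h₄ : ac + b = abc)
    (u : obj ((q.cons s.out).cons r.out) a) (v : obj r b) (z : obj s c),
    map (commIso q r s) (comp h₂ (map (parIso q r s.out) (comp h₁ u v)) z) =
      ks k (b * c) • comp h₄ (map (parIso q s r.out)
        (comp h₃ (map (swapIso q s.out r.out) u) z)) v
  one_comp : ∀ {r : Corolla Ξ} {b : ℤ} (h : 0 + b = b) (v : obj r b),
    map (leftUnitIso r) (comp h (one r.out) v) = v
  comp_one : ∀ {q : Corolla Ξ} {x : Ξ} {a : ℤ} (h : a + 0 = a) (u : obj (q.cons x) a),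
    map (rightUnitIso q x) (comp (r := (nil x).cons x) h u (one x)) = u

/-- A `Ξ`-colored dg operad. -/
structure DGOperad (k : Type w) [Field k] (Ξ : Type u) extends
    Operad.{u, v, w} k Ξ, DGColl.{u, v, w} k Ξ where
  d_one : ∀ (x : Ξ) {b : ℤ} (h : 0 + 1 = b), d h (one x) = 0
  d_comp : ∀ {q r : Corolla Ξ} {a b c a' b' c' : ℤ} (h : a + b = c) (hc : c + 1 = c')
    (ha : a + 1 = a') (hb : b + 1 = b') (h₁ : a' + b = c') (h₂ : a + b' = c')
    (u : obj (q.cons r.out) a) (v : obj r b),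
    d hc (comp h u v) = comp h₁ (d ha u) v + ks k a • comp h₂ u (d hb v)

/-- A `Ξ`-colored dg pseudo-cooperad (no counit is required). `cocomp h` is the component of
bidegree `(a, b)` of the comultiplication for the tree with two nodal vertices `q.cons r.out`
and `r`. -/
structure DGPseudoCooperad (k : Type w) [Field k] (Ξ : Type u) extends
    DGColl.{u, v, w} k Ξ where
  cocomp : ∀ {q r : Corolla Ξ} {a b c : ℤ} (_ : a + b = c),
    obj (q.graft r) c →ₗ[k] obj (q.cons r.out) a ⊗[k] obj r b
  cocomp_map : ∀ {q r q' r' : Corolla Ξ} (e : q.Iso q') (f : r.Iso r') {a b c : ℤ}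
    (h : a + b = c) (X : obj (q.graft r) c),
    cocomp h (map (graftIso e f) X) =
      TensorProduct.map (map (consIso e f.out_eq)) (map f) (cocomp h X)
  cocomp_seq : ∀ {q r s : Corolla Ξ} {a b c ab bc abc : ℤ} (h₁ : a + b = ab) (h₂ : ab + c = abc)
    (h₃ : b + c = bc) (h₄ : a + bc = abc) (X : obj ((q.graft r).graft s) abc),
    TensorProduct.assoc k _ _ _ (TensorProduct.map
        (cocomp (r := r.cons s.out) h₁ ∘ₗ map (seqIso q r s.out).symm) LinearMap.id
        (cocomp h₂ X)) =
      TensorProduct.map LinearMap.id (cocomp h₃)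
        (cocomp (r := r.graft s) h₄ (map (assocIso q r s) X))
  cocomp_par : ∀ {q r s : Corolla Ξ} {a b c ab ac abc : ℤ} (h₁ : a + b = ab) (h₂ : ab + c = abc)
    (h₃ : a + c = ac) (h₄ : ac + b = abc) (X : obj ((q.graft r).graft s) abc),
    TensorProduct.map (cocomp h₁ ∘ₗ map (parIso q r s.out).symm) LinearMap.id (cocomp h₂ X) =
      ks k (b * c) • TensorProduct.map
        (TensorProduct.map (map (swapIso q r.out s.out)) LinearMap.id) LinearMap.id
        (TensorProduct.rightComm k _ _ _
          (TensorProduct.map (cocomp h₃ ∘ₗ map (parIso q s r.out).symm) LinearMap.id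
            (cocomp h₄ (map (commIso q r s) X))))
  cocomp_d : ∀ {q r : Corolla Ξ} {a b c a' b' c' : ℤ} (h : a' + b' = c') (hc : c + 1 = c')
    (ha : a + 1 = a') (hb : b + 1 = b') (h₁ : a + b' = c) (h₂ : a' + b = c)
    (X : obj (q.graft r) c),
    cocomp h (d hc X) =
      TensorProduct.map (d ha) LinearMap.id (cocomp h₁ X) +
        ks k a' • TensorProduct.map LinearMap.id (d hb) (cocomp h₂ X)
  /-- The comultiplication of a vector has finitely many nonzero components (it takes values in
  a direct sum over the bidegrees and over the colors of the internal edge). -/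
  cocomp_finite : ∀ {t : Corolla Ξ} {c : ℤ} (X : obj t c),
    {z : Set t.leaf × Ξ × ℤ | cocomp (add_sub_cancel z.2.2 c)
      (map (t.splitIso z.1 z.2.1) X) ≠ 0}.Finite

/-! ### Signs -/

section signs

variable (k : Type w) [Field k]

theorem ks_add (m n : ℤ) : ks k (m + n) = ks k m * ks k n := by
  simp [ks, Int.negOnePow_add]

@[simp] theorem ks_zero : ks k 0 = 1 := by simp [ks]

@[simp] theorem ks_one : ks k 1 = -1 := by simp [ks]

theorem ks_mul_self (m : ℤ) : ks k m * ks k m = 1 := by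
  rw [← ks_add, ks, Int.negOnePow_even _ ⟨m, rfl⟩]; simp

end signs

/-! ### The convolution Lie algebra -/

/-- The degree `p` part of `Hom_Coll(P, V)`. -/
structure Conv {k : Type w} [Field k] {Ξ : Type u} (P : Coll.{u, v, w} k Ξ)
    (V : Coll.{u, x, w} k Ξ) (p : ℤ) where
  app : ∀ {t : Corolla Ξ} {a b : ℤ} (_ : a + p = b), P.obj t a →ₗ[k] V.obj t b
  app_map : ∀ {t s : Corolla Ξ} (e : t.Iso s) {a b : ℤ} (h : a + p = b) (X : P.obj t a),
    app h (P.map e X) = V.map e (app h X)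

namespace Conv

variable {k : Type w} [Field k] {Ξ : Type u} {P : DGPseudoCooperad.{u, v, w} k Ξ}

section preLie

variable {V : Operad.{u, x, w} k Ξ}

/-- The linear map `u ⊗ v ↦ σ φ(u) ⊗ ψ(v)` followed by the operadic multiplication. -/
def pairing (σ : k) {q r : Corolla Ξ} {a b a' b' c : ℤ}
    (φ : P.obj (q.cons r.out) a →ₗ[k] V.obj (q.cons r.out) a') (ψ : P.obj r b →ₗ[k] V.obj r b')
    (h : a' + b' = c) :
    P.obj (q.cons r.out) a ⊗[k] P.obj r b →ₗ[k] V.obj (q.graft r) c :=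
  σ • TensorProduct.lift ((V.comp h).compl₁₂ φ ψ)

/-- The map `X ↦ μ ((φ ⊗ ψ) (Δ X))`, up to the factor `σ`, in bidegree `(a, b)`, for a tree with
two nodal vertices `q.cons r.out` and `r`, whose contraction is identified with `t`. -/
def treeMap (σ : k) {t q r : Corolla Ξ} {a b a' b' n n' : ℤ}
    (φ : P.obj (q.cons r.out) a →ₗ[k] V.obj (q.cons r.out) a') (ψ : P.obj r b →ₗ[k] V.obj r b')
    (κ : t.Iso (q.graft r)) (h : a + b = n) (h' : a' + b' = n') : P.obj t n →ₗ[k] V.obj t n' :=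
  V.map κ.symm ∘ₗ pairing σ φ ψ h' ∘ₗ P.cocomp h ∘ₗ P.map κ

theorem pairing_tmul (σ : k) {q r : Corolla Ξ} {a b a' b' c : ℤ}
    (φ : P.obj (q.cons r.out) a →ₗ[k] V.obj (q.cons r.out) a') (ψ : P.obj r b →ₗ[k] V.obj r b')
    (h : a' + b' = c) (X : P.obj (q.cons r.out) a) (Y : P.obj r b) :
    pairing σ φ ψ h (X ⊗ₜ Y) = σ • V.comp h (φ X) (ψ Y) := by
  simp [pairing]

theorem map_pairing (σ : k) {q r q' r' : Corolla Ξ} (e : q.Iso q') (i : r.Iso r')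
    {a b a' b' c : ℤ}
    (φ : P.obj (q.cons r.out) a →ₗ[k] V.obj (q.cons r.out) a') (ψ : P.obj r b →ₗ[k] V.obj r b')
    (φ' : P.obj (q'.cons r'.out) a →ₗ[k] V.obj (q'.cons r'.out) a')
    (ψ' : P.obj r' b →ₗ[k] V.obj r' b')
    (hφ : ∀ X, φ' (P.map (consIso e i.out_eq) X) = V.map (consIso e i.out_eq) (φ X))
    (hψ : ∀ X, ψ' (P.map i X) = V.map i (ψ X))
    (h : a' + b' = c) (T : P.obj (q.cons r.out) a ⊗[k] P.obj r b) :
    V.map (graftIso e i) (pairing σ φ ψ h T) =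
      pairing σ φ' ψ' h (TensorProduct.map (P.map (consIso e i.out_eq)) (P.map i) T) := by
  induction T using TensorProduct.induction_on with
  | zero => simp
  | add T T' h₁ h₂ => simp only [map_add, h₁, h₂]
  | tmul X Y => simp only [pairing_tmul, TensorProduct.map_tmul, map_smul, V.map_comp, hφ, hψ]

theorem treeMap_trans (σ : k) {t q r q' r' : Corolla Ξ} {a b a' b' n n' : ℤ}
    (e : q.Iso q') (i : r.Iso r')
    (φ : P.obj (q.cons r.out) a →ₗ[k] V.obj (q.cons r.out) a') (ψ : P.obj r b →ₗ[k] V.obj r b')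
    (φ' : P.obj (q'.cons r'.out) a →ₗ[k] V.obj (q'.cons r'.out) a')
    (ψ' : P.obj r' b →ₗ[k] V.obj r' b')
    (hφ : ∀ X, φ' (P.map (consIso e i.out_eq) X) = V.map (consIso e i.out_eq) (φ X))
    (hψ : ∀ X, ψ' (P.map i X) = V.map i (ψ X))
    (κ : t.Iso (q.graft r)) (h : a + b = n) (h' : a' + b' = n') (X : P.obj t n) :
    treeMap σ φ' ψ' (κ.trans (graftIso e i)) h h' X = treeMap σ φ ψ κ h h' X := by
  simp only [treeMap, LinearMap.comp_apply]
  rw [P.map_trans, P.cocomp_map, ← map_pairing σ e i φ ψ φ' ψ' hφ hψ, ← V.map_trans]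
  exact congrArg (fun j => V.map j _) (Iso.trans_trans_symm _ _)

theorem treeMap_map (σ : k) {t s q r : Corolla Ξ} {a b a' b' n n' : ℤ} (e : t.Iso s)
    (φ : P.obj (q.cons r.out) a →ₗ[k] V.obj (q.cons r.out) a') (ψ : P.obj r b →ₗ[k] V.obj r b')
    (κ : s.Iso (q.graft r)) (h : a + b = n) (h' : a' + b' = n') (X : P.obj t n) :
    treeMap σ φ ψ κ h h' (P.map e X) = V.map e (treeMap σ φ ψ (e.trans κ) h h' X) := by
  simp only [treeMap, LinearMap.comp_apply]
  rw [P.map_trans, ← V.map_trans]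
  exact congrArg (fun j => V.map j _) (Iso.symm_trans_cancel _ _).symm

/-- The map `X ↦ μ ((f ⊗ g) (Δ X))` for a tree with two nodal vertices, in bidegree `(a, b)`,
with the Koszul sign rule `(f ⊗ g)(u ⊗ v) = (-1)^{|g||u|} f(u) ⊗ g(v)`. -/
def treeTerm {p p' : ℤ} (f : Conv P.toColl V.toColl p) (g : Conv P.toColl V.toColl p')
    {t q r : Corolla Ξ} (κ : t.Iso (q.graft r)) {a b n n' : ℤ} (h : a + b = n)
    (h' : n + (p + p') = n') : P.obj t n →ₗ[k] V.obj t n' :=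
  treeMap (ks k (p' * a)) (f.app (rfl : a + p = _)) (g.app (rfl : b + p' = _)) κ h (by omega)

theorem treeTerm_trans {p p' : ℤ} (f : Conv P.toColl V.toColl p)
    (g : Conv P.toColl V.toColl p') {t q r q' r' : Corolla Ξ} (e : q.Iso q') (i : r.Iso r')
    (κ : t.Iso (q.graft r)) {a b n n' : ℤ} (h : a + b = n) (h' : n + (p + p') = n')
    (X : P.obj t n) :
    treeTerm f g (κ.trans (graftIso e i)) h h' X = treeTerm f g κ h h' X :=
  treeMap_trans _ e i _ _ _ _ (f.app_map _ _) (g.app_map _ _) κ h _ X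

theorem treeTerm_map {p p' : ℤ} (f : Conv P.toColl V.toColl p)
    (g : Conv P.toColl V.toColl p') {t s q r : Corolla Ξ} (e : t.Iso s)
    (κ : s.Iso (q.graft r)) {a b n n' : ℤ} (h : a + b = n) (h' : n + (p + p') = n')
    (X : P.obj t n) :
    treeTerm f g κ h h' (P.map e X) = V.map e (treeTerm f g (e.trans κ) h h' X) :=
  treeMap_map _ e _ _ κ h _ X

/-- The contribution to `f • g` of the tree with two nodal vertices given by `L = z.1` and
`x = z.2.1`, in bidegree `(z.2.2, n - z.2.2)`. -/
def preLieTerm {p p' : ℤ} (f : Conv P.toColl V.toColl p) (g : Conv P.toColl V.toColl p')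
    {t : Corolla Ξ} {n n' : ℤ} (h : n + (p + p') = n') (z : Set t.leaf × Ξ × ℤ) :
    P.obj t n →ₗ[k] V.obj t n' :=
  treeTerm f g (t.splitIso z.1 z.2.1) (add_sub_cancel z.2.2 n) h

theorem preLieTerm_finite {p p' : ℤ} (f : Conv P.toColl V.toColl p)
    (g : Conv P.toColl V.toColl p')
    {t : Corolla Ξ} {a b : ℤ} (h : a + (p + p') = b) (X : P.obj t a) :
    Function.HasFiniteSupport fun z => preLieTerm f g h z X := by
  refine (P.cocomp_finite X).subset fun z hz h0 => hz ?_
  simp only [preLieTerm, treeTerm, treeMap, LinearMap.comp_apply]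
  rw [h0]
  simp

theorem preLieTerm_map {p p' : ℤ} (f : Conv P.toColl V.toColl p)
    (g : Conv P.toColl V.toColl p') {t s : Corolla Ξ} (e : t.Iso s) {a b : ℤ}
    (h : a + (p + p') = b) (z : Set t.leaf × Ξ × ℤ) (X : P.obj t a) :
    preLieTerm f g h (Set.image e.toEquiv z.1, z.2) (P.map e X) =
      V.map e (preLieTerm f g h z X) := by
  obtain ⟨L, x, m⟩ := z
  have key : (t.joinIso L x).trans e =
      (graftIso (lowerIso e L) (upperIso e L x)).trans (s.joinIso (e.toEquiv '' L) x) := by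
    refine Iso.ext' ?_
    rintro (i | i) <;> rfl
  have key' : e.trans (s.splitIso (e.toEquiv '' L) x) =
      (t.splitIso L x).trans (graftIso (lowerIso e L) (upperIso e L x)) :=
    Iso.conj_symm key
  simp only [preLieTerm]
  rw [treeTerm_map, key', treeTerm_trans]

/-- The pre-Lie product `f • g`, i.e. the sum over all trees with two nodal vertices. -/
def preLie {p p' : ℤ} (f : Conv P.toColl V.toColl p) (g : Conv P.toColl V.toColl p') :
    Conv P.toColl V.toColl (p + p') where
  app h :=
    { toFun := fun X => ∑ᶠ z, preLieTerm f g h z X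
      map_add' := fun X Y => by
        simp only [map_add]
        exact finsum_add_distrib (preLieTerm_finite f g h X) (preLieTerm_finite f g h Y)
      map_smul' := fun c X => by
        simp only [map_smul, RingHom.id_apply]
        exact (smul_finsum c _).symm }
  app_map e _ _ h X := by
    simp only [LinearMap.coe_mk, AddHom.coe_mk]
    rw [map_finsum (V.map e) (preLieTerm_finite f g h X),
      ← finsum_comp_equiv ((Equiv.Set.congr e.toEquiv).prodCongr (Equiv.refl _))]
    exact finsum_congr fun z => preLieTerm_map f g e h z X

/-- The Lie bracket `[f, g] = f • g - (-1)^{|f||g|} g • f`. -/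
def bracket {p p' : ℤ} (f : Conv P.toColl V.toColl p) (g : Conv P.toColl V.toColl p') :
    Conv P.toColl V.toColl (p + p') where
  app h := (preLie f g).app h - ks k (p * p') • (preLie g f).app (by rw [← h]; ring)
  app_map e _ _ h X := by simp [app_map]

end preLie

section differential

variable {O : DGOperad.{u, x, w} k Ξ}

/-- The differential `∂f = ∂_O ∘ f - (-1)^{|f|} f ∘ ∂_P`. -/
def diff {p : ℤ} (f : Conv P.toColl O.toColl p) : Conv P.toColl O.toColl (p + 1) where
  app {_ a _} h := O.d (a := a + p) (by rw [← h]; ring) ∘ₗ f.app rfl -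
    ks k p • f.app (a := a + 1) (by rw [← h]; ring) ∘ₗ P.d rfl
  app_map e _ _ h X := by simp [app_map, O.d_map, P.d_map]

/-- `Curv α = ∂α + ½ [α, α]` for `α` of degree one. -/
def curv (α : Conv P.toColl O.toColl 1) : Conv P.toColl O.toColl 2 where
  app h := α.diff.app h + (1 / 2 : k) • (bracket (V := O.toOperad) α α).app h
  app_map e _ _ h X := by
    have h₁ := α.diff.app_map e h X
    have h₂ := (bracket (V := O.toOperad) α α).app_map e h X
    simp only [LinearMap.add_apply, LinearMap.smul_apply, map_add, map_smul] at *
    rw [h₁, h₂]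

/-- Maurer-Cartan elements: zeros of the curvature. -/
def IsMC (α : Conv P.toColl O.toColl 1) : Prop :=
  ∀ (t : Corolla Ξ) (a b : ℤ) (h : a + 2 = b) (X : P.obj t a), α.curv.app h X = 0

end differential

end Conv

/-! ### The free operad generated by the suspension of a collection -/

section free

variable {k : Type w} [Field k] {Ξ : Type u}

/-- Formal operadic expressions in the vectors `s X`, `X ∈ P`, where `s` raises the degree by
one. -/
inductive Expr (P : Coll.{u, v, w} k Ξ) : Corolla Ξ → ℤ → Type (max 1 u v w)
  | gen {q : Corolla Ξ} {a b : ℤ} (h : a + 1 = b) (X : P.obj q a) : Expr P q b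
  | one (x : Ξ) : Expr P ((nil x).cons x) 0
  | zero {q : Corolla Ξ} {a : ℤ} : Expr P q a
  | add {q : Corolla Ξ} {a : ℤ} (u v : Expr P q a) : Expr P q a
  | smul {q : Corolla Ξ} {a : ℤ} (c : k) (u : Expr P q a) : Expr P q a
  | map {q r : Corolla Ξ} (e : q.Iso r) {a : ℤ} (u : Expr P q a) : Expr P r a
  | comp {q r : Corolla Ξ} {a b c : ℤ} (h : a + b = c) (u : Expr P (q.cons r.out) a)
      (v : Expr P r b) : Expr P (q.graft r) c

/-- The smallest congruence on formal expressions for which the quotient is an operad, and `s`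
is a map of collections. -/
inductive Expr.Rel (P : Coll.{u, v, w} k Ξ) :
    ∀ {q : Corolla Ξ} {a : ℤ}, Expr P q a → Expr P q a → Prop
  | refl {q : Corolla Ξ} {a : ℤ} (u : Expr P q a) : Rel P u u
  | symm {q : Corolla Ξ} {a : ℤ} {u v : Expr P q a} (_ : Rel P u v) : Rel P v u
  | trans {q : Corolla Ξ} {a : ℤ} {u v z : Expr P q a} (_ : Rel P u v) (_ : Rel P v z) : Rel P u z
  | add_congr {q : Corolla Ξ} {a : ℤ} {u u' v v' : Expr P q a} (_ : Rel P u u') (_ : Rel P v v') :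
      Rel P (.add u v) (.add u' v')
  | smul_congr {q : Corolla Ξ} {a : ℤ} (c : k) {u u' : Expr P q a} (_ : Rel P u u') :
      Rel P (.smul c u) (.smul c u')
  | map_congr {q r : Corolla Ξ} (e : q.Iso r) {a : ℤ} {u u' : Expr P q a} (_ : Rel P u u') :
      Rel P (.map e u) (.map e u')
  | comp_congr {q r : Corolla Ξ} {a b c : ℤ} (h : a + b = c) {u u' : Expr P (q.cons r.out) a}
      {v v' : Expr P r b} (_ : Rel P u u') (_ : Rel P v v') : Rel P (.comp h u v) (.comp h u' v')
  | add_comm {q : Corolla Ξ} {a : ℤ} (u v : Expr P q a) : Rel P (.add u v) (.add v u)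
  | add_assoc {q : Corolla Ξ} {a : ℤ} (u v z : Expr P q a) :
      Rel P (.add (.add u v) z) (.add u (.add v z))
  | zero_add {q : Corolla Ξ} {a : ℤ} (u : Expr P q a) : Rel P (.add .zero u) u
  | neg_add {q : Corolla Ξ} {a : ℤ} (u : Expr P q a) : Rel P (.add (.smul (-1) u) u) .zero
  | smul_add {q : Corolla Ξ} {a : ℤ} (c : k) (u v : Expr P q a) :
      Rel P (.smul c (.add u v)) (.add (.smul c u) (.smul c v))
  | add_smul {q : Corolla Ξ} {a : ℤ} (c c' : k) (u : Expr P q a) :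
      Rel P (.smul (c + c') u) (.add (.smul c u) (.smul c' u))
  | mul_smul {q : Corolla Ξ} {a : ℤ} (c c' : k) (u : Expr P q a) :
      Rel P (.smul (c * c') u) (.smul c (.smul c' u))
  | one_smul {q : Corolla Ξ} {a : ℤ} (u : Expr P q a) : Rel P (.smul 1 u) u
  | gen_add {q : Corolla Ξ} {a b : ℤ} (h : a + 1 = b) (X Y : P.obj q a) :
      Rel P (.gen h (X + Y)) (.add (.gen h X) (.gen h Y))
  | gen_smul {q : Corolla Ξ} {a b : ℤ} (h : a + 1 = b) (c : k) (X : P.obj q a) :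
      Rel P (.gen h (c • X)) (.smul c (.gen h X))
  | gen_map {q r : Corolla Ξ} (e : q.Iso r) {a b : ℤ} (h : a + 1 = b) (X : P.obj q a) :
      Rel P (.gen h (P.map e X)) (.map e (.gen h X))
  | map_add {q r : Corolla Ξ} (e : q.Iso r) {a : ℤ} (u v : Expr P q a) :
      Rel P (.map e (.add u v)) (.add (.map e u) (.map e v))
  | map_smul {q r : Corolla Ξ} (e : q.Iso r) {a : ℤ} (c : k) (u : Expr P q a) :
      Rel P (.map e (.smul c u)) (.smul c (.map e u))
  | map_refl {q : Corolla Ξ} {a : ℤ} (u : Expr P q a) : Rel P (.map (Iso.refl q) u) u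
  | map_trans {q r s : Corolla Ξ} (e : q.Iso r) (f : r.Iso s) {a : ℤ} (u : Expr P q a) :
      Rel P (.map (e.trans f) u) (.map f (.map e u))
  | add_comp {q r : Corolla Ξ} {a b c : ℤ} (h : a + b = c) (u u' : Expr P (q.cons r.out) a)
      (v : Expr P r b) : Rel P (.comp h (.add u u') v) (.add (.comp h u v) (.comp h u' v))
  | smul_comp {q r : Corolla Ξ} {a b c : ℤ} (h : a + b = c) (x : k) (u : Expr P (q.cons r.out) a)
      (v : Expr P r b) : Rel P (.comp h (.smul x u) v) (.smul x (.comp h u v))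
  | comp_add {q r : Corolla Ξ} {a b c : ℤ} (h : a + b = c) (u : Expr P (q.cons r.out) a)
      (v v' : Expr P r b) : Rel P (.comp h u (.add v v')) (.add (.comp h u v) (.comp h u v'))
  | comp_smul {q r : Corolla Ξ} {a b c : ℤ} (h : a + b = c) (x : k) (u : Expr P (q.cons r.out) a)
      (v : Expr P r b) : Rel P (.comp h u (.smul x v)) (.smul x (.comp h u v))
  | map_comp {q r q' r' : Corolla Ξ} (e : q.Iso q') (f : r.Iso r') {a b c : ℤ} (h : a + b = c)
      (u : Expr P (q.cons r.out) a) (v : Expr P r b) :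
      Rel P (.map (graftIso e f) (.comp h u v))
        (.comp h (.map (consIso e f.out_eq) u) (.map f v))
  | comp_seq {q r s : Corolla Ξ} {a b c ab bc abc : ℤ} (h₁ : a + b = ab) (h₂ : ab + c = abc)
      (h₃ : b + c = bc) (h₄ : a + bc = abc)
      (u : Expr P (q.cons r.out) a) (v : Expr P (r.cons s.out) b) (z : Expr P s c) :
      Rel P (.map (assocIso q r s)
          (.comp h₂ (.map (seqIso q r s.out) (.comp (r := r.cons s.out) h₁ u v)) z))
        (.comp (r := r.graft s) h₄ u (.comp h₃ v z))
  | comp_par {q r s : Corolla Ξ} {a b c ab ac abc : ℤ} (h₁ : a + b = ab) (h₂ : ab + c = abc)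
      (h₃ : a + c = ac) (h₄ : ac + b = abc)
      (u : Expr P ((q.cons s.out).cons r.out) a) (v : Expr P r b) (z : Expr P s c) :
      Rel P (.map (commIso q r s) (.comp h₂ (.map (parIso q r s.out) (.comp h₁ u v)) z))
        (.smul (ks k (b * c)) (.comp h₄ (.map (parIso q s r.out)
          (.comp h₃ (.map (swapIso q s.out r.out) u) z)) v))
  | one_comp {r : Corolla Ξ} {b : ℤ} (h : 0 + b = b) (v : Expr P r b) :
      Rel P (.map (leftUnitIso r) (.comp h (.one r.out) v)) v
  | comp_one {q : Corolla Ξ} {x : Ξ} {a : ℤ} (h : a + 0 = a) (u : Expr P (q.cons x) a) :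
      Rel P (.map (rightUnitIso q x) (.comp (r := (nil x).cons x) h u (.one x))) u

variable (P : Coll.{u, v, w} k Ξ)

def exprSetoid (q : Corolla Ξ) (a : ℤ) : Setoid (Expr P q a) where
  r := Expr.Rel P
  iseqv := ⟨.refl, .symm, .trans⟩

def FreeObj (q : Corolla Ξ) (a : ℤ) : Type (max 1 u v w) := Quotient (exprSetoid P q a)

namespace FreeObj

variable {P}

def mk {q : Corolla Ξ} {a : ℤ} (u : Expr P q a) : FreeObj P q a := Quotient.mk _ u

theorem sound {q : Corolla Ξ} {a : ℤ} {u v : Expr P q a} (h : Expr.Rel P u v) : mk u = mk v :=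
  Quotient.sound h

theorem ind {q : Corolla Ξ} {a : ℤ} {C : FreeObj P q a → Prop} (h : ∀ u, C (mk u)) (u) : C u :=
  Quotient.ind h u

instance (q : Corolla Ξ) (a : ℤ) : Zero (FreeObj P q a) := ⟨mk .zero⟩

instance (q : Corolla Ξ) (a : ℤ) : Add (FreeObj P q a) :=
  ⟨Quotient.map₂ .add fun _ _ h _ _ h' => .add_congr h h'⟩

instance (q : Corolla Ξ) (a : ℤ) : SMul k (FreeObj P q a) :=
  ⟨fun c => Quotient.map (.smul c) fun _ _ h => .smul_congr c h⟩

instance (q : Corolla Ξ) (a : ℤ) : Neg (FreeObj P q a) := ⟨fun u => (-1 : k) • u⟩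

theorem mk_zero {q : Corolla Ξ} {a : ℤ} : mk (.zero : Expr P q a) = 0 := rfl

theorem mk_add {q : Corolla Ξ} {a : ℤ} (u v : Expr P q a) : mk (.add u v) = mk u + mk v := rfl

theorem mk_smul {q : Corolla Ξ} {a : ℤ} (c : k) (u : Expr P q a) :
    mk (.smul c u) = c • mk u := rfl

instance (q : Corolla Ξ) (a : ℤ) : AddCommGroup (FreeObj P q a) where
  add_assoc := ind fun u => ind fun v => ind fun z => sound (.add_assoc u v z)
  add_comm := ind fun u => ind fun v => sound (.add_comm u v)
  zero_add := ind fun u => sound (.zero_add u)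
  add_zero := ind fun u => sound (.trans (.add_comm _ _) (.zero_add u))
  neg_add_cancel := ind fun u => sound (.neg_add u)
  nsmul := nsmulRec
  zsmul := zsmulRec

theorem zero_smul' {q : Corolla Ξ} {a : ℤ} (u : FreeObj P q a) : (0 : k) • u = 0 := by
  have h : (0 : k) • u + (0 : k) • u = (0 : k) • u := by
    refine Eq.trans (Eq.symm ?_) (congrArg (· • u) (add_zero (0 : k)))
    induction u using ind
    exact sound (.add_smul 0 0 _)
  simpa using h

theorem smul_add' {q : Corolla Ξ} {a : ℤ} (c : k) (u v : FreeObj P q a) :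
    c • (u + v) = c • u + c • v := by
  induction u using ind
  induction v using ind
  exact sound (.smul_add c _ _)

instance (q : Corolla Ξ) (a : ℤ) : Module k (FreeObj P q a) where
  one_smul := ind fun u => sound (.one_smul u)
  mul_smul c c' := ind fun u => sound (.mul_smul c c' u)
  smul_zero c := by
    have h := smul_add' c (0 : FreeObj P q a) 0
    simpa using h
  smul_add := smul_add'
  add_smul c c' := ind fun u => sound (.add_smul c c' u)
  zero_smul := zero_smul'

def map {q r : Corolla Ξ} (e : q.Iso r) {a : ℤ} : FreeObj P q a →ₗ[k] FreeObj P r a where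
  toFun := Quotient.map (.map e) fun _ _ h => .map_congr e h
  map_add' := ind fun u => ind fun v => sound (.map_add e u v)
  map_smul' c := ind fun u => sound (.map_smul e c u)

def comp {q r : Corolla Ξ} {a b c : ℤ} (h : a + b = c) :
    FreeObj P (q.cons r.out) a →ₗ[k] FreeObj P r b →ₗ[k] FreeObj P (q.graft r) c :=
  LinearMap.mk₂ k (Quotient.map₂ (.comp h) fun _ _ h₁ _ _ h₂ => .comp_congr h h₁ h₂)
    (ind fun u => ind fun u' => ind fun v => sound (.add_comp h u u' v))
    (fun c => ind fun u => ind fun v => sound (.smul_comp h c u v))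
    (ind fun u => ind fun v => ind fun v' => sound (.comp_add h u v v'))
    (fun c => ind fun u => ind fun v => sound (.comp_smul h c u v))

end FreeObj

/-- The free operad generated by the collection `s P`. -/
def freeOperad : Operad.{u, max 1 u v w, w} k Ξ where
  obj := FreeObj P
  map := FreeObj.map
  map_refl := FreeObj.ind fun u => FreeObj.sound (.map_refl u)
  map_trans e f := FreeObj.ind fun u => FreeObj.sound (.map_trans e f u)
  one x := FreeObj.mk (.one x)
  comp := FreeObj.comp
  map_comp e f _ _ _ h := FreeObj.ind fun u => FreeObj.ind fun v => FreeObj.sound (.map_comp e f h u v)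
  comp_seq h₁ h₂ h₃ h₄ := FreeObj.ind fun u => FreeObj.ind fun v => FreeObj.ind fun z =>
    FreeObj.sound (.comp_seq h₁ h₂ h₃ h₄ u v z)
  comp_par h₁ h₂ h₃ h₄ := FreeObj.ind fun u => FreeObj.ind fun v => FreeObj.ind fun z =>
    FreeObj.sound (.comp_par h₁ h₂ h₃ h₄ u v z)
  one_comp h := FreeObj.ind fun v => FreeObj.sound (.one_comp h v)
  comp_one h := FreeObj.ind fun u => FreeObj.sound (.comp_one h u)

/-- The class of a formal expression in the free operad. -/
def freeMk {q : Corolla Ξ} {a : ℤ} (u : Expr P q a) : (freeOperad P).obj q a := FreeObj.mk u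

section freeMk

variable {P} {q r : Corolla Ξ} {a b c : ℤ}

theorem freeMk_sound {u v : Expr P q a} (h : Expr.Rel P u v) : freeMk P u = freeMk P v :=
  FreeObj.sound h

theorem freeMk_surj (u : (freeOperad P).obj q a) : ∃ v, freeMk P v = u :=
  Quotient.exists_rep u

theorem freeMk_zero : freeMk P (.zero : Expr P q a) = 0 := rfl

theorem freeMk_add (u v : Expr P q a) : freeMk P (.add u v) = freeMk P u + freeMk P v := rfl

theorem freeMk_smul (x : k) (u : Expr P q a) : freeMk P (.smul x u) = x • freeMk P u := rfl

theorem freeMk_map (e : q.Iso r) (u : Expr P q a) :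
    freeMk P (.map e u) = (freeOperad P).map e (freeMk P u) := rfl

theorem freeMk_comp (h : a + b = c) (u : Expr P (q.cons r.out) a) (v : Expr P r b) :
    freeMk P (.comp h u v) = (freeOperad P).comp h (freeMk P u) (freeMk P v) := rfl

theorem freeMk_one (x : Ξ) : freeMk P (.one x) = (freeOperad P).one x := rfl

end freeMk

/-- The map `s : P → 𝕆ℙ(s P)`, as a vector of degree one. -/
def sus : Conv P (freeOperad P).toColl 1 where
  app h :=
    { toFun := fun X => FreeObj.mk (.gen h X)
      map_add' := fun X Y => FreeObj.sound (.gen_add h X Y)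
      map_smul' := fun c X => FreeObj.sound (.gen_smul h c X) }
  app_map e _ _ h X := FreeObj.sound (.gen_map e h X)

end free

/-! ### The cobar construction -/

section cobar

variable {k : Type w} [Field k] {Ξ : Type u} (P : DGPseudoCooperad.{u, v, w} k Ξ)

/-- The cobar differential on formal expressions: on generators it is given by
`∂(s X) = - s ∂_P X - (s • s)(X)`, so that `s` is a Maurer-Cartan element, and it is extended as
a derivation of degree one. -/
def Expr.d : ∀ {q : Corolla Ξ} {a b : ℤ} (_ : a + 1 = b), Expr P.toColl q a →
    (freeOperad P.toColl).obj q b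
  | _, _, b, h, .gen (a := a) h' X =>
      -(sus P.toColl).app (a := a + 1) (by omega) (P.d rfl X) -
        ((sus P.toColl).preLie (P := P) (sus P.toColl)).app (by omega) X
  | _, _, _, _, .one _ => 0
  | _, _, _, _, .zero => 0
  | _, _, _, h, .add u v => Expr.d h u + Expr.d h v
  | _, _, _, h, .smul c u => c • Expr.d h u
  | _, _, _, h, .map e u => (freeOperad P.toColl).map e (Expr.d h u)
  | _, _, _, h, .comp (a := a) (b := b) h' u v =>
      (freeOperad P.toColl).comp (a := a + 1) (by omega) (Expr.d rfl u)
          (freeMk P.toColl v) +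
        ks k a • (freeOperad P.toColl).comp (b := b + 1) (by omega)
          (freeMk P.toColl u) (Expr.d rfl v)

theorem Expr.d_sound {q : Corolla Ξ} {a : ℤ} {u v : Expr P.toColl q a}
    (r : Expr.Rel P.toColl u v) : ∀ {b : ℤ} (h : a + 1 = b), Expr.d P h u = Expr.d P h v := by
  induction r with
  | refl u => intros; rfl
  | symm _ ih => intro b h; exact (ih h).symm
  | trans _ _ ih ih' => intro b h; exact (ih h).trans (ih' h)
  | add_congr _ _ ih ih' => intro b h; simp only [Expr.d, ih, ih']
  | smul_congr c _ ih => intro b h; simp only [Expr.d, ih]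
  | map_congr e _ ih => intro b h; simp only [Expr.d, ih]
  | comp_congr h r r' ih ih' =>
    intro b h
    simp only [Expr.d, ih, ih', freeMk_sound r, freeMk_sound r']
  | add_comm u v => intro b h; simp only [Expr.d, add_comm]
  | add_assoc u v z => intro b h; simp only [Expr.d, add_assoc]
  | zero_add u => intro b h; simp only [Expr.d, zero_add]
  | neg_add u => intro b h; simp [Expr.d]
  | smul_add c u v => intro b h; simp only [Expr.d, smul_add]
  | add_smul c c' u => intro b h; simp only [Expr.d, add_smul]
  | mul_smul c c' u => intro b h; simp only [Expr.d, mul_smul]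
  | one_smul u => intro b h; simp only [Expr.d, one_smul]
  | gen_add h X Y => intro b h; simp only [Expr.d, map_add]; abel
  | gen_smul h c X => intro b h; simp only [Expr.d, map_smul]; module
  | gen_map e h X =>
    intro b h
    simp only [Expr.d, map_sub, map_neg, P.d_map, Conv.app_map]
  | map_add e u v => intro b h; simp only [Expr.d, map_add]
  | map_smul e c u => intro b h; simp only [Expr.d, map_smul]
  | map_refl u => intro b h; simp only [Expr.d, Coll.map_refl]
  | map_trans e f u => intro b h; simp only [Expr.d, Coll.map_trans]
  | add_comp h u u' v =>
    intro b h
    simp only [Expr.d, freeMk_add, map_add, LinearMap.add_apply]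
    module
  | smul_comp h x u v =>
    intro b h
    simp only [Expr.d, freeMk_smul, map_smul, LinearMap.smul_apply]
    module
  | comp_add h u v v' =>
    intro b h
    simp only [Expr.d, freeMk_add, map_add]
    module
  | comp_smul h x u v =>
    intro b h
    simp only [Expr.d, freeMk_smul, map_smul]
    module
  | map_comp e f h u v =>
    intro b h
    simp only [Expr.d, map_add, map_smul, Operad.map_comp, freeMk_map]
  | @comp_seq q r s a b c ab bc abc h₁ h₂ h₃ h₄ u v z =>
    intro m h
    subst h h₁ h₃
    simp only [Expr.d, freeMk_comp, freeMk_map, map_add, map_smul, LinearMap.add_apply,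
      LinearMap.smul_apply]
    rw [Operad.comp_seq (bc := b + c) _ _ _ rfl (by omega),
      Operad.comp_seq (bc := b + c + 1) _ _ _ (by omega) (by omega),
      Operad.comp_seq (bc := b + c + 1) _ _ _ (by omega) (by omega), ks_add]
    module
  | @comp_par q r s a b c ab ac abc h₁ h₂ h₃ h₄ u v z =>
    intro m h
    subst h h₁ h₃
    simp only [Expr.d, freeMk_comp, freeMk_map, map_add, map_smul, LinearMap.add_apply,
      LinearMap.smul_apply]
    rw [Operad.comp_par (ac := a + c + 1) _ _ _ (by omega) (by omega),
      Operad.comp_par (ac := a + c) _ _ _ rfl (by omega),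
      Operad.comp_par (ac := a + c + 1) _ _ _ (by omega) (by omega)]
    simp only [mul_add, add_mul, one_mul, mul_one, ks_add, smul_add, smul_smul]
    have e₁ : ks k a * ks k b * (ks k (b * c) * ks k b) = ks k (b * c) * ks k a := by
      linear_combination ks k a * ks k (b * c) * ks_mul_self k b
    have e₂ : ks k a * (ks k (b * c) * ks k c) = ks k (b * c) * (ks k a * ks k c) := by ring
    rw [e₁, e₂]
    abel
  | one_comp h v =>
    intro b h
    subst h
    simp only [Expr.d, freeMk_one, map_zero, LinearMap.zero_apply, zero_add,
      ks_zero, one_smul]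
    exact Operad.one_comp _ _ _
  | comp_one h u =>
    intro b h
    subst h
    simp only [Expr.d, freeMk_one, map_zero, smul_zero, add_zero]
    exact Operad.comp_one _ _ _

end cobar

/-! ### The associator of the pre-Lie product -/

namespace Corolla

variable {Ξ : Type u}

/-- The fiber of a map `c` from the leaves to a three-element set. -/
abbrev fib (t : Corolla Ξ) (c : t.leaf → Fin 3) (i : Fin 3) (x : Ξ) : Corolla Ξ where
  leaf := {l // c l = i}
  inp l := t.inp l
  out := x

def joinTri (t : Corolla Ξ) (c : t.leaf → Fin 3) (x y : Ξ) :
    (((t.fib c 0 t.out).graft (t.fib c 1 x)).graft (t.fib c 2 y)).Iso t where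
  toEquiv := Equiv.ofBijective
    (Sum.elim (Sum.elim Subtype.val Subtype.val) Subtype.val) <| by
      constructor
      · rintro ((⟨i, hi⟩ | ⟨i, hi⟩) | ⟨i, hi⟩) ((⟨j, hj⟩ | ⟨j, hj⟩) | ⟨j, hj⟩) h <;>
          simp only [Sum.elim_inl, Sum.elim_inr] at h <;> subst h <;> first | rfl | (exfalso; omega)
      · intro l
        obtain h | h | h : c l = 0 ∨ c l = 1 ∨ c l = 2 := by omega
        · exact ⟨Sum.inl (Sum.inl ⟨l, h⟩), rfl⟩
        · exact ⟨Sum.inl (Sum.inr ⟨l, h⟩), rfl⟩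
        · exact ⟨Sum.inr ⟨l, h⟩, rfl⟩
  inp_eq := by rintro ((i | i) | i) <;> rfl
  out_eq := rfl

def triIso (t : Corolla Ξ) (c : t.leaf → Fin 3) (x y : Ξ) :
    t.Iso (((t.fib c 0 t.out).graft (t.fib c 1 x)).graft (t.fib c 2 y)) :=
  (t.joinTri c x y).symm

end Corolla

namespace Conv

variable {k : Type w} [Field k] {Ξ : Type u} {P : DGPseudoCooperad.{u, v, w} k Ξ}
  {V : Operad.{u, x, w} k Ξ} {p p' p'' : ℤ}

/-- The contribution to `(f • g) • e` of a tree with three nodal vertices, arranged in a line. -/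
def seqTerm (f : Conv P.toColl V.toColl p) (g : Conv P.toColl V.toColl p')
    (e : Conv P.toColl V.toColl p'') {t q r s : Corolla Ξ} (κ : t.Iso ((q.graft r).graft s))
    {a b c ab n n' : ℤ} (h₁ : a + b = ab) (h₂ : ab + c = n) (h' : n + (p + p' + p'') = n') :
    P.obj t n →ₗ[k] V.obj t n' :=
  treeMap (ks k (p'' * ab)) (treeTerm f g (seqIso q r s.out).symm h₁ rfl)
    (e.app (rfl : c + p'' = _)) κ h₂ (by omega)

/-- The contribution to `(f • g) • e` of a tree with three nodal vertices, two of which are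
attached to the root vertex. -/
def parTerm (f : Conv P.toColl V.toColl p) (g : Conv P.toColl V.toColl p')
    (e : Conv P.toColl V.toColl p'') {t q r s : Corolla Ξ} (κ : t.Iso ((q.graft r).graft s))
    {a b c ab n n' : ℤ} (h₁ : a + b = ab) (h₂ : ab + c = n) (h' : n + (p + p' + p'') = n') :
    P.obj t n →ₗ[k] V.obj t n' :=
  treeMap (ks k (p'' * ab)) (treeTerm f g (parIso q r s.out).symm h₁ rfl)
    (e.app (rfl : c + p'' = _)) κ h₂ (by omega)

/-- The contribution to `f • (g • e)` of a tree with three nodal vertices. -/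
def seqTerm' (f : Conv P.toColl V.toColl p) (g : Conv P.toColl V.toColl p')
    (e : Conv P.toColl V.toColl p'') {t q r s : Corolla Ξ} (κ : t.Iso (q.graft (r.graft s)))
    {a b c bc n n' : ℤ} (h₁ : b + c = bc) (h₂ : a + bc = n) (h' : n + (p + (p' + p'')) = n') :
    P.obj t n →ₗ[k] V.obj t n' :=
  treeMap (ks k ((p' + p'') * a)) (f.app (rfl : a + p = _))
    (treeTerm g e (Iso.refl (r.graft s)) h₁ rfl) κ h₂ (by omega)

/-- `u ⊗ (v ⊗ z) ↦ f(u) ∘ (g(v) ∘ e(z))`. -/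
def evSeq (f : Conv P.toColl V.toColl p) (g : Conv P.toColl V.toColl p')
    (e : Conv P.toColl V.toColl p'') (q r s : Corolla Ξ) (a b c : ℤ) {m n' : ℤ}
    (hm : b + p' + (c + p'') = m) (h' : a + p + m = n') :
    P.obj (q.cons r.out) a ⊗[k] (P.obj (r.cons s.out) b ⊗[k] P.obj s c) →ₗ[k]
      V.obj (q.graft (r.graft s)) n' :=
  TensorProduct.lift ((V.comp (r := r.graft s) h').compl₁₂ (f.app rfl)
    (TensorProduct.lift ((V.comp hm).compl₁₂ (g.app rfl) (e.app rfl))))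

/-- `(u ⊗ v) ⊗ z ↦ (f(u) ∘ g(v)) ∘ e(z)`. -/
def evPar (f : Conv P.toColl V.toColl p) (g : Conv P.toColl V.toColl p')
    (e : Conv P.toColl V.toColl p'') (q r s : Corolla Ξ) (a b c : ℤ) {m n' : ℤ}
    (hm : a + p + (b + p') = m) (h' : m + (c + p'') = n') :
    (P.obj ((q.cons s.out).cons r.out) a ⊗[k] P.obj r b) ⊗[k] P.obj s c →ₗ[k]
      V.obj ((q.graft r).graft s) n' :=
  TensorProduct.lift ((V.comp h').compl₁₂
    (V.map (parIso q r s.out) ∘ₗ TensorProduct.lift ((V.comp hm).compl₁₂ (f.app rfl) (g.app rfl)))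
    (e.app rfl))

theorem seqTerm_eq (f : Conv P.toColl V.toColl p) (g : Conv P.toColl V.toColl p')
    (e : Conv P.toColl V.toColl p'') {t q r s : Corolla Ξ} (κ : t.Iso ((q.graft r).graft s))
    {a b c ab bc n n' : ℤ} (h₁ : a + b = ab) (h₂ : ab + c = n) (h₃ : b + c = bc)
    (h₄ : a + bc = n) (h' : n + (p + p' + p'') = n') (h'' : n + (p + (p' + p'')) = n')
    (X : P.obj t n) :
    seqTerm f g e κ h₁ h₂ h' X =
      seqTerm' f g e (κ.trans (assocIso q r s)) h₃ h₄ h'' X := by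
  have hm : b + p' + (c + p'') = bc + (p' + p'') := by omega
  have hn : a + p + (bc + (p' + p'')) = n' := by omega
  have l1 : ∀ T : P.obj ((q.graft r).cons s.out) ab ⊗[k] P.obj s c,
      V.map (assocIso q r s) (pairing (ks k (p'' * ab))
        (treeTerm f g (seqIso q r s.out).symm h₁ rfl) (e.app (rfl : c + p'' = _))
          (by omega : _ = n') T) =
        (ks k (p'' * ab) * ks k (p' * a)) • evSeq f g e q r s a b c hm hn
          (TensorProduct.assoc k _ _ _ (TensorProduct.map
            (P.cocomp (r := r.cons s.out) h₁ ∘ₗ P.map (seqIso q r s.out).symm) LinearMap.id T)) := by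
    intro T
    induction T using TensorProduct.induction_on with
    | zero => simp
    | add T T' h h' => simp only [map_add, h, h', smul_add]
    | tmul Y Z =>
      simp only [pairing_tmul, TensorProduct.map_tmul, treeTerm, treeMap, LinearMap.comp_apply,
        LinearMap.id_apply]
      generalize P.cocomp (r := r.cons s.out) h₁ (P.map (seqIso q r s.out).symm Y) = U
      induction U using TensorProduct.induction_on with
      | zero => simp
      | add U U' h h' =>
        simp only [map_add, TensorProduct.add_tmul, LinearMap.add_apply, smul_add] at h h' ⊢
        rw [h, h']
      | tmul u v =>
        simp only [pairing_tmul, TensorProduct.assoc_tmul, evSeq, TensorProduct.lift.tmul,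
          LinearMap.compl₁₂_apply, map_smul, LinearMap.smul_apply, smul_smul]
        congr 1
        exact V.comp_seq _ _ _ _ _ _ _
  have l2 : ∀ T : P.obj (q.cons r.out) a ⊗[k] P.obj (r.graft s) bc,
      pairing (r := r.graft s) (ks k ((p' + p'') * a)) (f.app (rfl : a + p = _))
        (treeTerm g e (Iso.refl (r.graft s)) h₃ rfl) (by omega : _ = n') T =
        (ks k ((p' + p'') * a) * ks k (p'' * b)) • evSeq f g e q r s a b c hm hn
          (TensorProduct.map LinearMap.id (P.cocomp h₃) T) := by
    intro T
    induction T using TensorProduct.induction_on with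
    | zero => simp
    | add T T' h h' => simp only [map_add, h, h', smul_add]
    | tmul Y Z =>
      have hr : (Iso.refl (r.graft s)).symm = Iso.refl (r.graft s) := rfl
      simp only [pairing_tmul, TensorProduct.map_tmul, treeTerm, treeMap, LinearMap.comp_apply,
        LinearMap.id_apply, P.map_refl, hr, V.map_refl]
      generalize P.cocomp h₃ Z = U
      induction U using TensorProduct.induction_on with
      | zero => simp
      | add U U' h h' =>
        simp only [map_add, TensorProduct.tmul_add, smul_add] at h h' ⊢
        rw [h, h']
      | tmul u v =>
        simp only [pairing_tmul, evSeq, TensorProduct.lift.tmul,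
          LinearMap.compl₁₂_apply, map_smul, smul_smul]
  have hs : ks k (p'' * ab) * ks k (p' * a) = ks k ((p' + p'') * a) * ks k (p'' * b) := by
    rw [← ks_add, ← ks_add, ← h₁]
    congr 1
    ring
  simp only [seqTerm, seqTerm', treeMap, LinearMap.comp_apply]
  rw [l2, P.map_trans, ← P.cocomp_seq h₁ h₂, ← hs, ← l1, ← V.map_trans]
  exact congrArg (fun j => V.map j _) (Iso.trans_trans_symm _ _).symm

theorem parTerm_eq (f : Conv P.toColl V.toColl p) (g : Conv P.toColl V.toColl p')
    (e : Conv P.toColl V.toColl p'') {t q r s : Corolla Ξ} (κ : t.Iso ((q.graft r).graft s))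
    {a b c ab ac n n' : ℤ} (h₁ : a + b = ab) (h₂ : ab + c = n) (h₃ : a + c = ac)
    (h₄ : ac + b = n) (h' : n + (p + p' + p'') = n') (h'' : n + (p + p'' + p') = n')
    (X : P.obj t n) :
    parTerm f g e κ h₁ h₂ h' X =
      ks k (p' * p'') • parTerm f e g (κ.trans (commIso q r s)) h₃ h₄ h'' X := by
  have hm : a + p + (b + p') = ab + (p + p') := by omega
  have hn : ab + (p + p') + (c + p'') = n' := by omega
  have hm' : a + p + (c + p'') = ac + (p + p'') := by omega
  have hn' : ac + (p + p'') + (b + p') = n' := by omega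
  have l1 : ∀ {p' p'' : ℤ} (g : Conv P.toColl V.toColl p') (e : Conv P.toColl V.toColl p'')
      {r s : Corolla Ξ} {b c ab : ℤ} (h₁ : a + b = ab)
      (hm : a + p + (b + p') = ab + (p + p')) (hn : ab + (p + p') + (c + p'') = n')
      (T : P.obj ((q.graft r).cons s.out) ab ⊗[k] P.obj s c),
      pairing (ks k (p'' * ab))
        (treeTerm f g (parIso q r s.out).symm h₁ rfl) (e.app (rfl : c + p'' = _))
          (by omega : _ = n') T =
        (ks k (p'' * ab) * ks k (p' * a)) • evPar f g e q r s a b c hm hn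
          (TensorProduct.map
            (P.cocomp h₁ ∘ₗ P.map (parIso q r s.out).symm) LinearMap.id T) := by
    intro p' p'' g e r s b c ab h₁ hm hn T
    induction T using TensorProduct.induction_on with
    | zero => simp
    | add T T' h h' => simp only [map_add, h, h', smul_add]
    | tmul Y Z =>
      simp only [pairing_tmul, TensorProduct.map_tmul, treeTerm, treeMap, LinearMap.comp_apply,
        LinearMap.id_apply]
      generalize P.cocomp h₁ (P.map (parIso q r s.out).symm Y) = U
      induction U using TensorProduct.induction_on with
      | zero => simp
      | add U U' h h' =>
        simp only [map_add, TensorProduct.add_tmul, LinearMap.add_apply, smul_add] at h h' ⊢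
        rw [h, h']
      | tmul u v =>
        simp only [pairing_tmul, evPar, TensorProduct.lift.tmul, LinearMap.comp_apply,
          LinearMap.compl₁₂_apply, map_smul, LinearMap.smul_apply, smul_smul]
        rfl
  have l2 : ∀ S : (P.obj ((q.cons r.out).cons s.out) a ⊗[k] P.obj s c) ⊗[k] P.obj r b,
      V.map (commIso q r s) (evPar f g e q r s a b c hm hn
        (TensorProduct.map (TensorProduct.map (P.map (swapIso q r.out s.out)) LinearMap.id)
          LinearMap.id (TensorProduct.rightComm k _ _ _ S))) =
        ks k ((b + p') * (c + p'')) • evPar f e g q s r a c b hm' hn' S := by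
    intro S
    induction S using TensorProduct.induction_on with
    | zero => simp
    | add T T' h h' => simp only [map_add, h, h', smul_add]
    | tmul U z =>
      induction U using TensorProduct.induction_on with
      | zero => simp
      | add U U' h h' =>
        simp only [map_add, TensorProduct.add_tmul, smul_add] at h h' ⊢
        rw [h, h']
      | tmul u v =>
        simp only [TensorProduct.rightComm_tmul, TensorProduct.map_tmul, evPar,
          TensorProduct.lift.tmul, LinearMap.comp_apply, LinearMap.compl₁₂_apply,
          LinearMap.id_apply]
        rw [V.comp_par hm hn hm' hn', f.app_map, ← V.map_trans]
        have : (swapIso q r.out s.out).trans (swapIso q s.out r.out) = Iso.refl _ := by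
          refine Iso.ext' ?_
          rintro (_ | _ | i) <;> rfl
        rw [this, V.map_refl]
  have hs : ks k (p'' * ab) * ks k (p' * a) * (ks k (b * c) * ks k ((b + p') * (c + p''))) =
      ks k (p' * p'') * (ks k (p' * ac) * ks k (p'' * a)) := by
    rw [← h₁, ← h₃]
    simp only [mul_add, add_mul, ks_add, mul_comm b p'']
    linear_combination (ks k (p' * p'') * ks k (p' * a) * ks k (p' * c) * ks k (p'' * a)) *
      (ks k (b * c) * ks k (b * c) * ks_mul_self k (p'' * b) + ks_mul_self k (b * c))
  have l2' : ∀ U : V.obj ((q.graft r).graft s) n',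
      V.map (κ.trans (commIso q r s)).symm (V.map (commIso q r s) U) = V.map κ.symm U := by
    intro U
    rw [← V.map_trans]
    exact congrArg (fun j => V.map j _) (Iso.trans_trans_symm _ _)
  simp only [parTerm, treeMap, LinearMap.comp_apply]
  rw [l1 g e h₁ hm hn, l1 e g h₃ hm' hn', P.map_trans, P.cocomp_par h₁ h₂ h₃ h₄]
  simp only [map_smul]
  rw [← l2', l2, map_smul]
  simp only [smul_smul, hs]

end Conv

/-! ### Sums over trees with three nodal vertices -/

theorem finsum_sigma_eq {ι : Type*} {β : ι → Type*} {M : Type*} [AddCommMonoid M]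
    (F : ∀ i, β i → M) (h₁ : {i | ∃ b, F i b ≠ 0}.Finite)
    (h₂ : ∀ i, Function.HasFiniteSupport (F i)) :
    Function.HasFiniteSupport (fun z : Σ i, β i => F z.1 z.2) ∧
      ∑ᶠ z : Σ i, β i, F z.1 z.2 = ∑ᶠ i, ∑ᶠ b, F i b := by
  classical
  have hsub : Function.support (fun z : Σ i, β i => F z.1 z.2) ⊆
      (h₁.toFinset.sigma fun i => (h₂ i).toFinset : Finset (Σ i, β i)) := by
    rintro ⟨i, b⟩ h
    simp only [Finset.coe_sigma, Set.mem_sigma_iff, Finset.mem_coe, Set.Finite.mem_toFinset]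
    exact ⟨⟨b, h⟩, (Set.Finite.mem_toFinset _).2 h⟩
  refine ⟨(Finset.finite_toSet _).subset hsub, ?_⟩
  rw [finsum_eq_finsetSum_of_support_subset _ hsub, Finset.sum_sigma,
    finsum_eq_finsetSum_of_support_subset (s := h₁.toFinset)]
  · refine Finset.sum_congr rfl fun i _ => ?_
    exact (finsum_eq_finsetSum_of_support_subset _ fun b hb =>
      Finset.mem_coe.2 ((Set.Finite.mem_toFinset _).2 hb)).symm
  · intro i hi
    refine Finset.mem_coe.2 ((Set.Finite.mem_toFinset _).2 ?_)
    by_contra hb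
    have hb' : ∀ b, F i b = 0 := fun b => by_contra fun h => hb ⟨b, h⟩
    exact hi (by simp [hb'])

namespace Conv

variable {k : Type w} [Field k] {Ξ : Type u} {P : DGPseudoCooperad.{u, v, w} k Ξ}
  {V : Operad.{u, x, w} k Ξ} {p p' p'' : ℤ}

theorem pairing_finsum_left {ι : Type*} (σ : k) {q r : Corolla Ξ} {a b a' b' c : ℤ}
    (φ : P.obj (q.cons r.out) a →ₗ[k] V.obj (q.cons r.out) a')
    (φ' : ι → P.obj (q.cons r.out) a →ₗ[k] V.obj (q.cons r.out) a')
    (ψ : P.obj r b →ₗ[k] V.obj r b') (h : a' + b' = c)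
    (hf : ∀ X, Function.HasFiniteSupport fun i => φ' i X) (hφ : ∀ X, φ X = ∑ᶠ i, φ' i X)
    (T : P.obj (q.cons r.out) a ⊗[k] P.obj r b) :
    Function.HasFiniteSupport (fun i => pairing σ (φ' i) ψ h T) ∧
      pairing σ φ ψ h T = ∑ᶠ i, pairing σ (φ' i) ψ h T := by
  induction T using TensorProduct.induction_on with
  | zero => simp [Function.HasFiniteSupport, Function.support]
  | add T T' h₁ h₂ =>
    simp only [map_add]
    exact ⟨h₁.1.add h₂.1, by rw [finsum_add_distrib h₁.1 h₂.1, h₁.2, h₂.2]⟩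
  | tmul X Y =>
    simp only [pairing_tmul]
    have h₁ : ∀ i, σ • V.comp h (φ' i X) (ψ Y) = (σ • (V.comp h).flip (ψ Y)) (φ' i X) :=
      fun i => rfl
    have h₂ : σ • V.comp h (φ X) (ψ Y) = (σ • (V.comp h).flip (ψ Y)) (φ X) := rfl
    simp only [h₁]
    refine ⟨(hf X).subset fun i hi h0 => hi ?_, h₂.trans ?_⟩
    swap
    · rw [hφ X]
      exact map_finsum _ (hf X)
    simp only at h0 ⊢
    rw [h0, map_zero]

theorem pairing_finsum_right {ι : Type*} (σ : k) {q r : Corolla Ξ} {a b a' b' c : ℤ}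
    (φ : P.obj (q.cons r.out) a →ₗ[k] V.obj (q.cons r.out) a')
    (ψ : P.obj r b →ₗ[k] V.obj r b') (ψ' : ι → P.obj r b →ₗ[k] V.obj r b') (h : a' + b' = c)
    (hf : ∀ X, Function.HasFiniteSupport fun i => ψ' i X) (hψ : ∀ X, ψ X = ∑ᶠ i, ψ' i X)
    (T : P.obj (q.cons r.out) a ⊗[k] P.obj r b) :
    Function.HasFiniteSupport (fun i => pairing σ φ (ψ' i) h T) ∧
      pairing σ φ ψ h T = ∑ᶠ i, pairing σ φ (ψ' i) h T := by
  induction T using TensorProduct.induction_on with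
  | zero => simp [Function.HasFiniteSupport, Function.support]
  | add T T' h₁ h₂ =>
    simp only [map_add]
    exact ⟨h₁.1.add h₂.1, by rw [finsum_add_distrib h₁.1 h₂.1, h₁.2, h₂.2]⟩
  | tmul X Y =>
    simp only [pairing_tmul]
    have h₁ : ∀ i, σ • V.comp h (φ X) (ψ' i Y) = (σ • V.comp h (φ X)) (ψ' i Y) :=
      fun i => rfl
    have h₂ : σ • V.comp h (φ X) (ψ Y) = (σ • V.comp h (φ X)) (ψ Y) := rfl
    simp only [h₁]
    refine ⟨(hf Y).subset fun i hi h0 => hi ?_, h₂.trans ?_⟩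
    swap
    · rw [hψ Y]
      exact map_finsum _ (hf Y)
    simp only at h0 ⊢
    rw [h0, map_zero]

theorem map_finsum' {ι : Type*} {M N : Type*} [AddCommGroup M] [AddCommGroup N] [Module k M]
    [Module k N] (L : M →ₗ[k] N) (F : ι → M) (h : Function.HasFiniteSupport F) :
    Function.HasFiniteSupport (fun i => L (F i)) ∧ L (∑ᶠ i, F i) = ∑ᶠ i, L (F i) := by
  refine ⟨h.subset fun i hi h0 => hi ?_, map_finsum L h⟩
  simp only at h0 ⊢
  rw [h0, map_zero]

/-- The terms of `(f • g) • e`. -/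
def leftTerm (f : Conv P.toColl V.toColl p) (g : Conv P.toColl V.toColl p')
    (e : Conv P.toColl V.toColl p'') {t : Corolla Ξ} {n n' : ℤ} (h : n + (p + p' + p'') = n')
    (z : Set t.leaf × Ξ × ℤ) (z' : Set ((t.lower z.1).cons z.2.1).leaf × Ξ × ℤ) :
    P.obj t n →ₗ[k] V.obj t n' :=
  treeMap (ks k (p'' * z.2.2)) (preLieTerm f g rfl z') (e.app (rfl : n - z.2.2 + p'' = _))
    (t.splitIso z.1 z.2.1) (add_sub_cancel z.2.2 n) (by omega)

/-- The terms of `f • (g • e)`. -/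
def rightTerm (f : Conv P.toColl V.toColl p) (g : Conv P.toColl V.toColl p')
    (e : Conv P.toColl V.toColl p'') {t : Corolla Ξ} {n n' : ℤ} (h : n + (p + (p' + p'')) = n')
    (z : Set t.leaf × Ξ × ℤ) (z' : Set (t.upper z.1 z.2.1).leaf × Ξ × ℤ) :
    P.obj t n →ₗ[k] V.obj t n' :=
  treeMap (ks k ((p' + p'') * z.2.2)) (f.app (rfl : z.2.2 + p = _)) (preLieTerm g e rfl z')
    (t.splitIso z.1 z.2.1) (add_sub_cancel z.2.2 n) (by omega)

end Conv
namespace Conv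

variable {k : Type w} [Field k] {Ξ : Type u} {P : DGPseudoCooperad.{u, v, w} k Ξ}
  {V : Operad.{u, x, w} k Ξ} {p p' p'' : ℤ}

theorem left_sum (f : Conv P.toColl V.toColl p) (g : Conv P.toColl V.toColl p')
    (e : Conv P.toColl V.toColl p'') {t : Corolla Ξ} {n n' : ℤ} (h : n + (p + p' + p'') = n')
    (X : P.obj t n) :
    Function.HasFiniteSupport (fun z : Σ z : Set t.leaf × Ξ × ℤ,
        Set ((t.lower z.1).cons z.2.1).leaf × Ξ × ℤ => leftTerm f g e h z.1 z.2 X) ∧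
      ((f.preLie g).preLie e).app h X =
        ∑ᶠ z : Σ z : Set t.leaf × Ξ × ℤ,
          Set ((t.lower z.1).cons z.2.1).leaf × Ξ × ℤ, leftTerm f g e h z.1 z.2 X := by
  have key : ∀ z : Set t.leaf × Ξ × ℤ,
      Function.HasFiniteSupport (fun z' => leftTerm f g e h z z' X) ∧
        preLieTerm (f.preLie g) e h z X = ∑ᶠ z', leftTerm f g e h z z' X := by
    intro z
    have := pairing_finsum_left (ks k (p'' * z.2.2)) ((f.preLie g).app rfl)
      (preLieTerm f g rfl) (e.app (rfl : n - z.2.2 + p'' = _))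
      (by omega : z.2.2 + (p + p') + (n - z.2.2 + p'') = n') (preLieTerm_finite f g rfl)
      (fun _ => rfl) (P.cocomp (r := t.upper z.1 z.2.1) (add_sub_cancel z.2.2 n) (P.map (t.splitIso z.1 z.2.1) X))
    have h₂ := map_finsum' (k := k) (V.map (t.splitIso z.1 z.2.1).symm) _ this.1
    refine ⟨h₂.1, Eq.trans ?_ h₂.2⟩
    rw [← this.2]
    rfl
  have := finsum_sigma_eq (fun z z' => leftTerm f g e h z z' X) (by
      refine (P.cocomp_finite X).subset ?_
      rintro z ⟨z', hz⟩ h0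
      refine hz ?_
      simp only [leftTerm, treeMap, LinearMap.comp_apply]
      rw [h0]
      simp) (fun z => (key z).1)
  refine ⟨this.1, ?_⟩
  rw [this.2]
  exact finsum_congr fun z => (key z).2

theorem right_sum (f : Conv P.toColl V.toColl p) (g : Conv P.toColl V.toColl p')
    (e : Conv P.toColl V.toColl p'') {t : Corolla Ξ} {n n' : ℤ} (h : n + (p + (p' + p'')) = n')
    (X : P.obj t n) :
    Function.HasFiniteSupport (fun z : Σ z : Set t.leaf × Ξ × ℤ,
        Set (t.upper z.1 z.2.1).leaf × Ξ × ℤ => rightTerm f g e h z.1 z.2 X) ∧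
      (f.preLie (g.preLie e)).app h X =
        ∑ᶠ z : Σ z : Set t.leaf × Ξ × ℤ,
          Set (t.upper z.1 z.2.1).leaf × Ξ × ℤ, rightTerm f g e h z.1 z.2 X := by
  have key : ∀ z : Set t.leaf × Ξ × ℤ,
      Function.HasFiniteSupport (fun z' => rightTerm f g e h z z' X) ∧
        preLieTerm f (g.preLie e) h z X = ∑ᶠ z', rightTerm f g e h z z' X := by
    intro z
    have := pairing_finsum_right (ks k ((p' + p'') * z.2.2)) (f.app (rfl : z.2.2 + p = _))
      ((g.preLie e).app rfl) (preLieTerm g e rfl)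
      (by omega : z.2.2 + p + (n - z.2.2 + (p' + p'')) = n') (preLieTerm_finite g e rfl)
      (fun _ => rfl) (P.cocomp (r := t.upper z.1 z.2.1) (add_sub_cancel z.2.2 n) (P.map (t.splitIso z.1 z.2.1) X))
    have h₂ := map_finsum' (k := k) (V.map (t.splitIso z.1 z.2.1).symm) _ this.1
    refine ⟨h₂.1, Eq.trans ?_ h₂.2⟩
    rw [← this.2]
    rfl
  have := finsum_sigma_eq (fun z z' => rightTerm f g e h z z' X) (by
      refine (P.cocomp_finite X).subset ?_
      rintro z ⟨z', hz⟩ h0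
      refine hz ?_
      simp only [rightTerm, treeMap, LinearMap.comp_apply]
      rw [h0]
      simp) (fun z => (key z).1)
  refine ⟨this.1, ?_⟩
  rw [this.2]
  exact finsum_congr fun z => (key z).2

end Conv

namespace Corolla

variable {Ξ : Type u} (t : Corolla Ξ) (c : t.leaf → Fin 3) (x y : Ξ)

/-- The leaves not attached to the last vertex. -/
abbrev lo : Set t.leaf := {l | c l ≠ 2}

/-- The leaves attached to the root vertex. -/
abbrev rt : Set t.leaf := {l | c l = 0}

/-- The leaves of `(t.lower (t.lo c)).cons y` attached to the root vertex; the extra leaf is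
attached to the root vertex if and only if `b` holds. -/
abbrev inn (b : Prop) : Set ((t.lower (t.lo c)).cons y).leaf :=
  {o | o.elim b fun l => c l.1 = 0}

abbrev mid : Set (t.upper (t.rt c) x).leaf := {l | c l.1 = 1}

def fibLower : ((t.fib c 0 t.out).graft (t.fib c 1 x)).Iso (t.lower (t.lo c)) where
  toEquiv := Equiv.ofBijective
    (Sum.elim (fun l => ⟨l.1, by simp [l.2]⟩) (fun l => ⟨l.1, by simp [l.2]⟩)) <| by
      constructor
      · rintro (⟨i, hi⟩ | ⟨i, hi⟩) (⟨j, hj⟩ | ⟨j, hj⟩) h <;>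
          simp only [Sum.elim_inl, Sum.elim_inr, Subtype.mk.injEq] at h <;> subst h <;>
          first | rfl | (exfalso; omega)
      · rintro ⟨l, h⟩
        have h' : c l ≠ 2 := h
        obtain h | h : c l = 0 ∨ c l = 1 := by omega
        · exact ⟨Sum.inl ⟨l, h⟩, rfl⟩
        · exact ⟨Sum.inr ⟨l, h⟩, rfl⟩
  inp_eq := by rintro (i | i) <;> rfl
  out_eq := rfl

def fibUpper : (t.fib c 2 y).Iso (t.upper (t.lo c) y) where
  toEquiv := Equiv.subtypeEquivRight fun l => by simp
  inp_eq _ := rfl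
  out_eq := rfl

def fibParLower : ((t.fib c 0 t.out).cons y).Iso
    (((t.lower (t.lo c)).cons y).lower (t.inn c y True)) where
  toEquiv := Equiv.ofBijective
    (fun o => match o with
      | none => ⟨none, trivial⟩
      | some l => ⟨some ⟨l.1, by simp [l.2]⟩, l.2⟩) <| by
      constructor
      · rintro (_ | ⟨i, hi⟩) (_ | ⟨j, hj⟩) h
        · rfl
        · exact absurd (congrArg Subtype.val h) (by simp)
        · exact absurd (congrArg Subtype.val h) (by simp)
        · have h₁ := Option.some.inj (congrArg Subtype.val h)
          have h₂ : i = j := congrArg Subtype.val h₁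
          subst h₂
          rfl
      · rintro ⟨_ | ⟨l, h⟩, h'⟩
        · exact ⟨none, rfl⟩
        · exact ⟨some ⟨l, h'⟩, rfl⟩
  inp_eq := by rintro (_ | i) <;> rfl
  out_eq := rfl

def fibParUpper : (t.fib c 1 x).Iso
    (((t.lower (t.lo c)).cons y).upper (t.inn c y True) x) where
  toEquiv := Equiv.ofBijective
    (fun l => ⟨some ⟨l.1, by simp [l.2]⟩, fun h => by
        have h₀ : c l.1 = 0 := h
        have h₁ : c l.1 = 1 := l.2
        omega⟩) <| by
      constructor
      · rintro ⟨i, hi⟩ ⟨j, hj⟩ h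
        simp_all
      · rintro ⟨_ | ⟨l, h⟩, h'⟩
        · exact absurd trivial h'
        · have h₁ : c l ≠ 2 := h
          have h₂ : c l ≠ 0 := h'
          exact ⟨⟨l, by omega⟩, rfl⟩
  inp_eq _ := rfl
  out_eq := rfl

def fibSeqLower : (t.fib c 0 t.out).Iso
    (((t.lower (t.lo c)).cons y).lower (t.inn c y False)) where
  toEquiv := Equiv.ofBijective
    (fun l => ⟨some ⟨l.1, by simp [l.2]⟩, l.2⟩) <| by
      constructor
      · rintro ⟨i, hi⟩ ⟨j, hj⟩ h
        have h₁ := Option.some.inj (congrArg Subtype.val h)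
        have h₂ : i = j := congrArg Subtype.val h₁
        subst h₂
        rfl
      · rintro ⟨_ | ⟨l, h⟩, h'⟩
        · exact absurd h' id
        · exact ⟨⟨l, h'⟩, rfl⟩
  inp_eq _ := rfl
  out_eq := rfl

def fibSeqUpper : ((t.fib c 1 x).cons y).Iso
    (((t.lower (t.lo c)).cons y).upper (t.inn c y False) x) where
  toEquiv := Equiv.ofBijective
    (fun o => match o with
      | none => ⟨none, id⟩
      | some l => ⟨some ⟨l.1, by simp [l.2]⟩, fun h => by
        have h₀ : c l.1 = 0 := h
        have h₁ : c l.1 = 1 := l.2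
        omega⟩) <| by
      constructor
      · rintro (_ | ⟨i, hi⟩) (_ | ⟨j, hj⟩) h
        · rfl
        · exact absurd (congrArg Subtype.val h) (by simp)
        · exact absurd (congrArg Subtype.val h) (by simp)
        · have h₁ := Option.some.inj (congrArg Subtype.val h)
          have h₂ : i = j := congrArg Subtype.val h₁
          subst h₂
          rfl
      · rintro ⟨_ | ⟨l, h⟩, h'⟩
        · exact ⟨none, rfl⟩
        · have h₁ : c l ≠ 2 := h
          have h₂ : c l ≠ 0 := h'
          exact ⟨some ⟨l, by omega⟩, rfl⟩
  inp_eq := by rintro (_ | i) <;> rfl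
  out_eq := rfl

def fibRoot : (t.fib c 0 t.out).Iso (t.lower (t.rt c)) := ⟨Equiv.refl _, fun _ => rfl, rfl⟩

def fibTop : ((t.fib c 1 x).graft (t.fib c 2 y)).Iso (t.upper (t.rt c) x) where
  toEquiv := Equiv.ofBijective
    (Sum.elim (fun l => ⟨l.1, by simp [l.2]⟩) (fun l => ⟨l.1, by simp [l.2]⟩)) <| by
      constructor
      · rintro (⟨i, hi⟩ | ⟨i, hi⟩) (⟨j, hj⟩ | ⟨j, hj⟩) h <;>
          simp only [Sum.elim_inl, Sum.elim_inr, Subtype.mk.injEq] at h <;> subst h <;>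
          first | rfl | (exfalso; omega)
      · rintro ⟨l, h⟩
        have h' : c l ≠ 0 := h
        obtain h | h : c l = 1 ∨ c l = 2 := by omega
        · exact ⟨Sum.inl ⟨l, h⟩, rfl⟩
        · exact ⟨Sum.inr ⟨l, h⟩, rfl⟩
  inp_eq := by rintro (i | i) <;> rfl
  out_eq := rfl

def fibTopLower : (t.fib c 1 x).Iso ((t.upper (t.rt c) x).lower (t.mid c x)) where
  toEquiv := Equiv.ofBijective (fun l => ⟨⟨l.1, by simp [l.2]⟩, l.2⟩) <| by
      constructor
      · rintro ⟨i, hi⟩ ⟨j, hj⟩ h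
        simp_all
      · rintro ⟨⟨l, h⟩, h'⟩
        exact ⟨⟨l, h'⟩, rfl⟩
  inp_eq _ := rfl
  out_eq := rfl

def fibTopUpper : (t.fib c 2 y).Iso ((t.upper (t.rt c) x).upper (t.mid c x) y) where
  toEquiv := Equiv.ofBijective (fun l => ⟨⟨l.1, by simp [l.2]⟩, fun h => by
        have h₀ : c l.1 = 1 := h
        have h₁ : c l.1 = 2 := l.2
        omega⟩) <| by
      constructor
      · rintro ⟨i, hi⟩ ⟨j, hj⟩ h
        simp_all
      · rintro ⟨⟨l, h⟩, h'⟩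
        have h₁ : c l ≠ 0 := h
        have h₂ : c l ≠ 1 := h'
        exact ⟨⟨l, by omega⟩, rfl⟩
  inp_eq _ := rfl
  out_eq := rfl

theorem tri_lo : (t.triIso c x y).trans (graftIso (t.fibLower c x) (t.fibUpper c y)) =
    t.splitIso (t.lo c) y := by
  have := Iso.conj_symm (j := t.joinTri c x y) (j' := t.joinIso (t.lo c) y) (e := Iso.refl t)
    (f := graftIso (t.fibLower c x) (t.fibUpper c y)) (Iso.ext' (by
      rintro ((i | i) | i) <;> rfl))
  exact this.symm

theorem tri_rt : ((t.triIso c x y).trans (assocIso _ _ _)).trans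
    (graftIso (t.fibRoot c) (t.fibTop c x y)) = t.splitIso (t.rt c) x := by
  have := Iso.conj_symm (j := t.joinTri c x y) (j' := t.joinIso (t.rt c) x) (e := Iso.refl t)
    (f := (assocIso _ _ _).trans (graftIso (t.fibRoot c) (t.fibTop c x y))) (Iso.ext' (by
      rintro ((i | i) | i) <;> rfl))
  exact this.symm

theorem par_split : (consIso (t.fibLower c x) (rfl : y = y)).trans
    (((t.lower (t.lo c)).cons y).splitIso (t.inn c y True) x) =
      (parIso _ _ y).symm.trans (graftIso (t.fibParLower c y) (t.fibParUpper c x y)) :=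
  Iso.conj_symm (Iso.ext' (by rintro ((_ | i) | i) <;> rfl))

theorem seq_split : (consIso (t.fibLower c x) (rfl : y = y)).trans
    (((t.lower (t.lo c)).cons y).splitIso (t.inn c y False) x) =
      (seqIso _ _ y).symm.trans (graftIso (t.fibSeqLower c y) (t.fibSeqUpper c x y)) :=
  Iso.conj_symm (Iso.ext' (by rintro (i | _ | i) <;> rfl))

theorem top_split : (t.fibTop c x y).trans ((t.upper (t.rt c) x).splitIso (t.mid c x) y) =
    (Iso.refl _).trans (graftIso (t.fibTopLower c x) (t.fibTopUpper c x y)) :=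
  Iso.conj_symm (j := Iso.refl _) (Iso.ext' (by rintro (i | i) <;> rfl))

end Corolla

namespace Corolla

variable {Ξ : Type u} (t : Corolla Ξ)

/-- Splittings of `t` into trees with three nodal vertices, with two internal degrees. -/
abbrev Idx : Type u := (t.leaf → Fin 3) × Ξ × Ξ × ℤ × ℤ

def encL (i : Bool × t.Idx) :
    Σ z : Set t.leaf × Ξ × ℤ, Set ((t.lower z.1).cons z.2.1).leaf × Ξ × ℤ :=
  ⟨(t.lo i.2.1, i.2.2.2.1, i.2.2.2.2.1),
    (t.inn i.2.1 i.2.2.2.1 (cond i.1 True False), i.2.2.1, i.2.2.2.2.2)⟩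

def encR (i : t.Idx) : Σ z : Set t.leaf × Ξ × ℤ, Set (t.upper z.1 z.2.1).leaf × Ξ × ℤ :=
  ⟨(t.rt i.1, i.2.1, i.2.2.2.2), (t.mid i.1 i.2.1, i.2.2.1, i.2.2.2.1 - i.2.2.2.2)⟩

theorem none_mem_inn (c : t.leaf → Fin 3) (y : Ξ) (b : Prop) : none ∈ t.inn c y b ↔ b := Iff.rfl

theorem some_mem_inn (c : t.leaf → Fin 3) (y : Ξ) (b : Prop) (l : {l // l ∈ t.lo c}) :
    some l ∈ t.inn c y b ↔ c l.1 = 0 := Iff.rfl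

theorem mem_mid (c : t.leaf → Fin 3) (x : Ξ) (l : {l // l ∉ t.rt c}) :
    l ∈ t.mid c x ↔ c l.1 = 1 := Iff.rfl

open Classical in
theorem encL_bijective : Function.Bijective t.encL := by
  constructor
  · let dec (z : Σ z : Set t.leaf × Ξ × ℤ, Set ((t.lower z.1).cons z.2.1).leaf × Ξ × ℤ) :
        Bool × t.Idx :=
      (decide (none ∈ z.2.1), fun l => if h : l ∈ z.1.1 then
        (if some ⟨l, h⟩ ∈ z.2.1 then 0 else 1) else 2, z.2.2.1, z.1.2.1, z.1.2.2, z.2.2.2)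
    refine Function.LeftInverse.injective (g := dec) ?_
    rintro ⟨b, c, x, y, m, m'⟩
    refine Prod.ext ?_ (Prod.ext ?_ rfl)
    · cases b
      · exact decide_eq_false id
      · exact decide_eq_true trivial
    · funext l
      change @dite _ (c l ≠ 2) (Classical.propDecidable _) (fun _ => @ite _ (c l = 0)
        (Classical.propDecidable _) 0 1) (fun _ => 2) = c l
      obtain h | h | h : c l = 0 ∨ c l = 1 ∨ c l = 2 := by omega
      all_goals simp [h]
  · rintro ⟨⟨L, y, m⟩, ⟨L', x, m'⟩⟩
    obtain ⟨c, hc⟩ : ∃ c : t.leaf → Fin 3, ∀ l, (l ∈ L ↔ c l ≠ 2) ∧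
        ∀ h : l ∈ L, (some ⟨l, h⟩ ∈ L' ↔ c l = 0) := by
      refine ⟨fun l => if h : l ∈ L then (if some ⟨l, h⟩ ∈ L' then 0 else 1) else 2, fun l => ?_⟩
      by_cases h : l ∈ L
      · by_cases h' : some ⟨l, h⟩ ∈ L' <;> simp [h, h']
      · simp [h]
    have hL : L = t.lo c := Set.ext fun l => (hc l).1
    subst hL
    refine ⟨(decide (none ∈ L'), c, x, y, m, m'), ?_⟩
    have hL' : t.inn c y (cond (decide (none ∈ L')) True False) = L' := by
      refine Set.ext ?_
      rintro (_ | ⟨l, h⟩)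
      · refine (none_mem_inn t c y _).trans ?_
        by_cases h : none ∈ L' <;> simp [h]
      · exact ((hc l).2 h).symm
    simp only [encL]
    rw [hL']

open Classical in
theorem encR_bijective : Function.Bijective t.encR := by
  constructor
  · let dec (z : Σ z : Set t.leaf × Ξ × ℤ, Set (t.upper z.1 z.2.1).leaf × Ξ × ℤ) : t.Idx :=
      (fun l => if h : l ∈ z.1.1 then 0 else (if (⟨l, h⟩ : {l // l ∉ z.1.1}) ∈ z.2.1 then 1 else 2),
        z.1.2.1, z.2.2.1, z.2.2.2 + z.1.2.2, z.1.2.2)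
    refine Function.LeftInverse.injective (g := dec) ?_
    rintro ⟨c, x, y, m, m'⟩
    refine Prod.ext ?_ ?_
    · funext l
      change @dite _ (c l = 0) (Classical.propDecidable _) (fun _ => 0) (fun _ => @ite _ (c l = 1)
        (Classical.propDecidable _) 1 2) = c l
      obtain h | h | h : c l = 0 ∨ c l = 1 ∨ c l = 2 := by omega
      all_goals simp [h]
    · simp [dec, encR]
  · rintro ⟨⟨L, x, m'⟩, ⟨L', y, m⟩⟩
    obtain ⟨c, hc⟩ : ∃ c : t.leaf → Fin 3, ∀ l, (l ∈ L ↔ c l = 0) ∧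
        ∀ h : l ∉ L, ((⟨l, h⟩ : {l // l ∉ L}) ∈ L' ↔ c l = 1) := by
      refine ⟨fun l => if h : l ∈ L then 0 else
        (if (⟨l, h⟩ : {l // l ∉ L}) ∈ L' then 1 else 2), fun l => ?_⟩
      by_cases h : l ∈ L
      · simp [h]
      · by_cases h' : (⟨l, h⟩ : {l // l ∉ L}) ∈ L' <;> simp [h, h']
    have hL : L = t.rt c := Set.ext fun l => (hc l).1
    subst hL
    refine ⟨(c, x, y, m + m', m'), ?_⟩
    have hL' : t.mid c x = L' := by
      refine Set.ext ?_
      rintro ⟨l, h⟩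
      exact ((hc l).2 h).symm
    simp only [encR]
    rw [hL', add_sub_cancel_right]

/-- Exchange of the labels `1` and `2`. -/
def swapIdx (n : ℤ) : t.Idx ≃ t.Idx where
  toFun i := (fun l => Equiv.swap 1 2 (i.1 l), i.2.2.1, i.2.1, i.2.2.2.2 + (n - i.2.2.2.1),
    i.2.2.2.2)
  invFun i := (fun l => Equiv.swap 1 2 (i.1 l), i.2.2.1, i.2.1, i.2.2.2.2 + (n - i.2.2.2.1),
    i.2.2.2.2)
  left_inv i := by
    obtain ⟨c, x, y, m, m'⟩ := i
    simp only [Equiv.swap_apply_self]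
    rw [show m' + (n - (m' + (n - m))) = m by ring]
  right_inv i := by
    obtain ⟨c, x, y, m, m'⟩ := i
    simp only [Equiv.swap_apply_self]
    rw [show m' + (n - (m' + (n - m))) = m by ring]

def fibSwap0 (c : t.leaf → Fin 3) (x : Ξ) :
    (t.fib c 0 x).Iso (t.fib (fun l => Equiv.swap 1 2 (c l)) 0 x) where
  toEquiv := Equiv.subtypeEquivRight fun l => by
    change c l = 0 ↔ Equiv.swap 1 2 (c l) = 0
    obtain h | h | h : c l = 0 ∨ c l = 1 ∨ c l = 2 := by omega
    all_goals rw [h]; decide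
  inp_eq _ := rfl
  out_eq := rfl

def fibSwap1 (c : t.leaf → Fin 3) (x : Ξ) :
    (t.fib c 2 x).Iso (t.fib (fun l => Equiv.swap 1 2 (c l)) 1 x) where
  toEquiv := Equiv.subtypeEquivRight fun l => by
    change c l = 2 ↔ Equiv.swap 1 2 (c l) = 1
    obtain h | h | h : c l = 0 ∨ c l = 1 ∨ c l = 2 := by omega
    all_goals rw [h]; decide
  inp_eq _ := rfl
  out_eq := rfl

def fibSwap2 (c : t.leaf → Fin 3) (x : Ξ) :
    (t.fib c 1 x).Iso (t.fib (fun l => Equiv.swap 1 2 (c l)) 2 x) where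
  toEquiv := Equiv.subtypeEquivRight fun l => by
    change c l = 1 ↔ Equiv.swap 1 2 (c l) = 2
    obtain h | h | h : c l = 0 ∨ c l = 1 ∨ c l = 2 := by omega
    all_goals rw [h]; decide
  inp_eq _ := rfl
  out_eq := rfl

theorem tri_swap (c : t.leaf → Fin 3) (x y : Ξ) :
    ((t.triIso c x y).trans (commIso _ _ _)).trans
      (graftIso (graftIso (t.fibSwap0 c t.out) (t.fibSwap1 c y)) (t.fibSwap2 c x)) =
    t.triIso (fun l => Equiv.swap 1 2 (c l)) y x := by
  have := Iso.conj_symm (j := t.joinTri c x y)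
    (j' := t.joinTri (fun l => Equiv.swap 1 2 (c l)) y x) (e := Iso.refl t)
    (f := (commIso _ _ _).trans
      (graftIso (graftIso (t.fibSwap0 c t.out) (t.fibSwap1 c y)) (t.fibSwap2 c x)))
    (Iso.ext' (by rintro ((i | i) | i) <;> rfl))
  exact this.symm

end Corolla

namespace Conv

variable {k : Type w} [Field k] {Ξ : Type u} {P : DGPseudoCooperad.{u, v, w} k Ξ}
  {V : Operad.{u, x, w} k Ξ} {p p' p'' : ℤ}

section

variable (f : Conv P.toColl V.toColl p) (g : Conv P.toColl V.toColl p')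
  (e : Conv P.toColl V.toColl p'') {t : Corolla Ξ} {n n' : ℤ}

def parAt (h : n + (p + p' + p'') = n') (i : t.Idx) : P.obj t n →ₗ[k] V.obj t n' :=
  parTerm f g e (t.triIso i.1 i.2.1 i.2.2.1) (add_sub_cancel i.2.2.2.2 i.2.2.2.1)
    (add_sub_cancel i.2.2.2.1 n) h

def seqAt (h : n + (p + p' + p'') = n') (i : t.Idx) : P.obj t n →ₗ[k] V.obj t n' :=
  seqTerm f g e (t.triIso i.1 i.2.1 i.2.2.1) (add_sub_cancel i.2.2.2.2 i.2.2.2.1)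
    (add_sub_cancel i.2.2.2.1 n) h

theorem leftTerm_par (h : n + (p + p' + p'') = n') (i : t.Idx) (X : P.obj t n) :
    leftTerm f g e h (t.encL (true, i)).1 (t.encL (true, i)).2 X = parAt f g e h i X := by
  obtain ⟨c, x, y, m, m'⟩ := i
  simp only [leftTerm, parAt, parTerm, encL, cond_true]
  rw [← t.tri_lo c x y]
  refine treeMap_trans _ _ _ _ _ _ _ (fun X => ?_) (e.app_map _ _) _ _ _ X
  simp only [preLieTerm]
  refine (treeTerm_map f g _ _ _ _ X).trans ?_
  refine congrArg _ ?_
  refine Eq.trans ?_ (treeTerm_trans f g (t.fibParLower c y) (t.fibParUpper c x y) _ _ _ X)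
  exact congrArg (fun j => treeTerm f g j _ _ X) (t.par_split c x y)

theorem leftTerm_seq (h : n + (p + p' + p'') = n') (i : t.Idx) (X : P.obj t n) :
    leftTerm f g e h (t.encL (false, i)).1 (t.encL (false, i)).2 X = seqAt f g e h i X := by
  obtain ⟨c, x, y, m, m'⟩ := i
  simp only [leftTerm, seqAt, seqTerm, encL, cond_false]
  rw [← t.tri_lo c x y]
  refine treeMap_trans _ _ _ _ _ _ _ (fun X => ?_) (e.app_map _ _) _ _ _ X
  simp only [preLieTerm]
  refine (treeTerm_map f g _ _ _ _ X).trans ?_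
  refine congrArg _ ?_
  refine Eq.trans ?_ (treeTerm_trans f g (t.fibSeqLower c y) (t.fibSeqUpper c x y) _ _ _ X)
  exact congrArg (fun j => treeTerm f g j _ _ X) (t.seq_split c x y)

theorem treeTerm_congr {q r : Corolla Ξ} (κ : t.Iso (q.graft r)) {a b b' : ℤ} (hb : b = b')
    (h₁ : a + b = n) (h₂ : a + b' = n) (h' : n + (p + p') = n') (X : P.obj t n) :
    treeTerm f g κ h₁ h' X = treeTerm f g κ h₂ h' X := by
  subst hb
  rfl

theorem seqTerm'_congr {q r s : Corolla Ξ} (κ : t.Iso (q.graft (r.graft s)))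
    {a b c c' bc : ℤ} (hc : c = c') (h₁ : b + c = bc) (h₁' : b + c' = bc) (h₂ : a + bc = n)
    (h' : n + (p + (p' + p'')) = n') (X : P.obj t n) :
    seqTerm' f g e κ h₁ h₂ h' X = seqTerm' f g e κ h₁' h₂ h' X := by
  subst hc
  rfl

theorem parTerm_congr {q r s : Corolla Ξ} (κ : t.Iso ((q.graft r).graft s))
    {a b c b' c' ab : ℤ} (hb : b = b') (hc : c = c') (h₁ : a + b = ab) (h₁' : a + b' = ab)
    (h₂ : ab + c = n) (h₂' : ab + c' = n) (h' : n + (p + p' + p'') = n') (X : P.obj t n) :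
    parTerm f g e κ h₁ h₂ h' X = parTerm f g e κ h₁' h₂' h' X := by
  subst hb
  subst hc
  rfl

theorem parTerm_trans {q r s q' r' s' : Corolla Ξ} (κ : t.Iso ((q.graft r).graft s))
    (α : q.Iso q') (β : r.Iso r') (γ : s.Iso s')
    {a b c ab : ℤ} (h₁ : a + b = ab) (h₂ : ab + c = n)
    (h' : n + (p + p' + p'') = n') (X : P.obj t n) :
    parTerm f g e (κ.trans (graftIso (graftIso α β) γ)) h₁ h₂ h' X =
      parTerm f g e κ h₁ h₂ h' X := by
  refine treeMap_trans _ _ _ _ _ _ _ (fun X => ?_) (e.app_map _ _) _ _ _ X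
  rw [treeTerm_map]
  refine congrArg _ ?_
  refine Eq.trans ?_ (treeTerm_trans f g (consIso α γ.out_eq) β _ _ _ X)
  refine congrArg (fun j => treeTerm f g j _ _ X) ?_
  exact Iso.conj_symm (Iso.ext' (by rintro ((_ | i) | i) <;> rfl))

theorem rightTerm_eq (h : n + (p + p' + p'') = n') (h'' : n + (p + (p' + p'')) = n')
    (i : t.Idx) (X : P.obj t n) :
    rightTerm f g e h'' (t.encR i).1 (t.encR i).2 X = seqAt f g e h i X := by
  obtain ⟨c, x, y, m, m'⟩ := i
  have h₁ : m - m' + (n - m' - (m - m')) = n - m' := by ring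
  simp only [seqAt]
  rw [seqTerm_eq f g e _ _ _ (by ring : m - m' + (n - m) = n - m') (by ring) h h'',
    seqTerm'_congr f g e _ (by ring : n - m = n - m' - (m - m')) _ h₁]
  simp only [rightTerm, seqTerm', encR]
  rw [← t.tri_rt c x y]
  refine treeMap_trans _ _ _ _ _ _ _ (f.app_map _ _) (fun X => ?_) _ _ _ X
  simp only [preLieTerm]
  refine (treeTerm_map g e _ _ _ _ X).trans ?_
  refine congrArg _ ?_
  refine Eq.trans ?_ (treeTerm_trans g e (t.fibTopLower c x) (t.fibTopUpper c x y) _ _ _ X)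
  exact congrArg (fun j => treeTerm g e j _ _ X) (t.top_split c x y)

theorem parAt_swap (h : n + (p + p' + p'') = n') (h'' : n + (p + p'' + p') = n')
    (i : t.Idx) (X : P.obj t n) :
    parAt f g e h i X = ks k (p' * p'') • parAt f e g h'' (t.swapIdx n i) X := by
  obtain ⟨c, x, y, m, m'⟩ := i
  simp only [parAt, swapIdx, Equiv.coe_fn_mk]
  rw [parTerm_eq f g e _ _ _ (rfl : m' + (n - m) = _) (by ring) h h'', ← t.tri_swap c x y,
    parTerm_trans]
  congr 1
  exact parTerm_congr f e g _ (by ring) (by ring) _ _ _ _ _ X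

theorem left_eq (h : n + (p + p' + p'') = n') (X : P.obj t n) :
    Function.HasFiniteSupport (fun i => parAt f g e h i X) ∧
      Function.HasFiniteSupport (fun i => seqAt f g e h i X) ∧
      ((f.preLie g).preLie e).app h X =
        ∑ᶠ i : t.Idx, parAt f g e h i X + ∑ᶠ i : t.Idx, seqAt f g e h i X := by
  obtain ⟨h₁, h₂⟩ := left_sum f g e h X
  have h₃ : Function.HasFiniteSupport
      (fun i : Bool × t.Idx => leftTerm f g e h (t.encL i).1 (t.encL i).2 X) :=
    Set.Finite.preimage (t.encL_bijective.injective.injOn) h₁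
  have h₄ : Function.HasFiniteSupport (fun i => parAt f g e h i X) :=
    (Set.Finite.preimage (f := fun i : t.Idx => (true, i))
      (Prod.mk_right_injective true).injOn h₃).subset fun i hi => by
        change leftTerm f g e h (t.encL (true, i)).1 (t.encL (true, i)).2 X ≠ 0
        rw [leftTerm_par]
        exact hi
  have h₅ : Function.HasFiniteSupport (fun i => seqAt f g e h i X) :=
    (Set.Finite.preimage (f := fun i : t.Idx => (false, i))
      (Prod.mk_right_injective false).injOn h₃).subset fun i hi => by
        change leftTerm f g e h (t.encL (false, i)).1 (t.encL (false, i)).2 X ≠ 0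
        rw [leftTerm_seq]
        exact hi
  refine ⟨h₄, h₅, ?_⟩
  rw [h₂, ← finsum_comp _ t.encL_bijective, finsum_curry _ h₃, finsum_eq_sum_of_fintype,
    Fintype.sum_bool]
  simp only [leftTerm_par, leftTerm_seq]

theorem right_eq (h : n + (p + p' + p'') = n') (h'' : n + (p + (p' + p'')) = n')
    (X : P.obj t n) :
    (f.preLie (g.preLie e)).app h'' X = ∑ᶠ i : t.Idx, seqAt f g e h i X := by
  rw [(right_sum f g e h'' X).2, ← finsum_comp _ t.encR_bijective]
  exact finsum_congr fun i => rightTerm_eq f g e h h'' i X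

/-- The associator of the pre-Lie product is graded symmetric in the last two arguments. -/
theorem associator_symm (h : n + (p + p' + p'') = n') (h' : n + (p + p'' + p') = n')
    (h₁ : n + (p + (p' + p'')) = n') (h₂ : n + (p + (p'' + p')) = n') (X : P.obj t n) :
    ((f.preLie g).preLie e).app h X - (f.preLie (g.preLie e)).app h₁ X =
      ks k (p' * p'') •
        (((f.preLie e).preLie g).app h' X - (f.preLie (e.preLie g)).app h₂ X) := by
  obtain ⟨h₃, -, h₄⟩ := left_eq f g e h X
  obtain ⟨h₅, -, h₆⟩ := left_eq f e g h' X
  rw [h₄, h₆, right_eq f g e h h₁, right_eq f e g h' h₂, add_sub_cancel_right,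
    add_sub_cancel_right,
    ← finsum_comp_equiv (t.swapIdx n) (f := fun i => parAt f e g h' i X), smul_finsum]
  exact finsum_congr fun i => parAt_swap f g e h h' i X

end

end Conv

/-! ### The cobar construction is a dg operad -/

section cobarOperad

variable {k : Type w} [Field k] {Ξ : Type u} (P : DGPseudoCooperad.{u, v, w} k Ξ)

/-- The cobar differential. -/
def cobarD {q : Corolla Ξ} {a b : ℤ} (h : a + 1 = b) :
    (freeOperad P.toColl).obj q a →ₗ[k] (freeOperad P.toColl).obj q b where
  toFun := Quotient.lift (Expr.d P h) fun _ _ r => Expr.d_sound P r h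
  map_add' := FreeObj.ind fun _ => FreeObj.ind fun _ => rfl
  map_smul' _ := FreeObj.ind fun _ => rfl

theorem cobarD_mk {q : Corolla Ξ} {a b : ℤ} (h : a + 1 = b) (u : Expr P.toColl q a) :
    cobarD P h (freeMk P.toColl u) = Expr.d P h u := rfl

theorem cobarD_map {q r : Corolla Ξ} (e : q.Iso r) {a b : ℤ} (h : a + 1 = b)
    (u : (freeOperad P.toColl).obj q a) :
    cobarD P h ((freeOperad P.toColl).map e u) = (freeOperad P.toColl).map e (cobarD P h u) := by
  obtain ⟨u, rfl⟩ := freeMk_surj u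
  rfl

theorem cobarD_comp {q r : Corolla Ξ} {a b c a' b' c' : ℤ} (h : a + b = c) (hc : c + 1 = c')
    (ha : a + 1 = a') (hb : b + 1 = b') (h₁ : a' + b = c') (h₂ : a + b' = c')
    (u : (freeOperad P.toColl).obj (q.cons r.out) a) (v : (freeOperad P.toColl).obj r b) :
    cobarD P hc ((freeOperad P.toColl).comp h u v) =
      (freeOperad P.toColl).comp h₁ (cobarD P ha u) v +
        ks k a • (freeOperad P.toColl).comp h₂ u (cobarD P hb v) := by
  subst ha hb
  obtain ⟨u, rfl⟩ := freeMk_surj u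
  obtain ⟨v, rfl⟩ := freeMk_surj v
  rfl

theorem cobarD_sus {q : Corolla Ξ} {a b c : ℤ} (h : a + 1 = b) (h' : b + 1 = c)
    (h₁ : a + 1 + 1 = c) (h₂ : a + (1 + 1) = c) (X : P.obj q a) :
    cobarD P h' ((sus P.toColl).app h X) = -(sus P.toColl).app h₁ (P.d rfl X) -
      ((sus P.toColl).preLie (P := P) (sus P.toColl)).app h₂ X := rfl

/-- The contribution of `(s ∂ ⊗ s) Δ` to `∂ (s • s)`. -/
def linL {t q r : Corolla Ξ} (κ : t.Iso (q.graft r)) {a b n n' : ℤ} (h : a + b = n)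
    (h' : n + 3 = n') : P.obj t n →ₗ[k] (freeOperad P.toColl).obj t n' :=
  Conv.treeMap (-ks k a) ((sus P.toColl).app (rfl : a + 1 + 1 = _) ∘ₗ P.d rfl)
    ((sus P.toColl).app (rfl : b + 1 = _)) κ h (by omega)

/-- The contribution of `(s ⊗ s ∂) Δ` to `∂ (s • s)`. -/
def linR {t q r : Corolla Ξ} (κ : t.Iso (q.graft r)) {a b n n' : ℤ} (h : a + b = n)
    (h' : n + 3 = n') : P.obj t n →ₗ[k] (freeOperad P.toColl).obj t n' :=
  Conv.treeMap 1 ((sus P.toColl).app (rfl : a + 1 = _))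
    ((sus P.toColl).app (rfl : b + 1 + 1 = _) ∘ₗ P.d rfl) κ h (by omega)

theorem linL_congr {t q r : Corolla Ξ} (κ : t.Iso (q.graft r)) {a b b' n n' : ℤ} (h : a + b = n)
    (hb : a + b' = n) (h' : n + 3 = n') (X : P.obj t n) :
    linL P κ h h' X = linL P κ hb h' X := by
  obtain rfl : b = b' := by omega
  rfl

theorem cobarD_term {t q r : Corolla Ξ} (κ : t.Iso (q.graft r)) {a b n n' n'' : ℤ}
    (h : a + b = n) (h₁ : n + (1 + 1) = n') (h₂ : n' + 1 = n'') (h₃ : n + 3 = n'')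
    (h₄ : n + (1 + 1 + 1) = n'') (h₅ : n + (1 + (1 + 1)) = n'') (X : P.obj t n) :
    cobarD P h₂ (Conv.treeTerm (P := P) (sus P.toColl) (sus P.toColl) κ h h₁ X) =
      linL P κ h h₃ X + linR P κ h h₃ X -
        Conv.treeTerm (P := P) ((sus P.toColl).preLie (P := P) (sus P.toColl)) (sus P.toColl)
          κ h h₄ X +
        Conv.treeTerm (P := P) (sus P.toColl) ((sus P.toColl).preLie (P := P) (sus P.toColl))
          κ h h₅ X := by
  simp only [Conv.treeTerm, linL, linR, Conv.treeMap, LinearMap.comp_apply, cobarD_map]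
  rw [← map_add, ← map_sub, ← map_add]
  congr 1
  generalize P.cocomp h (P.map κ X) = T
  induction T using TensorProduct.induction_on with
  | zero => simp
  | add T T' h h' => simp only [map_add, h, h']; abel
  | tmul Y Z =>
    simp only [Conv.pairing_tmul, map_smul, LinearMap.comp_apply]
    rw [cobarD_comp (a' := a + 1 + 1) (b' := b + 1 + 1) P _ h₂ rfl rfl (by omega) (by omega),
      cobarD_sus P _ _ rfl (by omega), cobarD_sus P _ _ rfl (by omega)]
    simp only [map_sub, map_neg, LinearMap.sub_apply, LinearMap.neg_apply, one_mul, ks_add,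
      ks_one, add_mul]
    have := ks_mul_self k a
    simp only [smul_add, smul_sub, smul_smul, smul_neg, mul_neg, mul_one, this, neg_smul,
      one_smul]
    have e : ∀ {i j : ℤ} (hij : i = j) (hi : b + (1 + 1) = i) (hj : b + (1 + 1) = j)
        (l₁ : a + 1 + i = n'') (l₂ : a + 1 + j = n''),
        (freeOperad P.toColl).comp l₁ ((sus P.toColl).app rfl Y)
          (((sus P.toColl).preLie (P := P) (sus P.toColl)).app hi Z) =
        (freeOperad P.toColl).comp l₂ ((sus P.toColl).app rfl Y)
          (((sus P.toColl).preLie (P := P) (sus P.toColl)).app hj Z) := by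
      rintro i _ rfl
      intros
      rfl
    have e' : ∀ {i j : ℤ} (hij : i = j) (hi : a + (1 + 1) = i) (hj : a + (1 + 1) = j)
        (l₁ : i + (b + 1) = n'') (l₂ : j + (b + 1) = n''),
        (freeOperad P.toColl).comp l₁
          (((sus P.toColl).preLie (P := P) (sus P.toColl)).app hi Y) ((sus P.toColl).app rfl Z) =
        (freeOperad P.toColl).comp l₂
          (((sus P.toColl).preLie (P := P) (sus P.toColl)).app hj Y)
          ((sus P.toColl).app rfl Z) := by
      rintro i _ rfl
      intros
      rfl
    rw [e (by ring : b + 1 + 1 = b + (1 + 1)) _ rfl _ (by omega),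
      e' (by ring : a + 1 + 1 = a + (1 + 1)) _ rfl _ (by omega)]
    abel

theorem term_d {t q r : Corolla Ξ} (κ : t.Iso (q.graft r)) {a b a' b' n n' n'' : ℤ}
    (h : a' + b' = n') (hn : n + 1 = n') (ha : a + 1 = a') (hb : b + 1 = b') (h₁ : a + b' = n)
    (h₂ : a' + b = n) (h₃ : n' + (1 + 1) = n'') (h₄ : n + 3 = n'') (X : P.obj t n) :
    Conv.treeTerm (P := P) (sus P.toColl) (sus P.toColl) κ h h₃ (P.d hn X) =
      linL P κ h₁ h₄ X + linR P κ h₂ h₄ X := by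
  subst ha hb
  simp only [Conv.treeTerm, linL, linR, Conv.treeMap, LinearMap.comp_apply]
  rw [← map_add, ← P.d_map, P.cocomp_d h hn rfl rfl h₁ h₂]
  congr 1
  simp only [map_add, map_smul]
  congr 1
  · generalize P.cocomp h₁ (P.map κ X) = T
    induction T using TensorProduct.induction_on with
    | zero => simp
    | add T T' h h' => simp only [map_add, h, h']
    | tmul Y Z => simp [Conv.pairing_tmul, ks_add]
  · generalize P.cocomp h₂ (P.map κ X) = T
    induction T using TensorProduct.induction_on with
    | zero => simp
    | add T T' h h' => simp only [map_add, smul_add, h, h']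
    | tmul Y Z => simp [Conv.pairing_tmul, smul_smul, ks_mul_self]

theorem sus_assoc [CharZero k] {t : Corolla Ξ} {n n' : ℤ} (h : n + (1 + 1 + 1) = n')
    (h₁ : n + (1 + (1 + 1)) = n') (X : P.obj t n) :
    (((sus P.toColl).preLie (P := P) (sus P.toColl)).preLie (P := P) (sus P.toColl)).app h X =
      ((sus P.toColl).preLie (P := P) ((sus P.toColl).preLie (P := P) (sus P.toColl))).app h₁
        X := by
  have := Conv.associator_symm (P := P) (sus P.toColl) (sus P.toColl) (sus P.toColl) h h h₁ h₁ X
  rw [one_mul, ks_one, neg_one_smul] at this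
  have h2 := eq_neg_iff_add_eq_zero.1 this
  rw [← two_smul k] at h2
  exact sub_eq_zero.1 ((smul_eq_zero.1 h2).resolve_left two_ne_zero)

theorem cobarD_preLie [CharZero k] {t : Corolla Ξ} {n m n' n'' : ℤ} (h₁ : n + (1 + 1) = n')
    (h₂ : n' + 1 = n'') (hm : n + 1 = m) (h₃ : m + (1 + 1) = n'') (X : P.obj t n) :
    cobarD P h₂ (((sus P.toColl).preLie (P := P) (sus P.toColl)).app h₁ X) =
      ((sus P.toColl).preLie (P := P) (sus P.toColl)).app h₃ (P.d hm X) := by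
  have h₄ : n + 3 = n'' := by omega
  have h₅ : n + (1 + 1 + 1) = n'' := by omega
  have h₆ : n + (1 + (1 + 1)) = n'' := by omega
  let F₁ := fun z : Set t.leaf × Ξ × ℤ =>
    linL P (t.splitIso z.1 z.2.1) (add_sub_cancel z.2.2 n) h₄ X
  let F₂ := fun z : Set t.leaf × Ξ × ℤ =>
    linR P (t.splitIso z.1 z.2.1) (add_sub_cancel z.2.2 n) h₄ X
  let F₃ := fun z => Conv.preLieTerm (P := P) ((sus P.toColl).preLie (P := P) (sus P.toColl))
    (sus P.toColl) h₅ z X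
  let F₄ := fun z => Conv.preLieTerm (P := P) (sus P.toColl)
    ((sus P.toColl).preLie (P := P) (sus P.toColl)) h₆ z X
  have f₁ : Function.HasFiniteSupport F₁ := by
    refine (P.cocomp_finite X).subset fun z hz h0 => hz ?_
    simp only [F₁, linL, Conv.treeMap, LinearMap.comp_apply]
    rw [h0]
    simp
  have f₂ : Function.HasFiniteSupport F₂ := by
    refine (P.cocomp_finite X).subset fun z hz h0 => hz ?_
    simp only [F₂, linR, Conv.treeMap, LinearMap.comp_apply]
    rw [h0]
    simp
  have f₃ : Function.HasFiniteSupport F₃ := Conv.preLieTerm_finite _ _ h₅ X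
  have f₄ : Function.HasFiniteSupport F₄ := Conv.preLieTerm_finite _ _ h₆ X
  have e₃₄ : ∑ᶠ z, F₃ z = ∑ᶠ z, F₄ z := sus_assoc P h₅ h₆ X
  let σ : (Set t.leaf × Ξ × ℤ) ≃ (Set t.leaf × Ξ × ℤ) :=
    (Equiv.refl _).prodCongr ((Equiv.refl _).prodCongr (Equiv.subRight 1))
  have f₁' : Function.HasFiniteSupport fun z => F₁ (σ z) :=
    Set.Finite.preimage σ.injective.injOn f₁
  have l : cobarD P h₂ (((sus P.toColl).preLie (P := P) (sus P.toColl)).app h₁ X) =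
      ∑ᶠ z, (F₁ z + F₂ z - F₃ z + F₄ z) := by
    refine (map_finsum (cobarD P h₂) (Conv.preLieTerm_finite _ _ h₁ X)).trans ?_
    exact finsum_congr fun z => cobarD_term P _ _ h₁ h₂ h₄ h₅ h₆ X
  have r : ((sus P.toColl).preLie (P := P) (sus P.toColl)).app h₃ (P.d hm X) =
      ∑ᶠ z, (F₁ (σ z) + F₂ z) := by
    refine finsum_congr fun z => ?_
    refine (term_d P _ (a := z.2.2 - 1) (b := n - z.2.2) _ hm (by omega) (by omega) (by omega)
      (by omega) h₃ h₄ X).trans ?_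
    refine congrArg (· + _) ?_
    exact linL_congr P _ _ _ h₄ X
  have f₁₂ : Function.HasFiniteSupport fun z => F₁ z + F₂ z := f₁.add f₂
  have f₁₂₃ : Function.HasFiniteSupport fun z => F₁ z + F₂ z - F₃ z := f₁₂.sub f₃
  rw [l, r, finsum_add_distrib f₁₂₃ f₄, finsum_sub_distrib f₁₂ f₃,
    finsum_add_distrib f₁ f₂, finsum_add_distrib f₁' f₂, finsum_comp_equiv σ, e₃₄]
  abel

theorem cobarD_cobarD [CharZero k] {q : Corolla Ξ} {a : ℤ} (u : Expr P.toColl q a) :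
    ∀ {b c : ℤ} (h : a + 1 = b) (h' : b + 1 = c), cobarD P h' (Expr.d P h u) = 0 := by
  induction u with
  | gen h X =>
    rename_i q a b
    intro c e h₁ h₂
    rw [← cobarD_mk]
    change cobarD P h₂ (cobarD P h₁ ((sus P.toColl).app h X)) = 0
    rw [cobarD_sus P h h₁ (by omega) (by omega), map_sub, map_neg,
      cobarD_sus P _ h₂ (by omega) (by omega), P.d_d, map_zero,
      cobarD_preLie P _ h₂ rfl (by omega)]
    abel
  | one x => intros; exact map_zero _
  | zero => intros; exact map_zero _
  | add u v ih ih' => intro b c h h'; simp only [Expr.d, map_add, ih, ih', add_zero]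
  | smul x u ih => intro b c h h'; simp only [Expr.d, map_smul, ih, smul_zero]
  | map e u ih => intro b c h h'; simp only [Expr.d, cobarD_map, ih, map_zero]
  | comp h u v ih ih' =>
    rename_i q r a b c
    intro b' c' h₁ h₂
    simp only [Expr.d, map_add, map_smul]
    rw [cobarD_comp (a' := a + 1 + 1) (b' := b + 1) P _ h₂ rfl rfl (by omega) (by omega),
      cobarD_comp (a' := a + 1) (b' := b + 1 + 1) P _ h₂ rfl rfl (by omega) (by omega),
      ih, ih', cobarD_mk, cobarD_mk, ks_add, ks_one]
    simp

/-- The cobar construction: the free operad generated by the suspension of the underlying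
collection of `P`, with the differential induced by the differential and the comultiplication
of `P`. -/
def cobar [CharZero k] : DGOperad.{u, max 1 u v w, w} k Ξ where
  toOperad := freeOperad P.toColl
  d h := cobarD P h
  d_d h h' u := by
    obtain ⟨u, rfl⟩ := freeMk_surj u
    exact cobarD_cobarD P u h h'
  d_map e _ _ h u := cobarD_map P e h u
  d_one _ _ _ := rfl
  d_comp h hc ha hb h₁ h₂ u v := cobarD_comp P h hc ha hb h₁ h₂ u v

end cobarOperad

/-! ### Cohomology operads -/

namespace DGOperad

section cohomology

variable {k : Type w} [Field k] {Ξ : Type u} (O : DGOperad.{u, x, w} k Ξ)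

/-- The subspace of cocycles. -/
def cocycles (q : Corolla Ξ) (a : ℤ) : Submodule k (O.obj q a) :=
  LinearMap.ker (O.d (rfl : a + 1 = a + 1))

/-- The subspace of coboundaries. -/
def coboundaries (q : Corolla Ξ) (a : ℤ) : Submodule k (O.cocycles q a) :=
  (LinearMap.range (O.d (sub_add_cancel a 1))).comap (O.cocycles q a).subtype

/-- The cohomology `H(O)(q)ᵃ`. -/
abbrev Coh (q : Corolla Ξ) (a : ℤ) : Type x := O.cocycles q a ⧸ O.coboundaries q a

/-- The canonical projection from cocycles to cohomology. -/
def proj (q : Corolla Ξ) (a : ℤ) : O.cocycles q a →ₗ[k] O.Coh q a :=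
  (O.coboundaries q a).mkQ

variable {O}

theorem mem_cocycles {q : Corolla Ξ} {a b : ℤ} (h : a + 1 = b) {u : O.obj q a} :
    u ∈ O.cocycles q a ↔ O.d h u = 0 := by
  subst h
  rfl

theorem mem_coboundaries {q : Corolla Ξ} {a b : ℤ} (h : b + 1 = a) {u : O.cocycles q a} :
    u ∈ O.coboundaries q a ↔ ∃ y, O.d h y = u.1 := by
  obtain rfl : b = a - 1 := by omega
  rfl

theorem proj_surj {q : Corolla Ξ} {a : ℤ} (u : O.Coh q a) : ∃ z, O.proj q a z = u :=
  Submodule.mkQ_surjective _ u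

variable (O)

def cocyclesMap {q r : Corolla Ξ} (e : q.Iso r) {a : ℤ} :
    O.cocycles q a →ₗ[k] O.cocycles r a :=
  (O.map e).restrict fun u hu => by
    rw [mem_cocycles rfl] at hu ⊢
    rw [O.d_map, hu, map_zero]

def cohMap {q r : Corolla Ξ} (e : q.Iso r) {a : ℤ} : O.Coh q a →ₗ[k] O.Coh r a :=
  (O.coboundaries q a).mapQ (O.coboundaries r a) (O.cocyclesMap e) fun u hu => by
    obtain ⟨y, hy⟩ := (mem_coboundaries (sub_add_cancel a 1)).1 hu
    refine (mem_coboundaries (sub_add_cancel a 1)).2 ⟨O.map e y, ?_⟩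
    rw [O.d_map, hy]
    rfl

def cocyclesComp {q r : Corolla Ξ} {a b c : ℤ} (h : a + b = c) :
    O.cocycles (q.cons r.out) a →ₗ[k] O.cocycles r b →ₗ[k] O.cocycles (q.graft r) c :=
  LinearMap.mk₂ k (fun u v => ⟨O.comp h u.1 v.1, by
      have hu := (mem_cocycles rfl).1 u.2
      have hv := (mem_cocycles rfl).1 v.2
      rw [mem_cocycles rfl, O.d_comp h rfl rfl rfl (by omega) (by omega), hu, hv]
      simp⟩)
    (fun u u' v => Subtype.ext (by simp)) (fun x u v => Subtype.ext (by simp))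
    (fun u v v' => Subtype.ext (by simp)) (fun x u v => Subtype.ext (by simp))

theorem cocyclesComp_left {q r : Corolla Ξ} {a b c : ℤ} (h : a + b = c)
    (u : O.cocycles (q.cons r.out) a) (hu : u ∈ O.coboundaries (q.cons r.out) a)
    (v : O.cocycles r b) : O.cocyclesComp h u v ∈ O.coboundaries (q.graft r) c := by
  obtain ⟨y, hy⟩ := (mem_coboundaries (sub_add_cancel a 1)).1 hu
  refine (mem_coboundaries (sub_add_cancel c 1)).2 ⟨O.comp (by omega) y v.1, ?_⟩
  have hv := (mem_cocycles rfl).1 v.2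
  rw [O.d_comp _ _ (sub_add_cancel a 1) rfl h (by omega), hy, hv]
  simp [cocyclesComp]

theorem cocyclesComp_right {q r : Corolla Ξ} {a b c : ℤ} (h : a + b = c)
    (u : O.cocycles (q.cons r.out) a) (v : O.cocycles r b) (hv : v ∈ O.coboundaries r b) :
    O.cocyclesComp h u v ∈ O.coboundaries (q.graft r) c := by
  obtain ⟨y, hy⟩ := (mem_coboundaries (sub_add_cancel b 1)).1 hv
  refine (mem_coboundaries (sub_add_cancel c 1)).2 ⟨ks k a • O.comp (by omega) u.1 y, ?_⟩
  have hu := (mem_cocycles rfl).1 u.2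
  rw [map_smul, O.d_comp (b := b - 1) _ _ rfl (sub_add_cancel b 1) (by omega) h, hy, hu]
  simp [cocyclesComp, smul_smul, ks_mul_self]

def cohComp {q r : Corolla Ξ} {a b c : ℤ} (h : a + b = c) :
    O.Coh (q.cons r.out) a →ₗ[k] O.Coh r b →ₗ[k] O.Coh (q.graft r) c :=
  (O.coboundaries _ a).liftQ
    (LinearMap.flip ((O.coboundaries _ b).liftQ
      (LinearMap.flip ((O.cocyclesComp h).compr₂ (O.proj _ c))) (fun v hv => by
        refine LinearMap.ext fun u => ?_
        exact (Submodule.Quotient.mk_eq_zero _).2 (O.cocyclesComp_right h u v hv))))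
    (fun u hu => by
      refine LinearMap.ext fun v => ?_
      obtain ⟨v, rfl⟩ := proj_surj v
      exact (Submodule.Quotient.mk_eq_zero _).2 (O.cocyclesComp_left h u hu v))

/-- The cohomology operad `H(O)`, with the zero differential. -/
def cohomology : DGOperad.{u, x, w} k Ξ where
  obj := O.Coh
  map e := O.cohMap e
  map_refl u := by
    obtain ⟨u, rfl⟩ := proj_surj u
    exact congrArg (O.proj _ _) (Subtype.ext (O.map_refl _))
  map_trans e f _ u := by
    obtain ⟨u, rfl⟩ := proj_surj u
    exact congrArg (O.proj _ _) (Subtype.ext (O.map_trans e f _))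
  one x := O.proj _ _ ⟨O.one x, O.d_one x rfl⟩
  comp h := O.cohComp h
  map_comp e f _ _ _ h u v := by
    obtain ⟨u, rfl⟩ := proj_surj u
    obtain ⟨v, rfl⟩ := proj_surj v
    exact congrArg (O.proj _ _) (Subtype.ext (O.map_comp e f h _ _))
  comp_seq h₁ h₂ h₃ h₄ u v z := by
    obtain ⟨u, rfl⟩ := proj_surj u
    obtain ⟨v, rfl⟩ := proj_surj v
    obtain ⟨z, rfl⟩ := proj_surj z
    exact congrArg (O.proj _ _) (Subtype.ext (O.comp_seq h₁ h₂ h₃ h₄ _ _ _))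
  comp_par h₁ h₂ h₃ h₄ u v z := by
    obtain ⟨u, rfl⟩ := proj_surj u
    obtain ⟨v, rfl⟩ := proj_surj v
    obtain ⟨z, rfl⟩ := proj_surj z
    exact congrArg (O.proj _ _) (Subtype.ext (O.comp_par h₁ h₂ h₃ h₄ _ _ _))
  one_comp h v := by
    obtain ⟨v, rfl⟩ := proj_surj v
    exact congrArg (O.proj _ _) (Subtype.ext (O.one_comp h _))
  comp_one h u := by
    obtain ⟨u, rfl⟩ := proj_surj u
    exact congrArg (O.proj _ _) (Subtype.ext (O.comp_one h _))
  d _ := 0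
  d_d _ _ _ := rfl
  d_map e _ _ _ _ := (map_zero (O.cohMap e)).symm
  d_one _ _ _ := rfl
  d_comp _ _ _ _ _ _ _ _ := by simp

end cohomology

/-! ### Morphisms and quasi-isomorphisms -/

/-- Morphisms of dg operads. -/
structure Hom {k : Type w} [Field k] {Ξ : Type u} (A : DGOperad.{u, v, w} k Ξ)
    (B : DGOperad.{u, x, w} k Ξ) where
  app : ∀ (q : Corolla Ξ) (a : ℤ), A.obj q a →ₗ[k] B.obj q a
  app_map : ∀ {q r : Corolla Ξ} (e : q.Iso r) {a : ℤ} (u : A.obj q a),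
    app r a (A.map e u) = B.map e (app q a u)
  app_one : ∀ x : Ξ, app _ 0 (A.one x) = B.one x
  app_comp : ∀ {q r : Corolla Ξ} {a b c : ℤ} (h : a + b = c) (u : A.obj (q.cons r.out) a)
    (v : A.obj r b), app _ c (A.comp h u v) = B.comp h (app _ a u) (app _ b v)
  app_d : ∀ {q : Corolla Ξ} {a b : ℤ} (h : a + 1 = b) (u : A.obj q a),
    app q b (A.d h u) = B.d h (app q a u)

namespace Hom

variable {k : Type w} [Field k] {Ξ : Type u} {A : DGOperad.{u, v, w} k Ξ}
  {B : DGOperad.{u, x, w} k Ξ} (F : A.Hom B)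

/-- The map induced on cocycles. -/
def onCocycles (q : Corolla Ξ) (a : ℤ) : A.cocycles q a →ₗ[k] B.cocycles q a :=
  (F.app q a).restrict fun u hu => by
    rw [mem_cocycles rfl] at hu ⊢
    rw [← F.app_d, hu, map_zero]

/-- The map induced on cohomology. -/
def onCoh (q : Corolla Ξ) (a : ℤ) : A.Coh q a →ₗ[k] B.Coh q a :=
  (A.coboundaries q a).mapQ (B.coboundaries q a) (F.onCocycles q a) fun u hu => by
    obtain ⟨y, hy⟩ := (mem_coboundaries (sub_add_cancel a 1)).1 hu
    refine (mem_coboundaries (sub_add_cancel a 1)).2 ⟨F.app q _ y, ?_⟩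
    rw [← F.app_d, hy]
    rfl

/-- Quasi-isomorphisms: morphisms inducing bijections on cohomology. -/
def IsQuasiIso : Prop := ∀ (q : Corolla Ξ) (a : ℤ), Function.Bijective (F.onCoh q a)

end Hom

theorem tmul_comp_tmul {k : Type w} [Field k] {M N L : Type*} [AddCommGroup M] [AddCommGroup N]
    [AddCommGroup L] [Module k M] [Module k N] [Module k L] (f : M →ₗ[k] N →ₗ[k] L) (K : Type y)
    [Field K] [Algebra k K] (u : M) (v : N) (c c' : K) :
    TensorProduct.map₂ f (LinearMap.mul k K) (u ⊗ₜ c) (v ⊗ₜ c') = f u v ⊗ₜ[k] (c * c') := rfl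

/-- The operad `O ⊗ K` for a field extension `K`, with the differential `∂ ⊗ id`. -/
def tensor {k : Type w} [Field k] {Ξ : Type u} (O : DGOperad.{u, x, w} k Ξ) (K : Type y)
    [Field K] [Algebra k K] : DGOperad.{u, max x y, w} k Ξ where
  obj q a := O.obj q a ⊗[k] K
  map e := (O.map e).rTensor K
  map_refl u := by
    induction u using TensorProduct.induction_on with
    | zero => exact map_zero _
    | add u v hu hv => rw [map_add, hu, hv]
    | tmul u c => rw [LinearMap.rTensor_tmul, O.map_refl]
  map_trans e f _ u := by
    induction u using TensorProduct.induction_on with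
    | zero => simp only [map_zero]
    | add u v hu hv => simp only [map_add, hu, hv]
    | tmul u c => simp only [LinearMap.rTensor_tmul, O.map_trans]
  one x := O.one x ⊗ₜ 1
  comp h := TensorProduct.map₂ (O.comp h) (LinearMap.mul k K)
  map_comp e f _ _ _ h u v := by
    induction u using TensorProduct.induction_on with
    | zero => simp only [map_zero, LinearMap.zero_apply]
    | add u u' hu hv => simp only [map_add, LinearMap.add_apply, hu, hv]
    | tmul u c =>
      induction v using TensorProduct.induction_on with
      | zero => simp only [map_zero]
      | add u v hu hv => simp only [map_add, hu, hv]
      | tmul v c' => simp only [LinearMap.rTensor_tmul, tmul_comp_tmul, O.map_comp]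
  comp_seq h₁ h₂ h₃ h₄ u v z := by
    induction u using TensorProduct.induction_on with
    | zero => simp only [map_zero, LinearMap.zero_apply]
    | add u u' hu hv => simp only [map_add, LinearMap.add_apply, hu, hv]
    | tmul u c =>
      induction v using TensorProduct.induction_on with
      | zero => simp only [map_zero, LinearMap.zero_apply]
      | add u v hu hv => simp only [map_add, LinearMap.add_apply, hu, hv]
      | tmul v c' =>
        induction z using TensorProduct.induction_on with
        | zero => simp only [map_zero]
        | add u v hu hv => simp only [map_add, hu, hv]
        | tmul z c'' =>
          simp only [LinearMap.rTensor_tmul, tmul_comp_tmul,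
            mul_assoc]
          exact congrArg (fun i => i ⊗ₜ[k] _) (O.comp_seq h₁ h₂ h₃ h₄ u v z)
  comp_par h₁ h₂ h₃ h₄ u v z := by
    induction u using TensorProduct.induction_on with
    | zero => simp only [map_zero, LinearMap.zero_apply, smul_zero]
    | add u u' hu hv => simp only [map_add, LinearMap.add_apply, hu, hv, smul_add]
    | tmul u c =>
      induction v using TensorProduct.induction_on with
      | zero => simp only [map_zero, LinearMap.zero_apply, smul_zero]
      | add u v hu hv => simp only [map_add, LinearMap.add_apply, hu, hv, smul_add]
      | tmul v c' =>
        induction z using TensorProduct.induction_on with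
        | zero => simp only [map_zero, LinearMap.zero_apply, smul_zero]
        | add u v hu hv => simp only [map_add, LinearMap.add_apply, hu, hv, smul_add]
        | tmul z c'' =>
          simp only [LinearMap.rTensor_tmul, tmul_comp_tmul,
            TensorProduct.smul_tmul']
          rw [mul_right_comm]
          exact congrArg (fun i => i ⊗ₜ[k] _) (O.comp_par h₁ h₂ h₃ h₄ u v z)
  one_comp h v := by
    induction v using TensorProduct.induction_on with
    | zero => simp only [map_zero]
    | add u v hu hv => simp only [map_add, hu, hv]
    | tmul v c =>
      simp only [LinearMap.rTensor_tmul, tmul_comp_tmul,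
        one_mul, O.one_comp]
  comp_one h u := by
    induction u using TensorProduct.induction_on with
    | zero => simp only [map_zero, LinearMap.zero_apply]
    | add u v hu hv => simp only [map_add, LinearMap.add_apply, hu, hv]
    | tmul v c =>
      simp only [LinearMap.rTensor_tmul, tmul_comp_tmul,
        mul_one]
      exact congrArg (fun i => i ⊗ₜ[k] _) (O.comp_one h v)
  d h := (O.d h).rTensor K
  d_d h h' u := by
    induction u using TensorProduct.induction_on with
    | zero => simp only [map_zero]
    | add u v hu hv => simp only [map_add, hu, hv, add_zero]
    | tmul u c => simp only [LinearMap.rTensor_tmul, O.d_d, TensorProduct.zero_tmul]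
  d_map e _ _ h u := by
    induction u using TensorProduct.induction_on with
    | zero => simp only [map_zero]
    | add u v hu hv => simp only [map_add, hu, hv]
    | tmul u c => simp only [LinearMap.rTensor_tmul, O.d_map]
  d_one x _ h := by simp only [LinearMap.rTensor_tmul, O.d_one, TensorProduct.zero_tmul]
  d_comp h hc ha hb h₁ h₂ u v := by
    induction u using TensorProduct.induction_on with
    | zero => simp only [map_zero, LinearMap.zero_apply, smul_zero, add_zero]
    | add u u' hu hv =>
      simp only [map_add, LinearMap.add_apply, hu, hv, smul_add]
      abel
    | tmul u c =>
      induction v using TensorProduct.induction_on with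
      | zero => simp only [map_zero, smul_zero, add_zero]
      | add u v hu hv =>
        simp only [map_add, hu, hv, smul_add]
        abel
      | tmul v c' =>
        simp only [LinearMap.rTensor_tmul, tmul_comp_tmul,
          TensorProduct.smul_tmul', ← TensorProduct.add_tmul, O.d_comp h hc ha hb h₁ h₂]

/-- The suboperad generated by a set `S` of vectors. -/
inductive Generated {k : Type w} [Field k] {Ξ : Type u} (O : DGOperad.{u, x, w} k Ξ)
    (S : ∀ (q : Corolla Ξ) (a : ℤ), Set (O.obj q a)) :
    ∀ {q : Corolla Ξ} {a : ℤ}, O.obj q a → Prop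
  | mem {q : Corolla Ξ} {a : ℤ} {u : O.obj q a} (_ : u ∈ S q a) : Generated O S u
  | zero {q : Corolla Ξ} {a : ℤ} : Generated O S (0 : O.obj q a)
  | add {q : Corolla Ξ} {a : ℤ} {u v : O.obj q a} (_ : Generated O S u) (_ : Generated O S v) :
      Generated O S (u + v)
  | smul {q : Corolla Ξ} {a : ℤ} (c : k) {u : O.obj q a} (_ : Generated O S u) :
      Generated O S (c • u)
  | map {q r : Corolla Ξ} (e : q.Iso r) {a : ℤ} {u : O.obj q a} (_ : Generated O S u) :
      Generated O S (O.map e u)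
  | one (x : Ξ) : Generated O S (O.one x)
  | comp {q r : Corolla Ξ} {a b c : ℤ} (h : a + b = c) {u : O.obj (q.cons r.out) a}
      {v : O.obj r b} (_ : Generated O S u) (_ : Generated O S v) :
      Generated O S (O.comp h u v)

end DGOperad

/-! ### Additional gradings and sprouts -/

section grading

variable {k : Type w} [Field k] {Ξ : Type u}

/-- An additional grading `P = ⨁_{k ≥ 1} 𝒢ᵏ P` by subcollections, with
`∂ (𝒢ᵏ P) ⊂ 𝒢ᵏ⁻¹ P` (where `𝒢⁰ P = 0`) and `Δ (𝒢ᵐ P) ⊂ ⨁_{r₁ + r₂ = m} 𝒢^{r₁} P ⊗ 𝒢^{r₂} P`. -/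
structure Grading (P : DGPseudoCooperad.{u, v, w} k Ξ) where
  G : ℕ → ∀ (q : Corolla Ξ) (a : ℤ), Submodule k (P.obj q a)
  zero : ∀ (q : Corolla Ξ) (a : ℤ), G 0 q a = ⊥
  isInternal : ∀ (q : Corolla Ξ) (a : ℤ), DirectSum.IsInternal fun j => G j q a
  map_mem : ∀ {q r : Corolla Ξ} (e : q.Iso r) (j : ℕ) {a : ℤ} {X : P.obj q a},
    X ∈ G j q a → P.map e X ∈ G j r a
  d_mem : ∀ {q : Corolla Ξ} (j : ℕ) {a b : ℤ} (h : a + 1 = b) {X : P.obj q a},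
    X ∈ G (j + 1) q a → P.d h X ∈ G j q b
  cocomp_mem : ∀ {q r : Corolla Ξ} (m : ℕ) {a b c : ℤ} (h : a + b = c) {X : P.obj (q.graft r) c},
    X ∈ G m (q.graft r) c → P.cocomp h X ∈ ⨆ (r₁ : ℕ) (r₂ : ℕ) (_ : r₁ + r₂ = m),
      LinearMap.range (TensorProduct.map (G r₁ (q.cons r.out) a).subtype (G r₂ r b).subtype)

namespace Grading

variable {P : DGPseudoCooperad.{u, v, w} k Ξ} (γ : Grading P)

/-- Every `𝒢ʲ P` is finite dimensional, in total. It suffices to consider the corollas with the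
inputs `0, …, N - 1`, since every corolla is isomorphic to one of these. -/
def IsFinite : Prop := ∀ j : ℕ,
  {z : (Σ N : ℕ, Fin N → Ξ) × Ξ × ℤ | γ.G j (std z.1.2 z.2.1) z.2.2 ≠ ⊥}.Finite ∧
    ∀ (q : Corolla Ξ) (a : ℤ), FiniteDimensional k (γ.G j q a)

variable {O : DGOperad.{u, x, w} k Ξ}

/-- The conditions on `ρ : Cobar(P) → H(O)`: the operad `H(O)` is generated by `ρ (s 𝒢¹ P)`, and
`ρ` vanishes on `s 𝒢ʲ P` for `j ≥ 2`. -/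
def Compatible [CharZero k] (ρ : (cobar P).Hom O.cohomology) : Prop :=
  (∀ (q : Corolla Ξ) (b : ℤ) (u : O.cohomology.obj q b), O.cohomology.Generated
    (fun q b => {u | ∃ (a : ℤ) (h : a + 1 = b), ∃ X ∈ γ.G 1 q a,
      u = ρ.app q b ((sus P.toColl).app h X)}) u) ∧
  ∀ (j : ℕ), 2 ≤ j → ∀ {q : Corolla Ξ} {a b : ℤ} (h : a + 1 = b), ∀ X ∈ γ.G j q a,
    ρ.app q b ((sus P.toColl).app h X) = 0

/-- `α` is an `n`-th MC-sprout: its curvature vanishes on `𝒢ʲ P` for `j ≤ n`. -/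
def IsSprout (n : ℕ) (α : Conv P.toColl O.toColl 1) : Prop :=
  ∀ j ≤ n, ∀ {q : Corolla Ξ} {a b : ℤ} (h : a + 2 = b), ∀ X ∈ γ.G j q a, α.curv.app h X = 0

/-- `α` maps `𝒢¹ P` to cocycles, and the composition of `α : 𝒢¹ P → Z(O)` with the projection
`Z(O) → H(O)` is the restriction to `𝒢¹ P` of the MC element of `Conv(P, H(O))` corresponding to
`ρ`. -/
def Lifts [CharZero k] (ρ : (cobar P).Hom O.cohomology) (α : Conv P.toColl O.toColl 1) : Prop :=
  ∀ {q : Corolla Ξ} {a b : ℤ} (h : a + 1 = b), ∀ X ∈ γ.G 1 q a,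
    ∃ hz : α.app h X ∈ O.cocycles q b,
      O.proj q b ⟨α.app h X, hz⟩ = ρ.app q b ((sus P.toColl).app h X)

/-- The components `β_j` and `α_j` of `β ∈ Conv(P, O ⊗ K)` and `α ∈ Conv(P, O)` in
`Hom(𝒢ʲ P, O ⊗ K)` coincide. -/
def Agree {K : Type y} [Field K] [Algebra k K] (j : ℕ)
    (β : Conv P.toColl (O.tensor K).toColl 1) (α : Conv P.toColl O.toColl 1) : Prop :=
  ∀ {q : Corolla Ξ} {a b : ℤ} (h : a + 1 = b), ∀ X ∈ γ.G j q a,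
    β.app h X = (α.app h X ⊗ₜ[k] (1 : K) : O.obj q b ⊗[k] K)

end Grading

end grading

end ColOp

end

noncomputable section

open scoped TensorProduct

universe u v w x y z

namespace ColOp

open Corolla

/-! ### The vector space of homomorphisms of collections -/

namespace Conv

section module

variable {k : Type w} [Field k] {Ξ : Type u} {P : Coll.{u, v, w} k Ξ} {V : Coll.{u, x, w} k Ξ}
  {p p' : ℤ}

/-! Write `ω = α ⊗ 1 - β`. It vanishes on `𝒢ʲ P` for `j < m`, and on `𝒢ʲ P` with `j ≤ m + 1` the
quadratic term `ω • ω` vanishes too, because `m ≥ 2`. As `α` is a sprout of order `n ≥ m + 1`, the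
component of `ω` in degree `m` is a cocycle of the differential twisted by `β`, and its first
obstruction, in degree `m + 1`, vanishes. The task is to realise this infinitesimal deformation of
`β` by an actual one.

Let `F : Cobar(P) ⊗ K → O ⊗ K` be the morphism given by `β`. On `𝒢¹ P` the vector `β` represents the
same classes as `ρ`, and these classes generate the cohomology operad. Hence `F` is a
quasi-isomorphism (`exists_cocycle_liftK`, `mem_exact_of_liftK`), and the problem can be moved to
the cobar construction.

There a second grading is available: give `s X` the weight `j - 1` for `X ∈ 𝒢ʲ P`. All weights are
nonnegative, the differential lowers the weight by one, and the cohomology sits in weight zero,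
since `ρ` kills `s 𝒢ʲ P` for `j ≥ 2` (`mem_exact_of_weight`). Represent the degree `m` component of
`ω` by cocycles of weight zero, up to the coboundary of some `κ`. The obstruction in degree `m + 1`
is exact because its image under `F` is exact. All later obstructions have positive weight and are
exact automatically. This gives a cocycle `D` for the twisted differential, of weight `j - m` on `𝒢ʲ
P` (`exists_infinitesimal`).

Such a `D` is the restriction to generators of a derivation of `Cobar(P) ⊗ K` that commutes with the
differential and shifts weights by `1 - m < 0`. It is therefore locally nilpotent and can be
exponentiated (`exists_deformation`). Composing with `F` gives an MC element equal to `β + F D` on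
`𝒢ʲ P` for `j ≤ m`, and a gauge transformation by `κ` (`exists_gauge`) adds `∂κ` there. Since `F D +
∂κ = ω` on these components, the result equals `α`.

Both exponentials are instances of one power series argument (`exists_flow`) followed by summation
with respect to the additional grading (`exists_sum`). Choices are made compatible with isomorphisms
of corollas by averaging (`exists_conv`). -/

theorem ext_app {f g : Conv P V p}
    (h : ∀ {t : Corolla Ξ} {a b : ℤ} (h : a + p = b) (X : P.obj t a), f.app h X = g.app h X) :
    f = g := by
  obtain ⟨f, _⟩ := f
  obtain ⟨g, _⟩ := g
  congr 1
  funext t a b e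
  exact LinearMap.ext fun X => h e X

instance : Zero (Conv P V p) := ⟨⟨fun _ => 0, by simp⟩⟩

instance : Add (Conv P V p) := ⟨fun f g => ⟨fun h => f.app h + g.app h, by simp [app_map]⟩⟩

instance : Neg (Conv P V p) := ⟨fun f => ⟨fun h => -f.app h, by simp [app_map]⟩⟩

instance : SMul k (Conv P V p) := ⟨fun c f => ⟨fun h => c • f.app h, by simp [app_map]⟩⟩

variable {t : Corolla Ξ} {a b : ℤ}

@[simp] theorem zero_app (h : a + p = b) (X : P.obj t a) : (0 : Conv P V p).app h X = 0 := rfl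

@[simp] theorem add_app (f g : Conv P V p) (h : a + p = b) (X : P.obj t a) :
    (f + g).app h X = f.app h X + g.app h X := rfl

@[simp] theorem neg_app (f : Conv P V p) (h : a + p = b) (X : P.obj t a) :
    (-f).app h X = -f.app h X := rfl

@[simp] theorem smul_app (c : k) (f : Conv P V p) (h : a + p = b) (X : P.obj t a) :
    (c • f).app h X = c • f.app h X := rfl

instance : AddCommGroup (Conv P V p) where
  add_assoc f g e := ext_app fun h X => by simp [add_assoc]
  add_comm f g := ext_app fun h X => by simp [add_comm]
  zero_add f := ext_app fun h X => by simp
  add_zero f := ext_app fun h X => by simp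
  neg_add_cancel f := ext_app fun h X => by simp
  nsmul := nsmulRec
  zsmul := zsmulRec

instance : Module k (Conv P V p) where
  one_smul f := ext_app fun h X => by simp
  mul_smul c c' f := ext_app fun h X => by simp [mul_smul]
  smul_zero c := ext_app fun h X => by simp
  smul_add c f g := ext_app fun h X => by simp
  add_smul c c' f := ext_app fun h X => by simp [add_smul]
  zero_smul f := ext_app fun h X => by simp

@[simp] theorem sub_app (f g : Conv P V p) (h : a + p = b) (X : P.obj t a) :
    (f - g).app h X = f.app h X - g.app h X := by
  rw [sub_eq_add_neg, add_app, neg_app, sub_eq_add_neg]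

theorem add_app_eq (f g : Conv P V p) (h : a + p = b) :
    (f + g).app (t := t) h = f.app h + g.app h := rfl

theorem smul_app_eq (c : k) (f : Conv P V p) (h : a + p = b) :
    (c • f).app (t := t) h = c • f.app h := rfl

/-- Evaluation at a vector. -/
def eval (h : a + p = b) (X : P.obj t a) : Conv P V p →ₗ[k] V.obj t b where
  toFun f := f.app h X
  map_add' _ _ := rfl
  map_smul' _ _ := rfl

theorem sum_app {ι : Type*} (s : Finset ι) (f : ι → Conv P V p) (h : a + p = b) (X : P.obj t a) :
    (∑ i ∈ s, f i).app h X = ∑ i ∈ s, (f i).app h X :=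
  map_sum (eval h X) f s

end module

/-! ### Bilinearity of the pre-Lie product -/

section mul

variable {k : Type w} [Field k] {Ξ : Type u} {P : DGPseudoCooperad.{u, v, w} k Ξ}
  {V : Operad.{u, x, w} k Ξ} {p p' q' : ℤ}

theorem preLie_app (f : Conv P.toColl V.toColl p) (g : Conv P.toColl V.toColl p')
    {t : Corolla Ξ} {a b : ℤ} (h : a + (p + p') = b) (X : P.obj t a) :
    (f.preLie g).app h X = ∑ᶠ z, preLieTerm f g h z X := rfl

theorem pairing_add_left {q r : Corolla Ξ} (σ : k) {a b a' b' c : ℤ}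
    (φ φ' : P.obj (q.cons r.out) a →ₗ[k] V.obj (q.cons r.out) a')
    (ψ : P.obj r b →ₗ[k] V.obj r b') (h : a' + b' = c) :
    pairing σ (φ + φ') ψ h = pairing σ φ ψ h + pairing σ φ' ψ h :=
  TensorProduct.ext' fun X Y => by simp [pairing_tmul]

theorem pairing_add_right {q r : Corolla Ξ} (σ : k) {a b a' b' c : ℤ}
    (φ : P.obj (q.cons r.out) a →ₗ[k] V.obj (q.cons r.out) a')
    (ψ ψ' : P.obj r b →ₗ[k] V.obj r b') (h : a' + b' = c) :
    pairing σ φ (ψ + ψ') h = pairing σ φ ψ h + pairing σ φ ψ' h :=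
  TensorProduct.ext' fun X Y => by simp [pairing_tmul]

theorem pairing_smul_left {q r : Corolla Ξ} (σ τ : k) {a b a' b' c : ℤ}
    (φ : P.obj (q.cons r.out) a →ₗ[k] V.obj (q.cons r.out) a')
    (ψ : P.obj r b →ₗ[k] V.obj r b') (h : a' + b' = c) :
    pairing σ (τ • φ) ψ h = τ • pairing σ φ ψ h :=
  TensorProduct.ext' fun X Y => by simp [pairing_tmul, smul_smul, mul_comm]

theorem pairing_smul_right {q r : Corolla Ξ} (σ τ : k) {a b a' b' c : ℤ}
    (φ : P.obj (q.cons r.out) a →ₗ[k] V.obj (q.cons r.out) a')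
    (ψ : P.obj r b →ₗ[k] V.obj r b') (h : a' + b' = c) :
    pairing σ φ (τ • ψ) h = τ • pairing σ φ ψ h :=
  TensorProduct.ext' fun X Y => by simp [pairing_tmul, smul_smul, mul_comm]

/-- The pre-Lie product as a bilinear map. -/
def mul (hp : p + p' = q') : Conv P.toColl V.toColl p →ₗ[k] Conv P.toColl V.toColl p' →ₗ[k]
    Conv P.toColl V.toColl q' :=
  -- The target degree is a variable `q'` with a proof of `p + p' = q'`, so that differently
  -- bracketed products lie in the same type and can be added.
  LinearMap.mk₂ k (fun f g => ⟨fun h => (f.preLie g).app (by omega),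
      fun e _ _ _ X => (f.preLie g).app_map e _ X⟩)
    (fun f f' g => ext_app fun h X => by
      simp only [preLie_app, add_app]
      rw [← finsum_add_distrib (preLieTerm_finite ..) (preLieTerm_finite ..)]
      refine finsum_congr fun z => ?_
      simp [preLieTerm, treeTerm, treeMap, add_app_eq, pairing_add_left])
    (fun c f g => ext_app fun h X => by
      simp only [preLie_app, smul_app]
      rw [smul_finsum]
      refine finsum_congr fun z => ?_
      simp [preLieTerm, treeTerm, treeMap, smul_app_eq, pairing_smul_left])
    (fun f g g' => ext_app fun h X => by
      simp only [preLie_app, add_app]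
      rw [← finsum_add_distrib (preLieTerm_finite ..) (preLieTerm_finite ..)]
      refine finsum_congr fun z => ?_
      simp [preLieTerm, treeTerm, treeMap, add_app_eq, pairing_add_right])
    (fun c f g => ext_app fun h X => by
      simp only [preLie_app, smul_app]
      rw [smul_finsum]
      refine finsum_congr fun z => ?_
      simp [preLieTerm, treeTerm, treeMap, smul_app_eq, pairing_smul_right])

theorem mul_app (hp : p + p' = q') (f : Conv P.toColl V.toColl p) (g : Conv P.toColl V.toColl p')
    {t : Corolla Ξ} {a b : ℤ} (h : a + q' = b) (h' : a + (p + p') = b) (X : P.obj t a) :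
    (mul hp f g).app h X = (f.preLie g).app h' X := rfl

/-- The associator of the pre-Lie product is graded symmetric in the last two arguments. -/
theorem mul_associator {p'' p₁ p₂ p₃ n : ℤ} (f : Conv P.toColl V.toColl p)
    (g : Conv P.toColl V.toColl p') (e : Conv P.toColl V.toColl p'')
    (h₁ : p + p' = p₁) (h₂ : p₁ + p'' = n) (h₃ : p' + p'' = p₂) (h₄ : p + p₂ = n)
    (h₅ : p + p'' = p₃) (h₆ : p₃ + p' = n) (h₇ : p'' + p' = p₂) :
    mul h₂ (mul h₁ f g) e - mul h₄ f (mul h₃ g e) =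
      ks k (p' * p'') • (mul h₆ (mul h₅ f e) g - mul h₄ f (mul h₇ e g)) := by
  subst h₁ h₃ h₅ h₂
  -- After the substitutions the products of `g, e` and of `e, g` carry the syntactically different
  -- degrees `p' + p''` and `p'' + p'`; `key` moves between them.
  have key : ∀ {r : ℤ} (hr : p'' + p' = r) (h : p + r = p + p' + p'') {t : Corolla Ξ} {a b : ℤ}
      (i : a + (p + p' + p'') = b) (j : a + (p + (p'' + p')) = b) (X : P.obj t a),
      (mul h f (mul hr e g)).app i X = (f.preLie (e.preLie g)).app j X := by
    rintro _ rfl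
    intros
    rfl
  refine ext_app fun {t a b} h X => ?_
  simp only [sub_app, smul_app]
  rw [key h₇ h₄ h (by omega)]
  exact associator_symm f g e h (by omega) (by omega) (by omega) X

end mul

/-! ### The differential -/

section diff

variable {k : Type w} [Field k] {Ξ : Type u} {P : DGPseudoCooperad.{u, v, w} k Ξ}
  {O : DGOperad.{u, x, w} k Ξ} {p p' : ℤ}

/-- The differential as a linear map. -/
def dif (hp : p + 1 = p') : Conv P.toColl O.toColl p →ₗ[k] Conv P.toColl O.toColl p' where
  toFun f := ⟨fun h => f.diff.app (by omega), fun e _ _ _ X => f.diff.app_map e _ X⟩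
  map_add' f g := ext_app fun h X => by
    simp only [diff, add_app, LinearMap.sub_apply, LinearMap.comp_apply, map_add,
      LinearMap.smul_apply, smul_add]
    abel
  map_smul' c f := ext_app fun h X => by
    simp only [diff, smul_app, LinearMap.sub_apply, LinearMap.comp_apply, map_smul,
      LinearMap.smul_apply, smul_sub, RingHom.id_apply, smul_comm c]

theorem dif_app (hp : p + 1 = p') (f : Conv P.toColl O.toColl p) {t : Corolla Ξ} {a b c a' : ℤ}
    (h : a + p' = c) (hb : a + p = b) (hc : b + 1 = c) (ha : a + 1 = a') (h' : a' + p = c)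
    (X : P.obj t a) :
    (dif hp f).app h X = O.d hc (f.app hb X) - ks k p • f.app h' (P.d ha X) := by
  subst hb ha
  rfl

theorem dif_dif {p'' : ℤ} (hp : p + 1 = p') (hp' : p' + 1 = p'') (f : Conv P.toColl O.toColl p) :
    dif hp' (dif hp f) = 0 := by
  refine ext_app fun {t a b} h X => ?_
  rw [dif_app (b := a + p') (a' := a + 1) hp' _ h rfl (by omega) rfl (by omega),
    dif_app (b := a + p) (a' := a + 1) hp _ _ rfl (by omega) rfl (by omega),
    dif_app (b := a + 1 + p) (a' := a + 1 + 1) hp _ _ rfl (by omega) rfl (by omega)]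
  simp only [map_sub, O.d_d, map_smul, P.d_d, map_zero, smul_zero, sub_zero, zero_sub, zero_app]
  have h₁ : ∀ {i : ℤ} (hi : a + 1 + p = i) (hi' : i + 1 = b),
      O.d hi' (f.app hi (P.d rfl X)) = O.d (by omega) (f.app rfl (P.d rfl X)) := by
    rintro _ rfl _
    rfl
  -- The two mixed terms `∂_O f ∂_P` cancel because the degree has changed parity.
  have h₂ : ks k p' = -ks k p := by rw [← hp, ks_add, ks_one, mul_neg_one]
  rw [h₁, h₂]
  module

/-- In degree one the sign in the bracket gives `[α, α] = 2 α • α`. From here on the MC equation is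
used in the form `∂α + α • α = 0`. -/
theorem curv_eq (α : Conv P.toColl O.toColl 1) [CharZero k] :
    α.curv = dif (by norm_num) α + mul (V := O.toOperad) (by norm_num) α α := by
  refine ext_app fun {t a b} h X => ?_
  have h' : a + (1 + 1) = b := by omega
  change α.diff.app _ X + (1 / 2 : k) • ((α.preLie (V := O.toOperad) α).app h' X -
    ks k (1 * 1) • (α.preLie (V := O.toOperad) α).app _ X) =
    α.diff.app _ X + (α.preLie (V := O.toOperad) α).app h' X
  have h₂ : ks k (1 * 1) = -1 := by rw [mul_one, ks_one]
  rw [h₂, neg_one_smul, sub_neg_eq_add, smul_add, ← add_smul, add_halves, one_smul]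

theorem isMC_iff [CharZero k] (α : Conv P.toColl O.toColl 1) :
    α.IsMC ↔ dif (p' := 2) (by norm_num) α + mul (V := O.toOperad) (by norm_num) α α = 0 := by
  rw [← curv_eq]
  exact ⟨fun h => ext_app fun h' X => h _ _ _ h' X, fun h t a b h' X => by rw [h]; rfl⟩

end diff

end Conv

/-! ### Composition with maps of collections -/

/-- A family of linear maps of degree zero, compatible with isomorphisms of corollas. -/
structure CollMap {k : Type w} [Field k] {Ξ : Type u} (V : Coll.{u, v, w} k Ξ)
    (V' : Coll.{u, x, w} k Ξ) where
  app : ∀ (q : Corolla Ξ) (a : ℤ), V.obj q a →ₗ[k] V'.obj q a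
  app_map : ∀ {q r : Corolla Ξ} (e : q.Iso r) {a : ℤ} (u : V.obj q a),
    app r a (V.map e u) = V'.map e (app q a u)

namespace Conv

section push

variable {k : Type w} [Field k] {Ξ : Type u} {P : Coll.{u, v, w} k Ξ} {V : Coll.{u, x, w} k Ξ}
  {V' : Coll.{u, y, w} k Ξ} {p : ℤ}

/-- Composition with a map of collections. -/
def push (Φ : CollMap V V') : Conv P V p →ₗ[k] Conv P V' p where
  toFun f := ⟨fun h => Φ.app _ _ ∘ₗ f.app h, fun e _ _ h X => by
    simp only [LinearMap.comp_apply, f.app_map, Φ.app_map]⟩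
  map_add' f g := ext_app fun h X => (Φ.app _ _).map_add (f.app h X) (g.app h X)
  map_smul' c f := ext_app fun h X => (Φ.app _ _).map_smul c (f.app h X)

@[simp] theorem push_app (Φ : CollMap V V') (f : Conv P V p) {t : Corolla Ξ} {a b : ℤ}
    (h : a + p = b) (X : P.obj t a) : (push Φ f).app h X = Φ.app _ _ (f.app h X) := rfl

end push

section pushMul

variable {k : Type w} [Field k] {Ξ : Type u} {P : DGPseudoCooperad.{u, v, w} k Ξ}
  {V : Operad.{u, x, w} k Ξ} {V' : Operad.{u, y, w} k Ξ} {p p' q' : ℤ}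

/-- The target operad enters the pre-Lie product only through single insertions, so any rule of
Leibniz type for `comp` passes to `mul`. One summand gives the case of a morphism, two summands give
the case of a derivation. -/
theorem push_mul {ι : Type} [Fintype ι] (Φ : CollMap V.toColl V'.toColl)
    (A B : ι → CollMap V.toColl V'.toColl)
    (hΦ : ∀ {q r : Corolla Ξ} {a b c : ℤ} (h : a + b = c) (u : V.obj (q.cons r.out) a)
      (v : V.obj r b), Φ.app _ c (V.comp h u v) =
        ∑ i, V'.comp h ((A i).app _ _ u) ((B i).app _ _ v))
    (hp : p + p' = q') (f : Conv P.toColl V.toColl p) (g : Conv P.toColl V.toColl p') :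
    push Φ (mul hp f g) = ∑ i, mul hp (push (A i) f) (push (B i) g) := by
  refine ext_app fun {t a b} h X => ?_
  have h' : a + (p + p') = b := by omega
  have e : ∀ i, (mul hp (push (A i) f) (push (B i) g)).app h X =
      ∑ᶠ z, preLieTerm (push (A i) f) (push (B i) g) h' z X := fun i => rfl
  rw [sum_app, push_app, mul_app hp f g h h', preLie_app, map_finsum _ (preLieTerm_finite ..)]
  simp only [e]
  rw [← finsum_sum_comm _ _ fun i _ => preLieTerm_finite ..]
  refine finsum_congr fun z => ?_
  simp only [preLieTerm, treeTerm, treeMap, LinearMap.comp_apply, Φ.app_map, ← map_sum]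
  congr 1
  generalize P.cocomp _ _ = T
  induction T using TensorProduct.induction_on with
  | zero => simp
  | add T T' h h' => simp only [map_add, h, h', Finset.sum_add_distrib]
  | tmul Y Z => simp only [pairing_tmul, map_smul, hΦ, push_app, Finset.smul_sum]

theorem push_mul_hom (Φ : CollMap V.toColl V'.toColl)
    (hΦ : ∀ {q r : Corolla Ξ} {a b c : ℤ} (h : a + b = c) (u : V.obj (q.cons r.out) a)
      (v : V.obj r b), Φ.app _ c (V.comp h u v) = V'.comp h (Φ.app _ _ u) (Φ.app _ _ v))
    (hp : p + p' = q') (f : Conv P.toColl V.toColl p) (g : Conv P.toColl V.toColl p') :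
    push Φ (mul hp f g) = mul hp (push Φ f) (push Φ g) := by
  rw [push_mul (ι := Unit) Φ (fun _ => Φ) (fun _ => Φ) 
    (fun h u v => by simpa using hΦ h u v)]
  simp

/-- A family of linear maps which is a derivation along `Ψ`. -/
theorem push_mul_der (Φ Ψ : CollMap V.toColl V'.toColl)
    (hΦ : ∀ {q r : Corolla Ξ} {a b c : ℤ} (h : a + b = c) (u : V.obj (q.cons r.out) a)
      (v : V.obj r b), Φ.app _ c (V.comp h u v) =
        V'.comp h (Φ.app _ _ u) (Ψ.app _ _ v) + V'.comp h (Ψ.app _ _ u) (Φ.app _ _ v))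
    (hp : p + p' = q') (f : Conv P.toColl V.toColl p) (g : Conv P.toColl V.toColl p') :
    push Φ (mul hp f g) = mul hp (push Φ f) (push Ψ g) + mul hp (push Ψ f) (push Φ g) := by
  rw [push_mul (ι := Bool) Φ (fun i => cond i Φ Ψ) (fun i => cond i Ψ Φ) 
    (fun h u v => by simpa using hΦ h u v)]
  simp

end pushMul

section pushDiff

variable {k : Type w} [Field k] {Ξ : Type u} {P : DGPseudoCooperad.{u, v, w} k Ξ}
  {A : DGOperad.{u, x, w} k Ξ} {B : DGOperad.{u, y, w} k Ξ} {p p' : ℤ}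

theorem push_dif (Φ : CollMap A.toColl B.toColl)
    (hΦ : ∀ {q : Corolla Ξ} {a b : ℤ} (h : a + 1 = b) (u : A.obj q a),
      Φ.app q b (A.d h u) = B.d h (Φ.app q a u))
    (hp : p + 1 = p') (f : Conv P.toColl A.toColl p) :
    push Φ (dif hp f) = dif hp (push Φ f) := by
  refine ext_app fun {t a b} h X => ?_
  rw [push_app, dif_app hp f h rfl (by omega) rfl (by omega),
    dif_app hp _ h rfl (by omega) rfl (by omega), map_sub, map_smul, hΦ]
  rfl

end pushDiff

/-! ### The differential is a derivation of the pre-Lie product -/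

section difMul

variable {k : Type w} [Field k] {Ξ : Type u} {P : DGPseudoCooperad.{u, v, w} k Ξ}
  {O : DGOperad.{u, x, w} k Ξ} {p p' : ℤ}

/-- The contribution of `(f ∂ ⊗ g) Δ` to `∂ (f • g)`. -/
def diffLeft (f : Conv P.toColl O.toColl p) (g : Conv P.toColl O.toColl p')
    {t q r : Corolla Ξ} (κ : t.Iso (q.graft r)) {a b n n' : ℤ} (h : a + b = n)
    (h' : n + (p + p' + 1) = n') : P.obj t n →ₗ[k] O.obj t n' :=
  treeMap (V := O.toOperad) (ks k (p' * (a + 1))) (f.app (rfl : a + 1 + p = _) ∘ₗ P.d rfl)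
    (g.app (rfl : b + p' = _)) κ h (by omega)

/-- The contribution of `(f ⊗ g ∂) Δ` to `∂ (f • g)`. -/
def diffRight (f : Conv P.toColl O.toColl p) (g : Conv P.toColl O.toColl p')
    {t q r : Corolla Ξ} (κ : t.Iso (q.graft r)) {a b n n' : ℤ} (h : a + b = n)
    (h' : n + (p + p' + 1) = n') : P.obj t n →ₗ[k] O.obj t n' :=
  treeMap (V := O.toOperad) (ks k (p' * a + a)) (f.app (rfl : a + p = _))
    (g.app (rfl : b + 1 + p' = _) ∘ₗ P.d rfl) κ h (by omega)

theorem diffLeft_congr (f : Conv P.toColl O.toColl p) (g : Conv P.toColl O.toColl p')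
    {t q r : Corolla Ξ} (κ : t.Iso (q.graft r)) {a b b' n n' : ℤ} (h : a + b = n)
    (hb : a + b' = n) (h' : n + (p + p' + 1) = n') (X : P.obj t n) :
    diffLeft f g κ h h' X = diffLeft f g κ hb h' X := by
  obtain rfl : b = b' := by omega
  rfl

/-- The operadic differential distributes over the insertion. Rewriting `∂_O f` and `∂_O g` through
`∂f` and `∂g` leaves terms containing `∂_P`; these are `diffLeft` and `diffRight`, and they cancel
in `dif_mul` against `treeTerm_d`. -/
theorem d_treeTerm (f : Conv P.toColl O.toColl p) (g : Conv P.toColl O.toColl p')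
    {p₁ p₂ : ℤ} (hp₁ : p + 1 = p₁) (hp₂ : p' + 1 = p₂)
    {t q r : Corolla Ξ} (κ : t.Iso (q.graft r)) {a b n n' n'' : ℤ}
    (h : a + b = n) (h₁ : n + (p + p') = n') (h₂ : n' + 1 = n'') (h₃ : n + (p + p' + 1) = n'')
    (h₄ : n + (p₁ + p') = n'') (h₅ : n + (p + p₂) = n'') (X : P.obj t n) :
    O.d h₂ (treeTerm (V := O.toOperad) f g κ h h₁ X) =
      treeTerm (V := O.toOperad) (dif hp₁ f) g κ h h₄ X +
        ks k p • treeTerm (V := O.toOperad) f (dif hp₂ g) κ h h₅ X +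
        ks k (p + p') • (diffLeft f g κ h h₃ X + diffRight f g κ h h₃ X) := by
  subst hp₁ hp₂
  simp only [treeTerm, diffLeft, diffRight, treeMap, LinearMap.comp_apply, O.d_map]
  simp only [← map_add, ← (O.map κ.symm).map_smul]
  congr 1
  generalize P.cocomp h (P.map κ X) = T
  induction T using TensorProduct.induction_on with
  | zero => simp
  | add T T' h h' => simp only [map_add, h, h', smul_add]; abel
  | tmul Y Z =>
    simp only [pairing_tmul, map_smul, LinearMap.comp_apply]
    rw [O.d_comp (a' := a + p + 1) (b' := b + p' + 1) _ h₂ rfl rfl (by omega) (by omega)]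
    -- `e₁` and `e₂` expand `∂f` and `∂g`; `c₁` to `c₄` only change the way in which equal integer
    -- degrees are written.
    have e₁ : ∀ {i : ℤ} (hi : a + (p + 1) = i) (hi' : i + (b + p') = n'')
        (j₁ : a + p + 1 = i) (j₂ : a + 1 + p = i),
        O.comp hi' ((dif rfl f).app hi Y) (g.app rfl Z) =
          O.comp hi' (O.d j₁ (f.app rfl Y)) (g.app rfl Z) -
            ks k p • O.comp hi' (f.app j₂ (P.d rfl Y)) (g.app rfl Z) := by
      intro i hi hi' j₁ j₂
      rw [dif_app rfl f hi rfl j₁ rfl j₂, map_sub, map_smul, LinearMap.sub_apply,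
        LinearMap.smul_apply]
    have e₂ : ∀ {i : ℤ} (hi : b + (p' + 1) = i) (hi' : (a + p) + i = n'')
        (j₁ : b + p' + 1 = i) (j₂ : b + 1 + p' = i),
        O.comp hi' (f.app rfl Y) ((dif rfl g).app hi Z) =
          O.comp hi' (f.app rfl Y) (O.d j₁ (g.app rfl Z)) -
            ks k p' • O.comp hi' (f.app rfl Y) (g.app j₂ (P.d rfl Z)) := by
      intro i hi hi' j₁ j₂
      rw [dif_app rfl g hi rfl j₁ rfl j₂, map_sub, map_smul]
    have c₁ : ∀ {i j : ℤ} (hij : i = j) (hi : i + (b + p') = n'') (hj : j + (b + p') = n'')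
        (j₁ : a + p + 1 = i) (j₂ : a + p + 1 = j),
        O.comp hi (O.d j₁ (f.app rfl Y)) (g.app rfl Z) =
          O.comp hj (O.d j₂ (f.app rfl Y)) (g.app rfl Z) := by
      rintro i _ rfl
      intros
      rfl
    have c₂ : ∀ {i j : ℤ} (hij : i = j) (hi : i + (b + p') = n'') (hj : j + (b + p') = n'')
        (j₁ : a + 1 + p = i) (j₂ : a + 1 + p = j),
        O.comp hi (f.app j₁ (P.d rfl Y)) (g.app rfl Z) =
          O.comp hj (f.app j₂ (P.d rfl Y)) (g.app rfl Z) := by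
      rintro i _ rfl
      intros
      rfl
    have c₃ : ∀ {i j : ℤ} (hij : i = j) (hi : a + p + i = n'') (hj : a + p + j = n'')
        (j₁ : b + p' + 1 = i) (j₂ : b + p' + 1 = j),
        O.comp hi (f.app rfl Y) (O.d j₁ (g.app rfl Z)) =
          O.comp hj (f.app rfl Y) (O.d j₂ (g.app rfl Z)) := by
      rintro i _ rfl
      intros
      rfl
    have c₄ : ∀ {i j : ℤ} (hij : i = j) (hi : a + p + i = n'') (hj : a + p + j = n'')
        (j₁ : b + 1 + p' = i) (j₂ : b + 1 + p' = j),
        O.comp hi (f.app rfl Y) (g.app j₁ (P.d rfl Z)) =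
          O.comp hj (f.app rfl Y) (g.app j₂ (P.d rfl Z)) := by
      rintro i _ rfl
      intros
      rfl
    rw [e₁ rfl _ (by omega) (by omega), e₂ rfl _ (by omega) (by omega)]
    rw [c₁ (by ring : a + (p + 1) = a + p + 1) _ (by omega) _ rfl,
      c₂ (by ring : a + (p + 1) = a + 1 + p) _ (by omega) _ rfl,
      c₃ (by ring : b + (p' + 1) = b + p' + 1) _ (by omega) _ rfl,
      c₄ (by ring : b + (p' + 1) = b + 1 + p') _ (by omega) _ rfl]
    simp only [mul_add, add_mul, one_mul, mul_one, ks_add, smul_add, smul_sub, smul_smul]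
    have s₁ := ks_mul_self k p
    have s₂ := ks_mul_self k p'
    generalize O.comp _ _ _ = A₁
    generalize O.comp _ _ _ = A₂
    generalize O.comp _ _ _ = A₃
    generalize O.comp _ _ _ = A₄
    generalize ks k (p' * a) = σ at *
    generalize ks k a = τ at *
    generalize ks k p = τ₁ at *
    generalize ks k p' = τ₂ at *
    -- With these three sign identities both sides become the same combination of `A₁, …, A₄`.
    have z₁ : τ₁ * τ₂ * (σ * τ₂) = σ * τ₁ := by linear_combination σ * τ₁ * s₂
    have z₂ : τ₁ * (σ * τ * τ₂) = τ₁ * τ₂ * (σ * τ) := by ring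
    have z₃ : τ₁ * (σ * τ) = σ * (τ * τ₁) := by ring
    simp only [z₁, z₂, z₃]
    abel

/-- The component of bidegree `(a', b')` of `Δ ∂X` comes from the components `(a' - 1, b')` and
`(a', b' - 1)` of `ΔX`; this is why the two terms are taken in different bidegrees. -/
theorem treeTerm_d (f : Conv P.toColl O.toColl p) (g : Conv P.toColl O.toColl p')
    {t q r : Corolla Ξ} (κ : t.Iso (q.graft r)) {a b a' b' n n' n'' : ℤ}
    (h : a' + b' = n') (hn : n + 1 = n') (ha : a + 1 = a') (hb : b + 1 = b') (h₁ : a + b' = n)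
    (h₂ : a' + b = n) (h₃ : n' + (p + p') = n'') (h₄ : n + (p + p' + 1) = n'') (X : P.obj t n) :
    treeTerm (V := O.toOperad) f g κ h h₃ (P.d hn X) =
      diffLeft f g κ h₁ h₄ X + diffRight f g κ h₂ h₄ X := by
  subst ha hb
  simp only [treeTerm, diffLeft, diffRight, treeMap, LinearMap.comp_apply]
  rw [← map_add, ← P.d_map, P.cocomp_d h hn rfl rfl h₁ h₂]
  congr 1
  simp only [map_add, map_smul]
  congr 1
  · generalize P.cocomp h₁ (P.map κ X) = T
    induction T using TensorProduct.induction_on with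
    | zero => simp
    | add T T' h h' => simp only [map_add, h, h']
    | tmul Y Z => simp [pairing_tmul]
  · generalize P.cocomp h₂ (P.map κ X) = T
    induction T using TensorProduct.induction_on with
    | zero => simp
    | add T T' h h' => simp only [map_add, smul_add, h, h']
    | tmul Y Z =>
      simp only [TensorProduct.map_tmul, pairing_tmul, smul_smul, LinearMap.id_apply,
        LinearMap.comp_apply, ks_add, mul_comm]

/-- Summing `d_treeTerm` and `treeTerm_d` over all trees and bidegrees, the terms with `∂_P` occur
in both sums and cancel. -/
theorem dif_mul {p₁ p₂ s s' : ℤ} (hs : p + p' = s) (hs' : s + 1 = s') (hp₁ : p + 1 = p₁)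
    (hp₂ : p' + 1 = p₂) (h₁ : p₁ + p' = s') (h₂ : p + p₂ = s')
    (f : Conv P.toColl O.toColl p) (g : Conv P.toColl O.toColl p') :
    dif hs' (mul (V := O.toOperad) hs f g) = mul (V := O.toOperad) h₁ (dif hp₁ f) g +
      ks k p • mul (V := O.toOperad) h₂ f (dif hp₂ g) := by
  subst hs
  refine ext_app fun {t n n''} h X => ?_
  have h₃ : n + (p + p' + 1) = n'' := by omega
  have h₄ : n + (p₁ + p') = n'' := by omega
  have h₅ : n + (p + p₂) = n'' := by omega
  let F₁ := fun z : Set t.leaf × Ξ × ℤ =>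
    diffLeft f g (t.splitIso z.1 z.2.1) (add_sub_cancel z.2.2 n) h₃ X
  let F₂ := fun z : Set t.leaf × Ξ × ℤ =>
    diffRight f g (t.splitIso z.1 z.2.1) (add_sub_cancel z.2.2 n) h₃ X
  let F₃ := fun z => preLieTerm (V := O.toOperad) (dif hp₁ f) g h₄ z X
  let F₄ := fun z => preLieTerm (V := O.toOperad) f (dif hp₂ g) h₅ z X
  have f₁ : Function.HasFiniteSupport F₁ := by
    refine (P.cocomp_finite X).subset fun z hz h0 => hz ?_
    simp only [F₁, diffLeft, treeMap, LinearMap.comp_apply]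
    rw [h0]
    simp
  have f₂ : Function.HasFiniteSupport F₂ := by
    refine (P.cocomp_finite X).subset fun z hz h0 => hz ?_
    simp only [F₂, diffRight, treeMap, LinearMap.comp_apply]
    rw [h0]
    simp
  have f₃ : Function.HasFiniteSupport F₃ := preLieTerm_finite _ _ h₄ X
  have f₄ : Function.HasFiniteSupport F₄ := preLieTerm_finite _ _ h₅ X
  -- The shift of the first internal degree by one, which matches the two ways of indexing the terms
  -- `F₁`.
  let σ : (Set t.leaf × Ξ × ℤ) ≃ (Set t.leaf × Ξ × ℤ) :=
    (Equiv.refl _).prodCongr ((Equiv.refl _).prodCongr (Equiv.subRight 1))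
  have f₁' : Function.HasFiniteSupport fun z => F₁ (σ z) :=
    Set.Finite.preimage σ.injective.injOn f₁
  have hsmul : ∀ (c : k) {F : Set t.leaf × Ξ × ℤ → O.obj t n''}, Function.HasFiniteSupport F →
      Function.HasFiniteSupport fun z => c • F z := fun c F hF =>
    (map_finsum' (LinearMap.lsmul k _ c) F hF).1
  have f₁₂ : Function.HasFiniteSupport fun z => F₁ z + F₂ z := f₁.add f₂
  have f₃₄ : Function.HasFiniteSupport fun z => F₃ z + ks k p • F₄ z := f₃.add (hsmul _ f₄)
  have l : O.d (a := n + (p + p')) (b := n'') (by omega)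
      ((mul (V := O.toOperad) rfl f g).app rfl X) =
      ∑ᶠ z, F₃ z + ks k p • ∑ᶠ z, F₄ z + ks k (p + p') • ∑ᶠ z, (F₁ z + F₂ z) := by
    rw [smul_finsum, smul_finsum, ← finsum_add_distrib f₃ (hsmul _ f₄),
      ← finsum_add_distrib f₃₄ (hsmul _ f₁₂)]
    refine (map_finsum (O.d _) (preLieTerm_finite _ _ rfl X)).trans ?_
    exact finsum_congr fun z => d_treeTerm f g hp₁ hp₂ _ _ rfl _ h₃ h₄ h₅ X
  have r : (mul (V := O.toOperad) rfl f g).app (a := n + 1) (b := n'') (by omega) (P.d rfl X) =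
      ∑ᶠ z, (F₁ (σ z) + F₂ z) := by
    refine finsum_congr fun z => ?_
    refine (treeTerm_d f g _ (a := z.2.2 - 1) (b := n - z.2.2) _ rfl (by omega) (by omega)
      (by omega) (by omega) (by omega) h₃ X).trans ?_
    refine congrArg (· + _) ?_
    exact diffLeft_congr f g _ _ _ h₃ X
  rw [dif_app hs' _ h rfl (by omega) rfl (by omega), l, r, finsum_add_distrib f₁ f₂,
    finsum_add_distrib f₁' f₂, finsum_comp_equiv σ, add_sub_cancel_right]
  rfl

end difMul

end Conv

/-! ### Locality with respect to the additional grading -/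

namespace Grading

section

variable {k : Type w} [Field k] {Ξ : Type u} {P : DGPseudoCooperad.{u, v, w} k Ξ} (γ : Grading P)

theorem hom_ext {q : Corolla Ξ} {a : ℤ} {M : Type*} [AddCommGroup M] [Module k M]
    {f g : P.obj q a →ₗ[k] M} (h : ∀ j, ∀ X ∈ γ.G j q a, f X = g X) : f = g := by
  refine LinearMap.ext fun X => ?_
  have hX : X ∈ ⨆ j, γ.G j q a := by
    rw [(γ.isInternal q a).submodule_iSup_eq_top]
    trivial
  induction hX using Submodule.iSup_induction' with
  | mem j X hX => exact h j X hX
  | zero => simp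
  | add X Y _ _ hX hY => rw [map_add, map_add, hX, hY]

/-- The decomposition of `P` into the components of the additional grading. -/
def dec (q : Corolla Ξ) (a : ℤ) : (DirectSum ℕ fun j => γ.G j q a) ≃ₗ[k] P.obj q a :=
  LinearEquiv.ofBijective (DirectSum.coeLinearMap fun j => γ.G j q a) (γ.isInternal q a)

theorem dec_symm {j : ℕ} {q : Corolla Ξ} {a : ℤ} {X : P.obj q a} (hX : X ∈ γ.G j q a) :
    (γ.dec q a).symm X = DirectSum.lof k ℕ (fun j => γ.G j q a) j ⟨X, hX⟩ := by
  rw [LinearEquiv.symm_apply_eq]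
  exact (DirectSum.coeLinearMap_lof (fun j => γ.G j q a) j ⟨X, hX⟩).symm

variable {V : Coll.{u, x, w} k Ξ} {p : ℤ}

theorem conv_ext {f g : Conv P.toColl V p}
    (H : ∀ j, ∀ {t : Corolla Ξ} {a b : ℤ} (h : a + p = b), ∀ X ∈ γ.G j t a,
      f.app h X = g.app h X) : f = g :=
  Conv.ext_app fun h X => LinearMap.congr_fun (γ.hom_ext fun j => H j h) X

/-- The linear map with the same restriction to `𝒢ʲ P` as `f j`, for all `j`. -/
def glueMap (f : ℕ → Conv P.toColl V p) {t : Corolla Ξ} {a b : ℤ} (h : a + p = b) :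
    P.obj t a →ₗ[k] V.obj t b :=
  DirectSum.toModule k ℕ _ (fun j => (f j).app h ∘ₗ (γ.G j t a).subtype) ∘ₗ
    (γ.dec t a).symm.toLinearMap

theorem glueMap_apply (f : ℕ → Conv P.toColl V p) {j : ℕ} {t : Corolla Ξ} {a b : ℤ}
    (h : a + p = b) {X : P.obj t a} (hX : X ∈ γ.G j t a) :
    γ.glueMap f h X = (f j).app h X := by
  simp only [glueMap, LinearMap.comp_apply, LinearEquiv.coe_coe, γ.dec_symm hX,
    DirectSum.toModule_lof, Submodule.subtype_apply]

/-- The homomorphism with the same restriction to `𝒢ʲ P` as `f j`, for all `j`. -/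
def glue (f : ℕ → Conv P.toColl V p) : Conv P.toColl V p where
  app h := γ.glueMap f h
  app_map e _ _ h X := by
    refine LinearMap.congr_fun (f := γ.glueMap f h ∘ₗ P.map e) (g := V.map e ∘ₗ γ.glueMap f h)
      (γ.hom_ext fun j Y hY => ?_) X
    simp only [LinearMap.comp_apply, γ.glueMap_apply f h hY,
      γ.glueMap_apply f h (γ.map_mem e j hY), Conv.app_map]

theorem glue_app (f : ℕ → Conv P.toColl V p) {j : ℕ} {t : Corolla Ξ} {a b : ℤ} (h : a + p = b)
    {X : P.obj t a} (hX : X ∈ γ.G j t a) : (γ.glue f).app h X = (f j).app h X :=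
  γ.glueMap_apply f h hX

/-- The homomorphisms vanishing on `𝒢ʲ P`. -/
def van (V : Coll.{u, x, w} k Ξ) (p : ℤ) (j : ℕ) : Submodule k (Conv P.toColl V p) where
  carrier := {f | ∀ (t : Corolla Ξ) (a b : ℤ) (h : a + p = b), ∀ X ∈ γ.G j t a, f.app h X = 0}
  zero_mem' _ _ _ _ _ _ := rfl
  add_mem' hf hg _ _ _ h X hX := by
    rw [Conv.add_app, hf _ _ _ h X hX, hg _ _ _ h X hX, add_zero]
  smul_mem' c f hf _ _ _ h X hX := by rw [Conv.smul_app, hf _ _ _ h X hX, smul_zero]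

/-- Degree zero imposes no condition because `𝒢⁰ P = 0`. This disposes of the boundary cases created
by indexing the grading by all natural numbers and by truncated subtraction. -/
theorem mem_van_zero (f : Conv P.toColl V p) : f ∈ γ.van V p 0 := by
  intro t a b h X hX
  rw [γ.zero, Submodule.mem_bot] at hX
  rw [hX, map_zero]

theorem eq_zero_of_van {f : Conv P.toColl V p} (hf : ∀ j, f ∈ γ.van V p j) : f = 0 :=
  γ.conv_ext fun j _ _ _ h X hX => hf j _ _ _ h X hX

/-- The component of `f` in `Hom (𝒢ᵐ P, V)`. -/
def restr (m : ℕ) (f : Conv P.toColl V p) : Conv P.toColl V p :=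
  γ.glue fun j => if j = m then f else 0

theorem restr_app {m : ℕ} (f : Conv P.toColl V p) {t : Corolla Ξ} {a b : ℤ} (h : a + p = b)
    {X : P.obj t a} (hX : X ∈ γ.G m t a) : (γ.restr m f).app h X = f.app h X := by
  rw [restr, γ.glue_app _ h hX, if_pos rfl]

theorem restr_van {m j : ℕ} (hj : j ≠ m) (f : Conv P.toColl V p) :
    γ.restr m f ∈ γ.van V p j := by
  intro t a b h X hX
  rw [restr, γ.glue_app _ h hX, if_neg hj]
  rfl

/-- If `f` maps `𝒢ᵐ P` to a subspace, so does its component on all of `P`. -/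
theorem restr_mem {m : ℕ} {f : Conv P.toColl V p} {t : Corolla Ξ} {a b : ℤ} (h : a + p = b)
    (S : Submodule k (V.obj t b)) (hS : ∀ X ∈ γ.G m t a, f.app h X ∈ S) (X : P.obj t a) :
    (γ.restr m f).app h X ∈ S := by
  rw [← Submodule.Quotient.mk_eq_zero, ← Submodule.mkQ_apply]
  refine LinearMap.congr_fun (f := S.mkQ ∘ₗ (γ.restr m f).app h) (g := 0)
    (γ.hom_ext fun j Y hY => ?_) X
  simp only [LinearMap.comp_apply, LinearMap.zero_apply, Submodule.mkQ_apply,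
    Submodule.Quotient.mk_eq_zero]
  rcases eq_or_ne j m with rfl | hj
  · rw [γ.restr_app f h hY]
    exact hS Y hY
  · rw [γ.restr_van hj f _ _ _ h Y hY]
    exact S.zero_mem

end

section

variable {k : Type w} [Field k] {Ξ : Type u} {P : DGPseudoCooperad.{u, v, w} k Ξ} (γ : Grading P)
  {V : Operad.{u, x, w} k Ξ} {p p' q' : ℤ}

/-- To show that `f • g` maps `𝒢ʲ P` to a subcollection, it suffices to consider the compositions
of values of `f` on `𝒢^{r₁} P` and values of `g` on `𝒢^{r₂} P` with `r₁ + r₂ = j`. -/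
theorem mul_mem {j : ℕ} (S : ∀ (t : Corolla Ξ) (b : ℤ), Submodule k (V.obj t b))
    (hS : ∀ {t s : Corolla Ξ} (e : t.Iso s) {b : ℤ}, ∀ u ∈ S t b, V.map e u ∈ S s b)
    (hp : p + p' = q') (f : Conv P.toColl V.toColl p) (g : Conv P.toColl V.toColl p')
    (H : ∀ r₁ r₂, r₁ + r₂ = j → ∀ {q r : Corolla Ξ} {a b a' b' c : ℤ} (ha : a + p = a')
      (hb : b + p' = b') (hc : a' + b' = c), ∀ X ∈ γ.G r₁ (q.cons r.out) a, ∀ Y ∈ γ.G r₂ r b,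
      V.comp hc (f.app ha X) (g.app hb Y) ∈ S (q.graft r) c)
    {t : Corolla Ξ} {n n' : ℤ} (h : n + q' = n') {X : P.obj t n} (hX : X ∈ γ.G j t n) :
    (Conv.mul hp f g).app h X ∈ S t n' := by
  rw [Conv.mul_app hp f g h (by omega), Conv.preLie_app]
  refine finsum_induction (· ∈ S t n') (S t n').zero_mem (fun _ _ => (S t n').add_mem)
    fun z => ?_
  simp only [Conv.preLieTerm, Conv.treeTerm, Conv.treeMap, LinearMap.comp_apply]
  refine hS _ _ ?_
  have hT := γ.cocomp_mem j (add_sub_cancel z.2.2 n)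
    (γ.map_mem (t.splitIso z.1 z.2.1) j hX)
  generalize P.cocomp _ _ = T at hT ⊢
  -- The claim becomes membership in a submodule of the tensor product, so it can be checked on each
  -- `𝒢^{r₁} P ⊗ 𝒢^{r₂} P` separately.
  rw [← Submodule.mem_comap]
  refine (iSup_le fun r₁ => iSup_le fun r₂ => iSup_le fun hr => ?_ : _ ≤ Submodule.comap _ _) hT
  rintro _ ⟨T, rfl⟩
  rw [Submodule.mem_comap]
  induction T using TensorProduct.induction_on with
  | zero => simp
  | add T T' h h' => simpa only [map_add] using add_mem h h'
  | tmul Y Z =>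
    rw [TensorProduct.map_tmul, Conv.pairing_tmul]
    exact Submodule.smul_mem _ _ (H r₁ r₂ hr rfl rfl _ _ Y.2 _ Z.2)

/-- Only splittings into two positive degrees matter, as `𝒢⁰ P = 0`. Consequently a product with a
factor that vanishes through degree `i` vanishes through degree `i + 1`; the degree estimates below
rest on this gain of one. -/
theorem mul_van {j : ℕ} (hp : p + p' = q') (f : Conv P.toColl V.toColl p)
    (g : Conv P.toColl V.toColl p')
    (H : ∀ r₁ r₂, r₁ + r₂ = j → 1 ≤ r₁ → 1 ≤ r₂ →
      f ∈ γ.van V.toColl p r₁ ∨ g ∈ γ.van V.toColl p' r₂) :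
    Conv.mul hp f g ∈ γ.van V.toColl q' j := by
  intro t a b h X hX
  refine (Submodule.mem_bot k).1 (γ.mul_mem (fun _ _ => ⊥) ?_ hp f g ?_ h hX)
  · intro t s e b u hu
    rw [(Submodule.mem_bot k).1 hu, map_zero]
    exact zero_mem _
  · intro r₁ r₂ hr q r a b a' b' c ha hb hc X hX Y hY
    have : f ∈ γ.van V.toColl p r₁ ∨ g ∈ γ.van V.toColl p' r₂ := by
      rcases Nat.eq_zero_or_pos r₁ with rfl | h₁
      · exact Or.inl (γ.mem_van_zero f)
      · rcases Nat.eq_zero_or_pos r₂ with rfl | h₂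
        · exact Or.inr (γ.mem_van_zero g)
        · exact H r₁ r₂ hr h₁ h₂
    rcases this with h | h
    · rw [h _ _ _ ha X hX]
      simp
    · rw [h _ _ _ hb Y hY]
      simp

end

section

variable {k : Type w} [Field k] {Ξ : Type u} {P : DGPseudoCooperad.{u, v, w} k Ξ} (γ : Grading P)
  {O : DGOperad.{u, x, w} k Ξ} {p p' : ℤ}

/-- On `𝒢ʲ P` the term `f ∘ ∂_P` sees `f` on `𝒢ʲ⁻¹ P`, hence the second hypothesis. For `j = 0`,
where `j - 1` is truncated, the claim is vacuous. -/
theorem dif_van {j : ℕ} (hp : p + 1 = p') {f : Conv P.toColl O.toColl p}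
    (hf : f ∈ γ.van O.toColl p j) (hf' : f ∈ γ.van O.toColl p (j - 1)) :
    Conv.dif hp f ∈ γ.van O.toColl p' j := by
  rcases j with _ | j
  · exact γ.mem_van_zero _
  intro t a b h X hX
  rw [Conv.dif_app hp f h rfl (by omega) rfl (by omega), hf _ _ _ _ X hX,
    hf' _ _ _ _ _ (γ.d_mem j rfl hX), map_zero, smul_zero, sub_zero]

end

end Grading

/-! ### Equivariant solutions of linear relations -/

/-- The first projection maps the relation onto `M`, and over a field this surjection has a linear
section. -/
theorem exists_linearMap_of_relation {k : Type*} [Field k] {M N : Type*} [AddCommGroup M]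
    [AddCommGroup N] [Module k M] [Module k N] (L : Submodule k (M × N))
    (hL : ∀ X, ∃ y, (X, y) ∈ L) : ∃ l : M →ₗ[k] N, ∀ X, (X, l X) ∈ L := by
  obtain ⟨s, hs⟩ := (LinearMap.fst k M N ∘ₗ L.subtype).exists_rightInverse_of_surjective
    (LinearMap.range_eq_top.2 fun X => by
      obtain ⟨y, hy⟩ := hL X
      exact ⟨⟨(X, y), hy⟩, rfl⟩)
  refine ⟨LinearMap.snd k M N ∘ₗ L.subtype ∘ₗ s, fun X => ?_⟩
  have : (s X).1 = (X, (s X).1.2) := Prod.ext (LinearMap.congr_fun hs X) rfl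
  exact this ▸ (s X).2

namespace Corolla

variable {Ξ : Type u}

instance (q r : Corolla Ξ) : Finite (q.Iso r) :=
  Finite.of_injective (fun e : q.Iso r => e.toEquiv) fun _ _ h =>
    Iso.ext' fun i => congrArg (fun e : q.leaf ≃ r.leaf => e i) h

/-- Isomorphic corollas. -/
def isoSetoid (Ξ : Type u) : Setoid (Corolla Ξ) where
  r q r := Nonempty (q.Iso r)
  iseqv := ⟨fun q => ⟨Iso.refl q⟩, fun ⟨e⟩ => ⟨e.symm⟩, fun ⟨e⟩ ⟨f⟩ => ⟨e.trans f⟩⟩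

/-- The equivalence `g ↦ g e` of automorphism groups. -/
def Iso.transRight (q : Corolla Ξ) (e : q.Iso q) : q.Iso q ≃ q.Iso q where
  toFun g := g.trans e
  invFun g := g.trans e.symm
  left_inv g := Iso.ext' fun i => by simp [Iso.symm]
  right_inv g := Iso.ext' fun i => by simp [Iso.symm]

end Corolla

section average

variable {k : Type w} [Field k] [CharZero k] {Ξ : Type u} {P : Coll.{u, v, w} k Ξ}
  {V : Coll.{u, x, w} k Ξ}

/-- Averaging over the automorphisms of a corolla. -/
theorem exists_equivariant_linearMap {q : Corolla Ξ} {a b : ℤ}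
    (L : Submodule k (P.obj q a × V.obj q b)) (hL : ∀ X, ∃ y, (X, y) ∈ L)
    (inv : ∀ (e : q.Iso q), ∀ z ∈ L, (P.map e z.1, V.map e z.2) ∈ L) :
    ∃ l : P.obj q a →ₗ[k] V.obj q b, (∀ X, (X, l X) ∈ L) ∧
      ∀ (e : q.Iso q) (X), l (P.map e X) = V.map e (l X) := by
  obtain ⟨l, hl⟩ := exists_linearMap_of_relation L hL
  have := Fintype.ofFinite (q.Iso q)
  -- Characteristic zero enters here: the average divides by the order of a finite automorphism
  -- group.
  have hc : (Fintype.card (q.Iso q) : k) ≠ 0 :=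
    have : Nonempty (q.Iso q) := ⟨Iso.refl q⟩
    Nat.cast_ne_zero.2 Fintype.card_ne_zero
  let l' : P.obj q a →ₗ[k] V.obj q b :=
    (Fintype.card (q.Iso q) : k)⁻¹ • ∑ g : q.Iso q, V.map g ∘ₗ l ∘ₗ P.map g.symm
  have l'_apply : ∀ X, l' X =
      (Fintype.card (q.Iso q) : k)⁻¹ • ∑ g : q.Iso q, V.map g (l (P.map g.symm X)) := by
    intro X
    simp [l', LinearMap.sum_apply]
  have cancel : ∀ (g : q.Iso q) (X : P.obj q a), P.map g (P.map g.symm X) = X := by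
    intro g X
    rw [← P.map_trans, Iso.symm_trans, P.map_refl]
  refine ⟨l', fun X => ?_, fun e X => ?_⟩
  · have h₁ : ∑ g : q.Iso q, (X, V.map g (l (P.map g.symm X))) ∈ L := by
      refine Submodule.sum_mem _ fun g _ => ?_
      simpa only [cancel] using inv g _ (hl (P.map g.symm X))
    have h₂ : (X, l' X) = (Fintype.card (q.Iso q) : k)⁻¹ •
        ∑ g : q.Iso q, (X, V.map g (l (P.map g.symm X))) := by
      refine Prod.ext ?_ ?_
      · simp only [Prod.smul_fst, Prod.fst_sum, Finset.sum_const, Finset.card_univ]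
        rw [← Nat.cast_smul_eq_nsmul k, smul_smul, inv_mul_cancel₀ hc, one_smul]
      · rw [l'_apply]
        simp only [Prod.smul_snd, Prod.snd_sum]
    rw [h₂]
    exact L.smul_mem _ h₁
  -- Equivariance of the average: translation by `e` permutes the summands.
  · rw [l'_apply, l'_apply, map_smul, map_sum, ← (Iso.transRight q e).sum_comp]
    congr 1
    refine Finset.sum_congr rfl fun g _ => ?_
    simp only [Iso.transRight, Equiv.coe_fn_mk]
    rw [V.map_trans, ← P.map_trans]
    exact congrArg (fun j => V.map e (V.map g (l (P.map j X))))
      (Iso.ext' fun i => by simp [Iso.symm, Iso.trans])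

/-- An invariant linear relation that is solvable pointwise has a solution which is a homomorphism
of collections. One solves it equivariantly at a representative of each isomorphism class of
corollas and transports the solution; equivariance makes the transport independent of the
isomorphism chosen. -/
theorem exists_conv {p : ℤ} (L : ∀ (q : Corolla Ξ) (a b : ℤ), Submodule k (P.obj q a × V.obj q b))
    (hL : ∀ (q : Corolla Ξ) (a b : ℤ), a + p = b → ∀ X, ∃ y, (X, y) ∈ L q a b)
    (inv : ∀ {q r : Corolla Ξ} (e : q.Iso r) {a b : ℤ}, ∀ z ∈ L q a b,
      (P.map e z.1, V.map e z.2) ∈ L r a b) :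
    ∃ f : Conv P V p, ∀ {q : Corolla Ξ} {a b : ℤ} (h : a + p = b) (X : P.obj q a),
      (X, f.app h X) ∈ L q a b := by
  have key : ∀ (c : Quotient (isoSetoid Ξ)) (a b : ℤ), ∃ l : P.obj c.out a →ₗ[k] V.obj c.out b,
      (a + p = b → ∀ X, (X, l X) ∈ L c.out a b) ∧
        ∀ (e : c.out.Iso c.out) (X), l (P.map e X) = V.map e (l X) := by
    intro c a b
    by_cases h : a + p = b
    · obtain ⟨l, h₁, h₂⟩ := exists_equivariant_linearMap (L c.out a b) (hL _ a b h)
        fun e => inv e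
      exact ⟨l, fun _ => h₁, h₂⟩
    · exact ⟨0, fun h' => absurd h' h, fun e X => by simp⟩
  choose l hl₁ hl₂ using key
  -- Isomorphic corollas have equal classes only propositionally, so equivariance is restated with
  -- an equation between the classes.
  have hl₂' : ∀ (c c' : Quotient (isoSetoid Ξ)) (_ : c = c') (a b : ℤ) (e : c.out.Iso c'.out) (X),
      l c' a b (P.map e X) = V.map e (l c a b X) := by
    rintro c _ rfl
    exact hl₂ c
  have rep : ∀ q : Corolla Ξ, Nonempty (q.Iso (Quotient.mk (isoSetoid Ξ) q).out) := fun q =>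
    (isoSetoid Ξ).symm (Quotient.mk_out (s := isoSetoid Ξ) q)
  let i : ∀ q : Corolla Ξ, q.Iso (Quotient.mk (isoSetoid Ξ) q).out := fun q => (rep q).some
  refine ⟨⟨fun {t a b} _ => V.map (i t).symm ∘ₗ l _ a b ∘ₗ P.map (i t), ?_⟩, ?_⟩
  · intro t s e a b h X
    simp only [LinearMap.comp_apply]
    have hc : Quotient.mk (isoSetoid Ξ) t = Quotient.mk (isoSetoid Ξ) s := Quotient.sound ⟨e⟩
    have h₁ : P.map (i s) (P.map e X) =
        P.map (((i t).symm.trans e).trans (i s)) (P.map (i t) X) := by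
      rw [← P.map_trans, ← P.map_trans]
      exact congrArg (fun j => P.map j X) (Iso.ext' fun l => by simp [Iso.symm])
    rw [h₁, hl₂' _ _ hc, ← V.map_trans, ← V.map_trans]
    exact congrArg (fun j => V.map j _) (Iso.ext' fun l => by simp [Iso.symm])
  · intro q a b h X
    have := inv (i q).symm _ (hl₁ _ a b h (P.map (i q) X))
    simp only [← P.map_trans, Iso.trans_symm, P.map_refl] at this
    exact this

end average

/-! ### Flows and their power series -/

/-- The flow of the vector field `f ↦ ζ + L f` preserves solutions of `d β + β • β = 0`. -/
theorem exists_flow {k : Type*} [Field k] [CharZero k] {M N : Type*} [AddCommGroup M]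
    [AddCommGroup N] [Module k M] [Module k N] (d : M →ₗ[k] N) (m : M →ₗ[k] M →ₗ[k] N)
    (L : M →ₗ[k] M) (L' : N →ₗ[k] N) (ζ : M)
    (h₁ : ∀ f, d (L f) = L' (d f) - (m f ζ + m ζ f))
    (h₂ : ∀ f g, m (L f) g + m f (L g) + (m (L g) f + m g (L f)) = L' (m f g + m g f))
    (h₃ : d ζ = 0) (β : M) (hβ : d β + m β β = 0) :
    ∃ b : ℕ → M, b 0 = β ∧ b 1 = ζ + L β ∧
      (∀ n : ℕ, 1 ≤ n → b (n + 1) = ((n : k) + 1)⁻¹ • L (b n)) ∧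
      ∀ n, d (b n) + ∑ i ∈ Finset.HasAntidiagonal.antidiagonal n, m (b i.1) (b i.2) = 0 := by
  -- `b n` is the coefficient of `tⁿ` in the solution of `f' = ζ + L f` with `f(0) = β`; the
  -- constant term `ζ` contributes directly to `b 1` only.
  let b : ℕ → M := fun n => Nat.rec β
    (fun n f => ((n : k) + 1)⁻¹ • ((if n = 0 then ζ else 0) + L f)) n
  have b_succ : ∀ n : ℕ, b (n + 1) = ((n : k) + 1)⁻¹ • ((if n = 0 then ζ else 0) + L (b n)) :=
    fun n => rfl
  have hn : ∀ n : ℕ, (n : k) + 1 ≠ 0 := Nat.cast_add_one_ne_zero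
  have b_succ' : ∀ n : ℕ, ((n : k) + 1) • b (n + 1) = (if n = 0 then ζ else 0) + L (b n) := by
    intro n
    rw [b_succ, smul_smul, mul_inv_cancel₀ (hn n), one_smul]
  refine ⟨b, rfl, by simp [b], fun n h => by simp [b_succ, Nat.ne_of_gt h],
    fun n => ?_⟩
  induction n with
  | zero => simpa [b] using hβ
  | succ n ih =>
    -- `e₁` and `e₂` are the two halves of the product rule for the `t`-derivative of `m(f, f)`,
    -- read off at `tⁿ`; the weights `i.1` and `i.2` add up to `n + 1`.
    have e₁ : ∑ i ∈ Finset.HasAntidiagonal.antidiagonal (n + 1), (i.1 : k) • m (b i.1) (b i.2) =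
        m ζ (b n) + ∑ i ∈ Finset.HasAntidiagonal.antidiagonal n, m (L (b i.1)) (b i.2) := by
      rw [Finset.Nat.sum_antidiagonal_succ]
      simp only [Nat.cast_zero, zero_smul, zero_add, Nat.cast_add, Nat.cast_one]
      have : ∀ i : ℕ × ℕ, ((i.1 : k) + 1) • m (b (i.1 + 1)) (b i.2) =
          (if i.1 = 0 then m ζ (b i.2) else 0) + m (L (b i.1)) (b i.2) := by
        intro i
        rw [← LinearMap.smul_apply, ← map_smul, b_succ', map_add, LinearMap.add_apply]
        split_ifs <;> simp
      simp only [this, Finset.sum_add_distrib]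
      congr 1
      rw [Finset.sum_eq_single (0, n)]
      · simp
      · rintro ⟨i, j⟩ hij h0
        rw [Finset.HasAntidiagonal.mem_antidiagonal] at hij
        refine if_neg ?_
        rintro rfl
        exact h0 (by simp_all)
      · intro h
        exact absurd (by simp) h
    have e₂ : ∑ i ∈ Finset.HasAntidiagonal.antidiagonal (n + 1), (i.2 : k) • m (b i.1) (b i.2) =
        m (b n) ζ + ∑ i ∈ Finset.HasAntidiagonal.antidiagonal n, m (b i.1) (L (b i.2)) := by
      rw [Finset.Nat.sum_antidiagonal_succ']
      simp only [Nat.cast_zero, zero_smul, zero_add, Nat.cast_add, Nat.cast_one]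
      have : ∀ i : ℕ × ℕ, ((i.2 : k) + 1) • m (b i.1) (b (i.2 + 1)) =
          (if i.2 = 0 then m (b i.1) ζ else 0) + m (b i.1) (L (b i.2)) := by
        intro i
        rw [← map_smul, b_succ', map_add]
        split_ifs <;> simp
      simp only [this, Finset.sum_add_distrib]
      congr 1
      rw [Finset.sum_eq_single (n, 0)]
      · simp
      · rintro ⟨i, j⟩ hij h0
        rw [Finset.HasAntidiagonal.mem_antidiagonal] at hij
        refine if_neg ?_
        rintro rfl
        exact h0 (by simp_all)
      · intro h
        exact absurd (by simp) h
    have e₃ : ((n : k) + 1) • ∑ i ∈ Finset.HasAntidiagonal.antidiagonal (n + 1), m (b i.1) (b i.2) =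
        (m ζ (b n) + ∑ i ∈ Finset.HasAntidiagonal.antidiagonal n, m (L (b i.1)) (b i.2)) +
          (m (b n) ζ + ∑ i ∈ Finset.HasAntidiagonal.antidiagonal n, m (b i.1) (L (b i.2))) := by
      rw [← e₁, ← e₂, ← Finset.sum_add_distrib, Finset.smul_sum]
      refine Finset.sum_congr rfl fun i hi => ?_
      rw [← add_smul, ← Nat.cast_add, Finset.HasAntidiagonal.mem_antidiagonal.1 hi, Nat.cast_add, Nat.cast_one]
    have sw : ∀ F : ℕ → ℕ → N, ∑ i ∈ Finset.HasAntidiagonal.antidiagonal n, F i.2 i.1 =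
        ∑ i ∈ Finset.HasAntidiagonal.antidiagonal n, F i.1 i.2 := fun F =>
      Finset.Nat.sum_antidiagonal_swap (f := fun i : ℕ × ℕ => F i.1 i.2)
    -- Only the symmetrised product is assumed to obey a Leibniz rule, because the bracket with a
    -- vector is a derivation of the bracket and not of the pre-Lie product. The sum is therefore
    -- doubled, and the second copy is reindexed by exchanging the two indices.
    have e₄ : ∑ i ∈ Finset.HasAntidiagonal.antidiagonal n, m (L (b i.1)) (b i.2) +
        ∑ i ∈ Finset.HasAntidiagonal.antidiagonal n, m (b i.1) (L (b i.2)) =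
          L' (∑ i ∈ Finset.HasAntidiagonal.antidiagonal n, m (b i.1) (b i.2)) := by
      have h2 : (2 : k) ≠ 0 := two_ne_zero
      refine smul_right_injective N h2 ?_
      simp only [two_smul]
      rw [← map_add]
      nth_rw 2 [← sw fun i j => m (L (b i)) (b j)]
      nth_rw 2 [← sw fun i j => m (b i) (L (b j))]
      nth_rw 2 [← sw fun i j => m (b i) (b j)]
      simp only [← Finset.sum_add_distrib, map_sum]
      exact Finset.sum_congr rfl fun i _ => h₂ _ _
    have e₅ : ((n : k) + 1) • d (b (n + 1)) = L' (d (b n)) - (m (b n) ζ + m ζ (b n)) := by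
      rw [← map_smul, b_succ', map_add, h₁]
      split_ifs <;> simp [h₃]
    have e₆ : L' (d (b n)) + L' (∑ i ∈ Finset.HasAntidiagonal.antidiagonal n, m (b i.1) (b i.2)) = 0 := by
      rw [← map_add, ih, map_zero]
    refine (smul_eq_zero.1 ?_).resolve_left (hn n)
    rw [smul_add, e₅, e₃, ← e₆, ← e₄]
    abel

/-! ### The twisted differential and infinitesimal gauge transformations. -/

namespace Conv

section

variable {k : Type w} [Field k] {Ξ : Type u} {P : DGPseudoCooperad.{u, v, w} k Ξ}
  {O : DGOperad.{u, x, w} k Ξ}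

/-- The differential on vectors of degree one. -/
abbrev dif₁ : Conv P.toColl O.toColl 1 →ₗ[k] Conv P.toColl O.toColl 2 := dif (by norm_num)

/-- The pre-Lie product of vectors of degree one. -/
abbrev mul₁ : Conv P.toColl O.toColl 1 →ₗ[k] Conv P.toColl O.toColl 1 →ₗ[k]
    Conv P.toColl O.toColl 2 := mul (V := O.toOperad) (by norm_num)

/-- The differential twisted by `β`, on vectors of degree one. -/
def twist (β f : Conv P.toColl O.toColl 1) : Conv P.toColl O.toColl 2 :=
  dif₁ f + mul₁ β f + mul₁ f β

/-- The bracket with a vector of degree zero. -/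
def br (κ : Conv P.toColl O.toColl 0) (p : ℤ) :
    Conv P.toColl O.toColl p →ₗ[k] Conv P.toColl O.toColl p :=
  (mul (V := O.toOperad) (add_zero p)).flip κ - mul (V := O.toOperad) (zero_add p) κ

theorem br_apply (κ : Conv P.toColl O.toColl 0) {p : ℤ} (f : Conv P.toColl O.toColl p) :
    br κ p f = mul (V := O.toOperad) (add_zero p) f κ -
      mul (V := O.toOperad) (zero_add p) κ f := rfl

/-- The Leibniz rule for `[f, κ]`, in the form of hypothesis `h₁` of `exists_flow` with `ζ = ∂κ`. -/
theorem dif_br (κ : Conv P.toColl O.toColl 0) (f : Conv P.toColl O.toColl 1) :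
    dif₁ (br κ 1 f) = br κ 2 (dif₁ f) -
      (mul₁ f (dif (zero_add 1) κ) + mul₁ (dif (zero_add 1) κ) f) := by
  rw [br_apply, br_apply, map_sub,
    dif_mul (hp₁ := (by norm_num : (1 : ℤ) + 1 = 2)) (hp₂ := zero_add 1)
      (h₁ := by norm_num) (h₂ := by norm_num),
    dif_mul (hp₁ := zero_add 1) (hp₂ := (by norm_num : (1 : ℤ) + 1 = 2))
      (h₁ := by norm_num) (h₂ := by norm_num), ks_one, ks_zero, neg_one_smul, one_smul]
  abel

/-- The Jacobi identity for `κ` and two vectors of degree one, in the form of hypothesis `h₂` of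
`exists_flow`. It combines three instances of the symmetry of the associator, one for each choice of
the vector at the root. -/
theorem br_mul (κ : Conv P.toColl O.toColl 0) (f g : Conv P.toColl O.toColl 1) :
    mul₁ (br κ 1 f) g + mul₁ f (br κ 1 g) + (mul₁ (br κ 1 g) f + mul₁ g (br κ 1 f)) =
      br κ 2 (mul₁ f g + mul₁ g f) := by
  have h₀ : (1 : ℤ) + 1 = 2 := by norm_num
  have a₁ := mul_associator (V := O.toOperad) f κ g (add_zero 1) h₀ (zero_add 1) h₀
    h₀ (add_zero 2) (add_zero 1)
  have a₂ := mul_associator (V := O.toOperad) g κ f (add_zero 1) h₀ (zero_add 1) h₀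
    h₀ (add_zero 2) (add_zero 1)
  have a₃ := mul_associator (V := O.toOperad) κ f g (zero_add 1) h₀ h₀ (zero_add 2)
    (zero_add 1) h₀ h₀
  rw [zero_mul, ks_zero, one_smul] at a₁ a₂
  rw [one_mul, ks_one, neg_one_smul] at a₃
  simp only [br_apply, map_add, map_sub, LinearMap.sub_apply]
  linear_combination (norm := abel) a₁ + a₂ - a₃

/-- Tangent vectors to the gauge orbit of an MC element are cocycles: the terms with `∂κ` cancel,
and the rest is the bracket of `∂β + β • β = 0` with `κ`. -/
theorem twist_gauge [CharZero k] {β : Conv P.toColl O.toColl 1} (hβ : dif₁ β + mul₁ β β = 0)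
    (κ : Conv P.toColl O.toColl 0) : twist β (dif (zero_add 1) κ + br κ 1 β) = 0 := by
  have h₁ : mul₁ (br κ 1 β) β + mul₁ β (br κ 1 β) = br κ 2 (mul₁ β β) := by
    refine smul_right_injective _ (two_ne_zero (α := k)) ?_
    simp only [two_smul]
    exact (br_mul κ β β).trans (map_add _ _ _)
  have h₂ : br κ 2 (dif₁ β) + br κ 2 (mul₁ β β) = 0 := by rw [← map_add, hβ, map_zero]
  rw [twist, map_add, dif_dif, dif_br, map_add, map_add, LinearMap.add_apply]
  linear_combination (norm := abel) h₂ + h₁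

/-- The Bianchi identity for the differential twisted by a Maurer-Cartan element. -/
theorem dif_twist [CharZero k] {β : Conv P.toColl O.toColl 1} (hβ : dif₁ β + mul₁ β β = 0)
    (f : Conv P.toColl O.toColl 1) :
    dif (p' := 3) (by norm_num) (twist β f) =
      mul (V := O.toOperad) (by norm_num) (twist β f) β -
        mul (V := O.toOperad) (by norm_num) β (twist β f) := by
  have h₀ : (1 : ℤ) + 1 = 2 := by norm_num
  have h₁ : (1 : ℤ) + 2 = 3 := by norm_num
  have h₂ : (2 : ℤ) + 1 = 3 := by norm_num
  have hb : dif₁ β = -mul₁ β β := eq_neg_of_add_eq_zero_left hβ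
  have a₁ := mul_associator (V := O.toOperad) β β f h₀ h₂ h₀ h₁ h₀ h₂ h₀
  have a₂ := mul_associator (V := O.toOperad) f β β h₀ h₂ h₀ h₁ h₀ h₂ h₀
  rw [one_mul, ks_one, neg_one_smul] at a₁ a₂
  -- If the last two arguments are the same odd vector, the associator equals its own negative, so
  -- it vanishes.
  have a₂' : mul (V := O.toOperad) h₂ (mul h₀ f β) β - mul h₁ f (mul h₀ β β) = 0 := by
    have h2 := eq_neg_iff_add_eq_zero.1 a₂
    rw [← two_smul k] at h2
    exact (smul_eq_zero.1 h2).resolve_left two_ne_zero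
  have d₁ := dif_mul (O := O) h₀ h₂ h₀ h₀ h₂ h₁ β f
  have d₂ := dif_mul (O := O) h₀ h₂ h₀ h₀ h₂ h₁ f β
  rw [ks_one, neg_one_smul] at d₁ d₂
  simp only [twist, map_add, dif_dif, LinearMap.add_apply, d₁, d₂]
  rw [hb]
  simp only [map_neg, LinearMap.neg_apply]
  linear_combination (norm := abel) -a₁ - a₂'

end

/-! ### Summation of formal MC elements with respect to the additional grading. -/

section

variable {k : Type w} [Field k] {Ξ : Type u} {P : DGPseudoCooperad.{u, v, w} k Ξ} (γ : Grading P)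
  {O : DGOperad.{u, x, w} k Ξ}

open Finset in
-- A formal power series of MC elements can be evaluated at `t = 1`. On a given `𝒢ʲ P` only the
-- coefficients with index at most `j` are nonzero, except possibly `b 0` at `j = 0`, where
-- everything vanishes, so the partial sums stabilise and can be glued.
theorem exists_sum {b : ℕ → Conv P.toColl O.toColl 1}
    (hb : ∀ n, 1 ≤ n → ∀ j ≤ n, b n ∈ γ.van O.toColl 1 j)
    (hc : ∀ n, dif₁ (b n) + ∑ i ∈ HasAntidiagonal.antidiagonal n, mul₁ (b i.1) (b i.2) = 0) :
    ∃ β : Conv P.toColl O.toColl 1, dif₁ β + mul₁ β β = 0 ∧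
      ∀ j, β - ∑ n ∈ range (j + 1), b n ∈ γ.van O.toColl 1 j := by
  let S : ℕ → Conv P.toColl O.toColl 1 := fun N => ∑ n ∈ range (N + 1), b n
  have hS : ∀ i N, i ≤ N → S N - S i ∈ γ.van O.toColl 1 i := by
    intro i N hiN
    induction N, hiN using Nat.le_induction with
    | base => rw [sub_self]; exact zero_mem _
    | succ N hiN ih =>
      have : S (N + 1) - S i = (S N - S i) + b (N + 1) := by
        simp only [S, sum_range_succ _ (N + 1)]
        abel
      rw [this]
      exact add_mem ih (hb _ (by omega) _ (by omega))
  have hβ : ∀ j, γ.glue S - S j ∈ γ.van O.toColl 1 j := by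
    intro j t a b h X hX
    rw [sub_app, γ.glue_app S h hX, sub_self]
  have hβ' : ∀ i N, i ≤ N → γ.glue S - S N ∈ γ.van O.toColl 1 i := by
    intro i N h
    rw [← sub_sub_sub_cancel_right _ _ (S i)]
    exact sub_mem (hβ i) (hS i N h)
  refine ⟨γ.glue S, γ.eq_zero_of_van fun N => ?_, hβ⟩
  have e : dif₁ (γ.glue S) + mul₁ (γ.glue S) (γ.glue S) =
      dif₁ (γ.glue S - S N) + mul₁ (γ.glue S - S N) (γ.glue S) + mul₁ (S N) (γ.glue S - S N) +
        (dif₁ (S N) + mul₁ (S N) (S N)) := by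
    simp only [map_sub, LinearMap.sub_apply]
    abel
  -- The coefficient equations up to order `N` cancel everything in the curvature of the partial sum
  -- except the cross terms of total order greater than `N`.
  have e' : dif₁ (S N) + mul₁ (S N) (S N) =
      ∑ i ∈ (range (N + 1) ×ˢ range (N + 1)).filter (fun i => ¬ i.1 + i.2 ≤ N),
        mul₁ (b i.1) (b i.2) := by
    have h₁ : mul₁ (S N) (S N) = ∑ i ∈ range (N + 1) ×ˢ range (N + 1), mul₁ (b i.1) (b i.2) := by
      rw [sum_product]
      simp only [S, map_sum, LinearMap.sum_apply]
      exact sum_comm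
    have h₂ : ∑ i ∈ (range (N + 1) ×ˢ range (N + 1)).filter (fun i => i.1 + i.2 ≤ N),
        mul₁ (b i.1) (b i.2) =
          ∑ n ∈ range (N + 1), ∑ i ∈ HasAntidiagonal.antidiagonal n, mul₁ (b i.1) (b i.2) := by
      rw [← sum_fiberwise_of_maps_to (g := fun i : ℕ × ℕ => i.1 + i.2) (t := range (N + 1))]
      · refine sum_congr rfl fun n hn => sum_congr ?_ fun _ _ => rfl
        ext ⟨i, j⟩
        simp only [mem_filter, mem_product, mem_range, HasAntidiagonal.mem_antidiagonal] at hn ⊢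
        omega
      · rintro ⟨i, j⟩ h
        simp only [mem_filter, mem_product, mem_range] at h ⊢
        omega
    rw [h₁, ← sum_filter_add_sum_filter_not _ (fun i => i.1 + i.2 ≤ N), h₂, ← add_assoc]
    simp only [S, map_sum]
    rw [← sum_add_distrib, sum_eq_zero fun n _ => hc n, zero_add]
  rw [e, e']
  refine add_mem (add_mem (add_mem ?_ ?_) ?_) (sum_mem ?_)
  · exact γ.dif_van _ (hβ' _ _ le_rfl) (hβ' _ _ (by omega))
  · exact γ.mul_van _ _ _ fun r₁ r₂ h _ _ => Or.inl (hβ' _ _ (by omega))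
  · exact γ.mul_van _ _ _ fun r₁ r₂ h _ _ => Or.inr (hβ' _ _ (by omega))
  · rintro ⟨i, j⟩ h
    simp only [mem_filter, mem_product, mem_range] at h
    refine γ.mul_van _ _ _ fun r₁ r₂ hr _ _ => ?_
    -- As `r₁ + r₂ = N < i + j`, one of `r₁ ≤ i` and `r₂ ≤ j` holds, so one factor vanishes.
    by_cases h₁ : r₁ ≤ i
    · exact Or.inl (hb _ (by omega) _ h₁)
    · exact Or.inr (hb _ (by omega) _ (by omega))

end

end Conv

/-! ### The universal property of the free operad -/

section free

variable {k : Type w} [Field k] {Ξ : Type u} {P : Coll.{u, v, w} k Ξ}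

theorem free_induction {C : ∀ {q : Corolla Ξ} {a : ℤ}, (freeOperad P).obj q a → Prop}
    (sus' : ∀ {q : Corolla Ξ} {a b : ℤ} (h : a + 1 = b) (X : P.obj q a), C ((sus P).app h X))
    (one : ∀ x : Ξ, C ((freeOperad P).one x))
    (zero : ∀ {q : Corolla Ξ} {a : ℤ}, C (0 : (freeOperad P).obj q a))
    (add : ∀ {q : Corolla Ξ} {a : ℤ} (u v : (freeOperad P).obj q a), C u → C v → C (u + v))
    (smul : ∀ {q : Corolla Ξ} {a : ℤ} (c : k) (u : (freeOperad P).obj q a), C u → C (c • u))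
    (map : ∀ {q r : Corolla Ξ} (e : q.Iso r) {a : ℤ} (u : (freeOperad P).obj q a), C u →
      C ((freeOperad P).map e u))
    (comp : ∀ {q r : Corolla Ξ} {a b c : ℤ} (h : a + b = c)
      (u : (freeOperad P).obj (q.cons r.out) a) (v : (freeOperad P).obj r b), C u → C v →
      C ((freeOperad P).comp h u v)) {q : Corolla Ξ} {a : ℤ} (u : (freeOperad P).obj q a) :
    C u := by
  obtain ⟨u, rfl⟩ := freeMk_surj u
  induction u with
  | gen h X => exact sus' h X
  | one x => exact one x
  | zero => exact zero
  | add u v hu hv => exact add _ _ hu hv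
  | smul c u hu => exact smul c _ hu
  | map e u hu => exact map e _ hu
  | comp h u v hu hv => exact comp h _ _ hu hv

variable (B : Operad.{u, x, w} k Ξ) (η : Conv P B.toColl 1)

/-- Evaluation of formal expressions. -/
def Expr.lift : ∀ {q : Corolla Ξ} {a : ℤ}, Expr P q a → B.obj q a
  | _, _, .gen h X => η.app h X
  | _, _, .one x => B.one x
  | _, _, .zero => 0
  | _, _, .add u v => Expr.lift u + Expr.lift v
  | _, _, .smul c u => c • Expr.lift u
  | _, _, .map e u => B.map e (Expr.lift u)
  | _, _, .comp h u v => B.comp h (Expr.lift u) (Expr.lift v)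

theorem Expr.lift_sound {q : Corolla Ξ} {a : ℤ} {u v : Expr P q a} (r : Expr.Rel P u v) :
    Expr.lift B η u = Expr.lift B η v := by
  induction r with
  | refl u => rfl
  | symm _ ih => exact ih.symm
  | trans _ _ ih ih' => exact ih.trans ih'
  | add_congr _ _ ih ih' => simp only [Expr.lift, ih, ih']
  | smul_congr c _ ih => simp only [Expr.lift, ih]
  | map_congr e _ ih => simp only [Expr.lift, ih]
  | comp_congr h _ _ ih ih' => simp only [Expr.lift, ih, ih']
  | add_comm u v => simp only [Expr.lift, add_comm]
  | add_assoc u v z => simp only [Expr.lift, add_assoc]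
  | zero_add u => simp only [Expr.lift, zero_add]
  | neg_add u => simp [Expr.lift]
  | smul_add c u v => simp only [Expr.lift, smul_add]
  | add_smul c c' u => simp only [Expr.lift, add_smul]
  | mul_smul c c' u => simp only [Expr.lift, mul_smul]
  | one_smul u => simp only [Expr.lift, one_smul]
  | gen_add h X Y => simp only [Expr.lift, map_add]
  | gen_smul h c X => simp only [Expr.lift, map_smul]
  | gen_map e h X => simp only [Expr.lift, Conv.app_map]
  | map_add e u v => simp only [Expr.lift, map_add]
  | map_smul e c u => simp only [Expr.lift, map_smul]
  | map_refl u => simp only [Expr.lift, Coll.map_refl]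
  | map_trans e f u => simp only [Expr.lift, Coll.map_trans]
  | add_comp h u u' v => simp only [Expr.lift, map_add, LinearMap.add_apply]
  | smul_comp h x u v => simp only [Expr.lift, map_smul, LinearMap.smul_apply]
  | comp_add h u v v' => simp only [Expr.lift, map_add]
  | comp_smul h x u v => simp only [Expr.lift, map_smul]
  | map_comp e f h u v => simp only [Expr.lift, Operad.map_comp]
  | comp_seq h₁ h₂ h₃ h₄ u v z => exact B.comp_seq h₁ h₂ h₃ h₄ _ _ _
  | comp_par h₁ h₂ h₃ h₄ u v z => exact B.comp_par h₁ h₂ h₃ h₄ _ _ _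
  | one_comp h v => exact B.one_comp h _
  | comp_one h u => exact B.comp_one h _

/-- The morphism of operads from the free operad which extends `η`. -/
def freeLift : CollMap (freeOperad P).toColl B.toColl where
  app _ _ :=
    { toFun := Quotient.lift (Expr.lift B η) fun _ _ r => Expr.lift_sound B η r
      map_add' := FreeObj.ind fun _ => FreeObj.ind fun _ => rfl
      map_smul' _ := FreeObj.ind fun _ => rfl }
  app_map _ _ := FreeObj.ind fun _ => rfl

theorem freeLift_comp {q r : Corolla Ξ} {a b c : ℤ} (h : a + b = c)
    (u : (freeOperad P).obj (q.cons r.out) a) (v : (freeOperad P).obj r b) :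
    (freeLift B η).app _ c ((freeOperad P).comp h u v) =
      B.comp h ((freeLift B η).app _ a u) ((freeLift B η).app _ b v) := by
  obtain ⟨u, rfl⟩ := freeMk_surj u
  obtain ⟨v, rfl⟩ := freeMk_surj v
  rfl

end free

/-! ### Square-zero extensions and derivations -/

section derivation

variable {k : Type w} [Field k] {Ξ : Type u} {P : Coll.{u, v, w} k Ξ}

/-- The operad `B[ε]` with `ε² = 0`. -/
def Operad.dual (B : Operad.{u, x, w} k Ξ) : Operad.{u, x, w} k Ξ where
  obj q a := B.obj q a × B.obj q a
  map e := (B.map e).prodMap (B.map e)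
  map_refl u := Prod.ext (B.map_refl _) (B.map_refl _)
  map_trans e f _ u := Prod.ext (B.map_trans e f _) (B.map_trans e f _)
  one x := (B.one x, 0)
  -- No Koszul sign appears because `ε` has degree zero.
  comp h := LinearMap.mk₂ k (fun u v => (B.comp h u.1 v.1, B.comp h u.2 v.1 + B.comp h u.1 v.2))
    (fun u u' v => Prod.ext (by simp) (by simp; abel)) (fun c u v => Prod.ext (by simp) (by simp))
    (fun u v v' => Prod.ext (by simp) (by simp; abel)) (fun c u v => Prod.ext (by simp) (by simp))
  map_comp e f _ _ _ h u v := Prod.ext (by simp [B.map_comp]) (by simp [B.map_comp])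
  comp_seq h₁ h₂ h₃ h₄ u v z := Prod.ext (B.comp_seq h₁ h₂ h₃ h₄ _ _ _) (by
    simp only [LinearMap.mk₂_apply, LinearMap.prodMap_apply, map_add, LinearMap.add_apply,
      B.comp_seq h₁ h₂ h₃ h₄]
    abel)
  comp_par h₁ h₂ h₃ h₄ u v z := Prod.ext (B.comp_par h₁ h₂ h₃ h₄ _ _ _) (by
    simp only [LinearMap.mk₂_apply, LinearMap.prodMap_apply, map_add, LinearMap.add_apply,
      B.comp_par h₁ h₂ h₃ h₄, Prod.smul_snd, smul_add]
    abel)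
  one_comp h v := Prod.ext (B.one_comp h _) (by simp [B.one_comp])
  comp_one h u := Prod.ext (B.comp_one h _) (by simp [B.comp_one])

/-- A vector of `Conv(P, B)` extends to a derivation of the free operad with values in `B`. -/
theorem exists_derivation (B : Operad.{u, x, w} k Ξ) (η ξ : Conv P B.toColl 1) :
    ∃ D : CollMap (freeOperad P).toColl B.toColl,
      (∀ {q : Corolla Ξ} {a b : ℤ} (h : a + 1 = b) (X : P.obj q a),
        D.app q b ((sus P).app h X) = ξ.app h X) ∧
      (∀ x : Ξ, D.app _ 0 ((freeOperad P).one x) = 0) ∧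
      ∀ {q r : Corolla Ξ} {a b c : ℤ} (h : a + b = c)
        (u : (freeOperad P).obj (q.cons r.out) a) (v : (freeOperad P).obj r b),
        D.app _ c ((freeOperad P).comp h u v) =
          B.comp h (D.app _ a u) ((freeLift B η).app _ b v) +
            B.comp h ((freeLift B η).app _ a u) (D.app _ b v) := by
  -- The morphism of operads extending `η + ε ξ` has the lift of `η` as its constant term, and its
  -- `ε`-coefficient is the derivation sought.
  let ζ : Conv P B.dual.toColl 1 := ⟨fun h => (η.app h).prod (ξ.app h),
    fun e _ _ h X => Prod.ext (η.app_map e h X) (ξ.app_map e h X)⟩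
  let F := freeLift B.dual ζ
  have hF : ∀ {q : Corolla Ξ} {a : ℤ} (u : (freeOperad P).obj q a),
      (F.app q a u).1 = (freeLift B η).app q a u := by
    intro q a u
    induction u using free_induction with
    | sus' h X => rfl
    | one x => rfl
    | zero => rw [map_zero, map_zero]; rfl
    | add u v hu hv => rw [map_add, map_add, ← hu, ← hv]; rfl
    | smul c u hu => rw [map_smul, map_smul, ← hu]; rfl
    | map e u hu => rw [F.app_map, (freeLift B η).app_map, ← hu]; rfl
    | comp h u v hu hv => rw [freeLift_comp, freeLift_comp, ← hu, ← hv]; rfl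
  refine ⟨⟨fun q a => LinearMap.snd k _ _ ∘ₗ F.app q a, fun e a u => ?_⟩, fun h X => rfl,
    fun x => rfl, fun h u v => ?_⟩
  · exact congrArg Prod.snd (F.app_map e u)
  · rw [← hF, ← hF]
    exact congrArg Prod.snd (freeLift_comp B.dual ζ h u v)

end derivation

/-! ### Extension of scalars -/

namespace DGOperad

section tensor

variable {k : Type w} [Field k] {Ξ : Type u} (O : DGOperad.{u, x, w} k Ξ)
  (K : Type y) [Field K] [Algebra k K] {q r : Corolla Ξ} {a b c : ℤ}

/-- The vector `u ⊗ c` of `O ⊗ K`. -/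
def tm : O.obj q a →ₗ[k] K →ₗ[k] (O.tensor K).obj q a := TensorProduct.mk k (O.obj q a) K

/-- The linear map on `O ⊗ K` corresponding to a bilinear map. -/
def tmLift {M : Type*} [AddCommGroup M] [Module k M] (f : O.obj q a →ₗ[k] K →ₗ[k] M) :
    (O.tensor K).obj q a →ₗ[k] M := TensorProduct.lift f

variable {O K}

@[simp] theorem tmLift_tm {M : Type*} [AddCommGroup M] [Module k M]
    (f : O.obj q a →ₗ[k] K →ₗ[k] M) (u : O.obj q a) (c : K) :
    O.tmLift K f (O.tm K u c) = f u c := rfl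

theorem tm_induction {C : (O.tensor K).obj q a → Prop} (tm : ∀ u c, C (O.tm K u c))
    (add : ∀ u v, C u → C v → C (u + v)) (u : (O.tensor K).obj q a) : C u :=
  TensorProduct.induction_on (motive := C) u
    (by have := tm 0 0; rwa [map_zero] at this) tm add

theorem map_tm (e : q.Iso r) (u : O.obj q a) (c : K) :
    (O.tensor K).map e (O.tm K u c) = O.tm K (O.map e u) c := rfl

theorem d_tm (h : a + 1 = b) (u : O.obj q a) (c : K) :
    (O.tensor K).d h (O.tm K u c) = O.tm K (O.d h u) c := rfl

theorem comp_tm (h : a + b = c) (u : O.obj (q.cons r.out) a) (v : O.obj r b) (z z' : K) :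
    (O.tensor K).comp h (O.tm K u z) (O.tm K v z') = O.tm K (O.comp h u v) (z * z') := rfl

variable (O K)

/-- The map `O → O ⊗ K`. -/
def inc : CollMap O.toColl (O.tensor K).toColl where
  app _ _ := (O.tm K).flip 1
  app_map _ _ _ := rfl

/-- The action of the scalars in `K`. -/
def scal : K →ₗ[k] (O.tensor K).obj q a →ₗ[k] (O.tensor K).obj q a :=
  LinearMap.lTensorHom (O.obj q a) ∘ₗ LinearMap.mul k K

/-- The map `O ⊗ K → O` induced by a linear form on `K`. -/
def crd (φ : K →ₗ[k] k) : CollMap (O.tensor K).toColl O.toColl where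
  app q a := O.tmLift K (LinearMap.lsmul k _ ∘ₗ φ).flip
  app_map e a u := by
    induction u using tm_induction with
    | tm u c => simp [map_tm]
    | add u v hu hv => simp only [map_add, hu, hv]

variable {O K}

theorem inc_apply (u : O.obj q a) : (O.inc K).app q a u = O.tm K u 1 := rfl

theorem inc_comp (h : a + b = c) (u : O.obj (q.cons r.out) a) (v : O.obj r b) :
    (O.inc K).app _ c (O.comp h u v) =
      (O.tensor K).comp h ((O.inc K).app _ a u) ((O.inc K).app _ b v) := by
  simp only [inc_apply, comp_tm, mul_one]

theorem inc_d (h : a + 1 = b) (u : O.obj q a) :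
    (O.inc K).app q b (O.d h u) = (O.tensor K).d h ((O.inc K).app q a u) := rfl

@[simp] theorem scal_tm (u : O.obj q a) (c c' : K) :
    O.scal K c (O.tm K u c') = O.tm K u (c * c') := rfl

theorem scal_scal (c c' : K) (u : (O.tensor K).obj q a) :
    O.scal K c (O.scal K c' u) = O.scal K (c * c') u := by
  induction u using tm_induction with
  | tm u z => simp only [scal_tm, mul_assoc]
  | add u v hu hv => simp only [map_add, hu, hv]

theorem scal_map (z : K) (e : q.Iso r) (u : (O.tensor K).obj q a) :
    O.scal K z ((O.tensor K).map e u) = (O.tensor K).map e (O.scal K z u) := by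
  induction u using tm_induction with
  | tm u c => rfl
  | add u v hu hv => simp only [map_add, hu, hv]

theorem scal_d (z : K) (h : a + 1 = b) (u : (O.tensor K).obj q a) :
    O.scal K z ((O.tensor K).d h u) = (O.tensor K).d h (O.scal K z u) := by
  induction u using tm_induction with
  | tm u c => rfl
  | add u v hu hv => simp only [map_add, hu, hv]

theorem comp_scal (h : a + b = c) (u : (O.tensor K).obj (q.cons r.out) a)
    (v : (O.tensor K).obj r b) (z z' : K) :
    (O.tensor K).comp h (O.scal K z u) (O.scal K z' v) =
      O.scal K (z * z') ((O.tensor K).comp h u v) := by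
  induction u using tm_induction with
  | tm u y =>
    induction v using tm_induction with
    | tm v y' => simp only [scal_tm, comp_tm, mul_mul_mul_comm]
    | add u v hu hv => simp only [map_add, hu, hv]
  | add u v hu hv => simp only [map_add, LinearMap.add_apply, hu, hv]

theorem crd_tm (φ : K →ₗ[k] k) (u : O.obj q a) (c : K) :
    (O.crd K φ).app q a (O.tm K u c) = φ c • u := rfl

theorem crd_d (φ : K →ₗ[k] k) (h : a + 1 = b) (u : (O.tensor K).obj q a) :
    (O.crd K φ).app q b ((O.tensor K).d h u) = O.d h ((O.crd K φ).app q a u) := by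
  induction u using tm_induction with
  | tm u c => simp only [d_tm, crd_tm, map_smul]
  | add u v hu hv => simp only [map_add, hu, hv]

/-- Together with the coordinate maps `crd`, which commute with the differential, this takes the
place of flatness of `K`: closedness and exactness over `K` are reduced to the coordinates over `k`.
-/
theorem exists_eq_sum {ι : Type*} (B : Module.Basis ι k K) (u : (O.tensor K).obj q a) :
    ∃ s : Finset ι, u = ∑ i ∈ s, O.tm K ((O.crd K (B.coord i)).app q a u) (B i) := by
  classical
  -- The statement for all larger finite sets is needed to add two expansions over a common index
  -- set.
  suffices ∃ s : Finset ι, ∀ t, s ⊆ t →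
      u = ∑ i ∈ t, O.tm K ((O.crd K (B.coord i)).app q a u) (B i) by
    obtain ⟨s, hs⟩ := this
    exact ⟨s, hs s subset_rfl⟩
  induction u using tm_induction with
  | tm u c =>
    refine ⟨(B.repr c).support, fun t ht => ?_⟩
    have h₁ : c = ∑ i ∈ t, B.repr c i • B i := by
      conv_lhs => rw [← B.linearCombination_repr c, Finsupp.linearCombination_apply]
      exact Finsupp.sum_of_support_subset _ ht _ (by simp)
    conv_lhs => rw [h₁]
    simp [crd_tm]
  | add u v hu hv =>
    obtain ⟨s, hs⟩ := hu
    obtain ⟨s', hs'⟩ := hv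
    refine ⟨s ∪ s', fun t ht => ?_⟩
    simp only [map_add, LinearMap.add_apply, Finset.sum_add_distrib]
    rw [← hs t (Finset.union_subset_left ht), ← hs' t (Finset.union_subset_right ht)]

/-- The extension of a map `A → B ⊗ K` to `A ⊗ K`. -/
def extend {A : DGOperad.{u, v, w} k Ξ} (G : CollMap A.toColl (O.tensor K).toColl) :
    CollMap (A.tensor K).toColl (O.tensor K).toColl where
  app q a := A.tmLift K ((O.scal K).flip ∘ₗ G.app q a)
  app_map e a u := by
    induction u using tm_induction with
    | tm u c => simp [map_tm, G.app_map, scal_map]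
    | add u v hu hv => simp only [map_add, hu, hv]

variable {A : DGOperad.{u, v, w} k Ξ} (G : CollMap A.toColl (O.tensor K).toColl)

theorem extend_tm (u : A.obj q a) (z : K) :
    (extend G).app q a (A.tm K u z) = O.scal K z (G.app q a u) := rfl

theorem extend_scal (u : (A.tensor K).obj q a) (z : K) :
    (extend G).app q a (A.scal K z u) = O.scal K z ((extend G).app q a u) := by
  induction u using tm_induction with
  | tm u c => simp only [scal_tm, extend_tm, scal_scal]
  | add u v hu hv => simp only [map_add, hu, hv]

theorem scal_one (u : (O.tensor K).obj q a) : O.scal K 1 u = u := by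
  induction u using tm_induction with
  | tm u c => rw [scal_tm, one_mul]
  | add u v hu hv => rw [map_add, hu, hv]

theorem extend_inc (u : A.obj q a) :
    (extend G).app q a ((A.inc K).app q a u) = G.app q a u := by
  rw [inc_apply, extend_tm, scal_one]

theorem extend_d
    (hG : ∀ {q : Corolla Ξ} {a b : ℤ} (h : a + 1 = b) (u : A.obj q a),
      G.app q b (A.d h u) = (O.tensor K).d h (G.app q a u))
    (h : a + 1 = b) (u : (A.tensor K).obj q a) :
    (extend G).app q b ((A.tensor K).d h u) = (O.tensor K).d h ((extend G).app q a u) := by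
  induction u using tm_induction with
  | tm u c => rw [d_tm, extend_tm, extend_tm, hG, scal_d]
  | add u v hu hv => simp only [map_add, hu, hv]

theorem extend_comp
    (hG : ∀ {q r : Corolla Ξ} {a b c : ℤ} (h : a + b = c) (u : A.obj (q.cons r.out) a)
      (v : A.obj r b), G.app _ c (A.comp h u v) = (O.tensor K).comp h (G.app _ _ u) (G.app _ _ v))
    (h : a + b = c) (u : (A.tensor K).obj (q.cons r.out) a) (v : (A.tensor K).obj r b) :
    (extend G).app _ c ((A.tensor K).comp h u v) =
      (O.tensor K).comp h ((extend G).app _ _ u) ((extend G).app _ _ v) := by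
  induction u using tm_induction with
  | tm u y =>
    induction v using tm_induction with
    | tm v y' => rw [comp_tm, extend_tm, extend_tm, extend_tm, comp_scal, hG]
    | add u v hu hv => simp only [map_add, hu, hv]
  | add u v hu hv => simp only [map_add, LinearMap.add_apply, hu, hv]

/-- The extension of a derivation along `A → A ⊗ K`. -/
theorem extend_derivation (G : CollMap A.toColl (A.tensor K).toColl)
    (hG : ∀ {q r : Corolla Ξ} {a b c : ℤ} (h : a + b = c) (u : A.obj (q.cons r.out) a)
      (v : A.obj r b), G.app _ c (A.comp h u v) =
        (A.tensor K).comp h (G.app _ _ u) ((A.inc K).app _ _ v) +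
          (A.tensor K).comp h ((A.inc K).app _ _ u) (G.app _ _ v))
    (h : a + b = c) (u : (A.tensor K).obj (q.cons r.out) a) (v : (A.tensor K).obj r b) :
    (extend G).app _ c ((A.tensor K).comp h u v) =
      (A.tensor K).comp h ((extend G).app _ _ u) v +
        (A.tensor K).comp h u ((extend G).app _ _ v) := by
  induction u using tm_induction with
  | tm u y =>
    induction v using tm_induction with
    | tm v y' =>
      rw [comp_tm, extend_tm, extend_tm, extend_tm, hG, map_add, ← comp_scal, ← comp_scal]
      simp only [inc_apply, scal_tm, mul_one]
    | add u v hu hv =>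
      simp only [map_add, hu, hv]
      abel
  | add u v hu hv =>
    simp only [map_add, LinearMap.add_apply, hu, hv]
    abel

end tensor

end DGOperad

/-! ### The cobar construction -/

namespace Cobar

variable {k : Type w} [Field k] [CharZero k] {Ξ : Type u} {P : DGPseudoCooperad.{u, v, w} k Ξ}

variable (P) in
/-- The suspension `P → Cobar(P)`. -/
def inj : Conv P.toColl (cobar P).toColl 1 := sus P.toColl

/-- The suspension is the universal MC element: the cobar differential on generators is defined so
that this equation holds. -/
theorem inj_isMC : Conv.dif₁ (inj P) + Conv.mul₁ (inj P) (inj P) = 0 := by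
  refine Conv.ext_app fun {t a b} h X => ?_
  rw [Conv.add_app, Conv.dif_app _ _ h rfl (by omega) rfl (by omega),
    Conv.mul_app _ _ _ h (by omega)]
  have : (cobar P).d (by omega : a + 1 + 1 = b) ((inj P).app rfl X) = _ :=
    cobarD_sus P (rfl : a + 1 = a + 1) (by omega) (by omega) (by omega) X
  rw [this, ks_one, neg_one_smul]
  have key : ∀ x y : (cobar P).obj t b, -x - y - -x + y = 0 := fun x y => by abel
  exact key _ _

theorem induction {C : ∀ {q : Corolla Ξ} {a : ℤ}, (cobar P).obj q a → Prop}
    (inj : ∀ {q : Corolla Ξ} {a b : ℤ} (h : a + 1 = b) (X : P.obj q a), C ((inj P).app h X))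
    (one : ∀ x : Ξ, C ((cobar P).one x))
    (zero : ∀ {q : Corolla Ξ} {a : ℤ}, C (0 : (cobar P).obj q a))
    (add : ∀ {q : Corolla Ξ} {a : ℤ} (u v : (cobar P).obj q a), C u → C v → C (u + v))
    (smul : ∀ {q : Corolla Ξ} {a : ℤ} (c : k) (u : (cobar P).obj q a), C u → C (c • u))
    (map : ∀ {q r : Corolla Ξ} (e : q.Iso r) {a : ℤ} (u : (cobar P).obj q a), C u →
      C ((cobar P).map e u))
    (comp : ∀ {q r : Corolla Ξ} {a b c : ℤ} (h : a + b = c)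
      (u : (cobar P).obj (q.cons r.out) a) (v : (cobar P).obj r b), C u → C v →
      C ((cobar P).comp h u v)) {q : Corolla Ξ} {a : ℤ} (u : (cobar P).obj q a) : C u :=
  free_induction (C := fun u => C u) inj one zero add smul map comp u

variable (B : DGOperad.{u, x, w} k Ξ) (η : Conv P.toColl B.toColl 1)

/-- The morphism of operads from the cobar construction which extends `η`. -/
def lift : CollMap (cobar P).toColl B.toColl := freeLift B.toOperad η

theorem lift_inj {q : Corolla Ξ} {a b : ℤ} (h : a + 1 = b) (X : P.obj q a) :
    (lift B η).app q b ((inj P).app h X) = η.app h X := rfl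

theorem push_lift_inj : Conv.push (lift B η) (inj P) = η := rfl

theorem lift_one (x : Ξ) : (lift B η).app _ 0 ((cobar P).one x) = B.one x := rfl

theorem lift_comp {q r : Corolla Ξ} {a b c : ℤ} (h : a + b = c)
    (u : (cobar P).obj (q.cons r.out) a) (v : (cobar P).obj r b) :
    (lift B η).app _ c ((cobar P).comp h u v) =
      B.comp h ((lift B η).app _ a u) ((lift B η).app _ b v) :=
  freeLift_comp B.toOperad η h u v

variable {B η}

/-- On generators, commuting with the differentials amounts to the MC equation of `η` compared with
that of `inj`; the remaining cases follow because both differentials are derivations. Thus MC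
elements give morphisms of dg operads. -/
theorem lift_d (hη : Conv.dif₁ η + Conv.mul₁ η η = 0) {q : Corolla Ξ} {a b : ℤ} (h : a + 1 = b)
    (u : (cobar P).obj q a) :
    (lift B η).app q b ((cobar P).d h u) = B.d h ((lift B η).app q a u) := by
  induction u using induction generalizing b with
  | @inj q a a' h' X =>
    have h₁ := congrArg (fun f : Conv P.toColl B.toColl 2 => f.app (by omega : a + 2 = b) X) hη
    have h₂ := congrArg (fun f => (Conv.push (lift B η) f).app (by omega : a + 2 = b) X)
      (inj_isMC (P := P))
    simp only [map_add, map_zero, Conv.add_app, Conv.zero_app] at h₁ h₂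
    rw [Conv.push_mul_hom (V := (cobar P).toOperad) (V' := B.toOperad) (lift B η) (lift_comp B η),
      push_lift_inj] at h₂
    rw [Conv.dif_app _ _ _ h' h rfl (by omega)] at h₁
    change (lift B η).app q b (Conv.app _ _ X) + _ = _ at h₂
    rw [Conv.dif_app _ _ _ h' h rfl (by omega), map_sub, map_smul, lift_inj] at h₂
    rw [lift_inj]
    exact sub_left_injective (add_left_injective _ (h₂.trans h₁.symm))
  | one x => rw [(cobar P).d_one, lift_one, B.d_one, map_zero]
  | zero => simp only [map_zero]
  | add u v hu hv => simp only [map_add, hu, hv]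
  | smul c u hu => simp only [map_smul, hu]
  | map e u hu => rw [(cobar P).d_map, (lift B η).app_map, (lift B η).app_map, B.d_map, hu]
  | @comp q r a b c h' u v hu hv =>
    rw [(cobar P).d_comp h' h rfl rfl (by omega) (by omega), lift_comp,
      B.d_comp h' h rfl rfl (by omega) (by omega), map_add, map_smul, lift_comp, lift_comp, hu, hv]

end Cobar

/-! ### Weights -/

namespace Grading

open Cobar DGOperad

variable {k : Type w} [Field k] [CharZero k] {Ξ : Type u} {P : DGPseudoCooperad.{u, v, w} k Ξ}
  (γ : Grading P)

/-- The endomorphism of the operad `Cobar(P)` which multiplies `s X` by `2 ^ (j - 1)` for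
`X ∈ 𝒢ʲ P`. -/
def scaling : CollMap (cobar P).toColl (cobar P).toColl :=
  -- Eigenspaces of this endomorphism replace an explicit weight decomposition of the free operad.
  -- In place of `2` any rational number other than `0`, `1`, `-1` would serve, since its powers are
  -- distinct.
  lift (cobar P) (γ.glue fun j => (2 ^ ((j : ℤ) - 1) : k) • inj P)

theorem scaling_inj {j : ℕ} {q : Corolla Ξ} {a b : ℤ} (h : a + 1 = b) {X : P.obj q a}
    (hX : X ∈ γ.G j q a) :
    γ.scaling.app q b ((inj P).app h X) = (2 ^ ((j : ℤ) - 1) : k) • (inj P).app h X := by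
  rw [scaling, lift_inj, γ.glue_app _ h hX]
  rfl

theorem scaling_comp {q r : Corolla Ξ} {a b c : ℤ} (h : a + b = c)
    (u : (cobar P).obj (q.cons r.out) a) (v : (cobar P).obj r b) :
    γ.scaling.app _ c ((cobar P).comp h u v) =
      (cobar P).comp h (γ.scaling.app _ a u) (γ.scaling.app _ b v) :=
  lift_comp _ _ h u v

variable (K : Type y) [Field K] [Algebra k K]

/-- The extension of `scaling` to `Cobar(P) ⊗ K`. -/
def scalingK : CollMap ((cobar P).tensor K).toColl ((cobar P).tensor K).toColl :=
  extend ⟨fun q a => ((cobar P).inc K).app q a ∘ₗ γ.scaling.app q a, fun e a u => by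
    rw [LinearMap.comp_apply, γ.scaling.app_map, CollMap.app_map]
    rfl⟩

variable {K} {q r : Corolla Ξ} {a b c : ℤ}

theorem scalingK_tm (u : (cobar P).obj q a) (z : K) :
    (γ.scalingK K).app q a ((cobar P).tm K u z) = (cobar P).tm K (γ.scaling.app q a u) z := by
  rw [scalingK, extend_tm]
  change (cobar P).scal K z ((cobar P).tm K _ 1) = _
  rw [scal_tm, mul_one]

theorem scalingK_crd (φ : K →ₗ[k] k) (u : ((cobar P).tensor K).obj q a) :
    ((cobar P).crd K φ).app q a ((γ.scalingK K).app q a u) =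
      γ.scaling.app q a (((cobar P).crd K φ).app q a u) := by
  induction u using tm_induction with
  | tm u z => simp only [scalingK_tm, crd_tm, map_smul]
  | add u v hu hv => simp only [map_add, hu, hv]

theorem scalingK_comp (h : a + b = c) (u : ((cobar P).tensor K).obj (q.cons r.out) a)
    (v : ((cobar P).tensor K).obj r b) :
    (γ.scalingK K).app _ c (((cobar P).tensor K).comp h u v) =
      ((cobar P).tensor K).comp h ((γ.scalingK K).app _ a u) ((γ.scalingK K).app _ b v) := by
  refine extend_comp _ (fun h u v => ?_) h u v
  change ((cobar P).inc K).app _ _ (γ.scaling.app _ _ _) = _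
  rw [scaling_comp, inc_comp]
  rfl

variable (K) in
/-- The vectors of weight `n` in `Cobar(P) ⊗ K`. -/
def weight (n : ℤ) (q : Corolla Ξ) (a : ℤ) : Submodule k (((cobar P).tensor K).obj q a) :=
  Module.End.eigenspace ((γ.scalingK K).app q a : Module.End k _) (2 ^ n)

variable {γ}

theorem mem_weight {n : ℤ} {u : ((cobar P).tensor K).obj q a} :
    u ∈ γ.weight K n q a ↔ (γ.scalingK K).app q a u = (2 ^ n : k) • u :=
  Module.End.mem_eigenspace_iff

theorem tm_mem_weight {n : ℤ} {u : (cobar P).obj q a}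
    (hu : γ.scaling.app q a u = (2 ^ n : k) • u) (z : K) : (cobar P).tm K u z ∈ γ.weight K n q a := by
  rw [mem_weight, scalingK_tm, hu, map_smul, LinearMap.smul_apply]

theorem inj_mem_weight {j : ℕ} (h : a + 1 = b) {X : P.obj q a} (hX : X ∈ γ.G j q a) (z : K) :
    (cobar P).tm K ((inj P).app h X) z ∈ γ.weight K ((j : ℤ) - 1) q b :=
  tm_mem_weight (γ.scaling_inj h hX) z

theorem map_mem_weight {n : ℤ} (e : q.Iso r) {u : ((cobar P).tensor K).obj q a}
    (hu : u ∈ γ.weight K n q a) : ((cobar P).tensor K).map e u ∈ γ.weight K n r a := by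
  rw [mem_weight] at hu ⊢
  rw [CollMap.app_map, hu, map_smul]

theorem comp_mem_weight {n n' : ℤ} (h : a + b = c) {u : ((cobar P).tensor K).obj (q.cons r.out) a}
    (hu : u ∈ γ.weight K n _ a) {v : ((cobar P).tensor K).obj r b} (hv : v ∈ γ.weight K n' r b) :
    ((cobar P).tensor K).comp h u v ∈ γ.weight K (n + n') _ c := by
  rw [mem_weight] at hu hv ⊢
  rw [scalingK_comp, hu, hv, map_smul, map_smul, LinearMap.smul_apply, smul_smul,
    zpow_add₀ two_ne_zero, mul_comm]

theorem mul_mem_weight {p p' q' : ℤ} (hp : p + p' = q') {i : ℤ}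
    (f : Conv P.toColl ((cobar P).tensor K).toColl p)
    (g : Conv P.toColl ((cobar P).tensor K).toColl p') {j : ℕ}
    (H : ∀ r₁ r₂ : ℕ, r₁ + r₂ = j → 1 ≤ r₁ → 1 ≤ r₂ → f ∈ γ.van _ p r₁ ∨ g ∈ γ.van _ p' r₂ ∨
      ∃ n n' : ℤ, n + n' = i ∧
        (∀ {q : Corolla Ξ} {a b : ℤ} (h : a + p = b), ∀ X ∈ γ.G r₁ q a,
          f.app h X ∈ γ.weight K n q b) ∧
        ∀ {q : Corolla Ξ} {a b : ℤ} (h : a + p' = b), ∀ X ∈ γ.G r₂ q a,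
          g.app h X ∈ γ.weight K n' q b)
    (h : a + q' = b) {X : P.obj q a} (hX : X ∈ γ.G j q a) :
    (Conv.mul (V := ((cobar P).tensor K).toOperad) hp f g).app h X ∈ γ.weight K i q b := by
  refine γ.mul_mem (V := ((cobar P).tensor K).toOperad) (fun t b => γ.weight K i t b)
    (fun e b u hu => map_mem_weight e hu) hp f g ?_ h hX
  intro r₁ r₂ hr q r a b a' b' c ha hb hc X hX Y hY
  rcases Nat.eq_zero_or_pos r₁ with rfl | h₁
  · rw [γ.mem_van_zero f _ _ _ ha X hX, map_zero, LinearMap.zero_apply]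
    exact zero_mem _
  rcases Nat.eq_zero_or_pos r₂ with rfl | h₂
  · rw [γ.mem_van_zero g _ _ _ hb Y hY, map_zero]
    exact zero_mem _
  rcases H r₁ r₂ hr h₁ h₂ with H | H | ⟨n, n', rfl, hf, hg⟩
  · rw [H _ _ _ ha X hX, map_zero, LinearMap.zero_apply]
    exact zero_mem _
  · rw [H _ _ _ hb Y hY, map_zero]
    exact zero_mem _
  · exact comp_mem_weight hc (hf ha X hX) (hg hb Y hY)

/-- Generators are sums of eigenvectors, and sums of eigenvectors are stable under all operations,
the weights being additive under insertion. Only nonnegative weights occur because the grading of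
`P` starts in degree one. -/
theorem iSup_weight (q : Corolla Ξ) (a : ℤ) : ⨆ n : ℕ, γ.weight K n q a = ⊤ := by
  have key : ∀ u : (cobar P).obj q a,
      u ∈ ⨆ n : ℕ, Module.End.eigenspace (γ.scaling.app q a : Module.End k _) (2 ^ n) := by
    intro u
    induction u using Cobar.induction with
    | @inj q a b h X =>
      refine LinearMap.congr_fun (f := Submodule.mkQ _ ∘ₗ (inj P).app h) (g := 0)
        (γ.hom_ext fun j Y hY => ?_) X |> (Submodule.Quotient.mk_eq_zero _).1
      refine (Submodule.Quotient.mk_eq_zero _).2 ?_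
      rcases j with _ | j
      · rw [γ.zero, Submodule.mem_bot] at hY
        rw [hY, map_zero]
        exact zero_mem _
      · refine Submodule.mem_iSup_of_mem j (Module.End.mem_eigenspace_iff.2 ?_)
        have := γ.scaling_inj h hY
        rw [this, Nat.cast_succ, add_sub_cancel_right, zpow_natCast]
    | one x =>
      refine Submodule.mem_iSup_of_mem 0 (Module.End.mem_eigenspace_iff.2 ?_)
      rw [pow_zero, one_smul]
      exact lift_one _ _ x
    | zero => exact zero_mem _
    | add u v hu hv => exact add_mem hu hv
    | smul c u hu => exact Submodule.smul_mem _ c hu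
    | @map q r e a u hu =>
      have : (⨆ n : ℕ, Module.End.eigenspace (γ.scaling.app q a : Module.End k _) (2 ^ n)) ≤
          (⨆ n : ℕ, Module.End.eigenspace (γ.scaling.app r a : Module.End k _) (2 ^ n)).comap
            ((cobar P).map e) := by
        refine iSup_le fun n v hv => Submodule.mem_iSup_of_mem n ?_
        rw [Module.End.mem_eigenspace_iff] at hv ⊢
        rw [CollMap.app_map, hv, map_smul]
      exact this hu
    | @comp q r a b c h u v hu hv =>
      induction hu using Submodule.iSup_induction' with
      | zero => simp
      | add u u' _ _ hu hu' => simpa using add_mem hu hu'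
      | mem n u hu =>
        induction hv using Submodule.iSup_induction' with
        | zero => simp
        | add v v' _ _ hv hv' => simpa using add_mem hv hv'
        | mem n' v hv =>
          refine Submodule.mem_iSup_of_mem (n + n') ?_
          rw [Module.End.mem_eigenspace_iff] at hu hv ⊢
          rw [scaling_comp, hu, hv, map_smul, map_smul, LinearMap.smul_apply, smul_smul, pow_add,
            mul_comm]
  refine (Submodule.eq_top_iff').2 fun u => ?_
  induction u using tm_induction with
  | tm u z =>
    have : (⨆ n : ℕ, Module.End.eigenspace (γ.scaling.app q a : Module.End k _) (2 ^ n)) ≤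
        (⨆ n : ℕ, γ.weight K n q a).comap (((cobar P).tm K).flip z) := by
      refine iSup_le fun n v hv => Submodule.mem_iSup_of_mem n (tm_mem_weight ?_ z)
      rw [zpow_natCast]
      exact Module.End.mem_eigenspace_iff.1 hv
    exact this (key u)
  | add u v hu hv => exact add_mem hu hv

variable (γ K) in
theorem iSupIndep_weight (q : Corolla Ξ) (a : ℤ) : iSupIndep fun n => γ.weight K n q a := by
  have h := Module.End.eigenspaces_iSupIndep ((γ.scalingK K).app q a : Module.End k _)
  refine h.comp (f := fun n : ℤ => (2 ^ n : k)) fun m n hmn => ?_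
  -- The field `k` carries no order, so injectivity of the powers of `2` is checked in `ℚ`.
  have h₂ : ((2 ^ m : ℚ) : k) = ((2 ^ n : ℚ) : k) := by
    push_cast
    exact hmn
  exact zpow_right_injective₀ (by norm_num) (by norm_num) (Rat.cast_injective h₂)

/-- The nonnegative weights already span, and distinct weights are independent. This is the source
of the vanishing in low degrees of `D` and of the iterates of its derivation. -/
theorem eq_zero_of_weight {n : ℤ} (hn : n < 0) {u : ((cobar P).tensor K).obj q a}
    (hu : u ∈ γ.weight K n q a) : u = 0 := by
  refine (Submodule.disjoint_def.1 (γ.iSupIndep_weight K q a n)) u hu ?_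
  have : (⨆ m : ℕ, γ.weight K m q a) ≤ ⨆ (m : ℤ) (_ : m ≠ n), γ.weight K m q a :=
    iSup_le fun m => le_iSup₂_of_le (m : ℤ) (by omega) le_rfl
  exact this ((iSup_weight q a).ge Submodule.mem_top)

/-- The differential lowers the weight by one. The part from `∂_P` lowers the degree in `P` by one,
and a splitting `j = r₁ + r₂` produces the weight `(r₁ - 1) + (r₂ - 1) = j - 2`. -/
theorem scaling_d (h : a + 1 = b) (u : (cobar P).obj q a) :
    γ.scaling.app q b ((cobar P).d h u) = (2⁻¹ : k) • (cobar P).d h (γ.scaling.app q a u) := by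
  induction u using Cobar.induction generalizing b with
  | @inj q a a' h' X =>
    refine LinearMap.congr_fun (f := γ.scaling.app q b ∘ₗ (cobar P).d h ∘ₗ (inj P).app h')
      (g := (2⁻¹ : k) • (cobar P).d h ∘ₗ γ.scaling.app q a' ∘ₗ (inj P).app h')
      (γ.hom_ext fun j Y hY => ?_) X
    have h₂ := congrArg (fun f : Conv P.toColl (cobar P).toColl 2 => f.app (by omega : a + 2 = b) Y)
      (inj_isMC (P := P))
    simp only [Conv.add_app, Conv.zero_app] at h₂
    rw [Conv.dif_app _ _ _ h' h rfl (by omega), ks_one, neg_one_smul, sub_neg_eq_add] at h₂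
    have h₃ : (Conv.mul₁ (inj P) (inj P)).app (by omega : a + 2 = b) Y ∈
        Module.End.eigenspace (γ.scaling.app q b : Module.End k _) (2 ^ ((j : ℤ) - 2)) := by
      refine γ.mul_mem (V := (cobar P).toOperad)
        (fun q b => Module.End.eigenspace (γ.scaling.app q b : Module.End k _) (2 ^ ((j : ℤ) - 2)))
        (fun e b u hu => ?_) _ _ _ (fun r₁ r₂ hr q r a b a' b' c ha hb hc X hX Y hY => ?_) _ hY
      · rw [Module.End.mem_eigenspace_iff] at hu ⊢
        rw [CollMap.app_map]
        exact (congrArg _ hu).trans (map_smul _ _ _)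
      · rw [Module.End.mem_eigenspace_iff]
        refine (γ.scaling_comp hc _ _).trans ?_
        rw [γ.scaling_inj ha hX, γ.scaling_inj hb hY, map_smul, map_smul, LinearMap.smul_apply,
          smul_smul, ← zpow_add₀ two_ne_zero]
        congr 2
        omega
    have h₄ : γ.scaling.app q b ((inj P).app (by omega) (P.d (rfl : a + 1 = a + 1) Y)) =
        (2 ^ ((j : ℤ) - 2) : k) • (inj P).app (by omega) (P.d (rfl : a + 1 = a + 1) Y) := by
      rcases j with _ | j
      · rw [γ.zero, Submodule.mem_bot] at hY
        simp only [hY, map_zero, smul_zero]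
      · rw [γ.scaling_inj _ (γ.d_mem j rfl hY)]
        congr 2
        omega
    have h₅ : (cobar P).d h ((inj P).app h' Y) ∈
        Module.End.eigenspace (γ.scaling.app q b : Module.End k _) (2 ^ ((j : ℤ) - 2)) := by
      have : (cobar P).d h ((inj P).app h' Y) =
          -(inj P).app (by omega) (P.d (rfl : a + 1 = a + 1) Y) -
            (Conv.mul₁ (inj P) (inj P)).app (by omega : a + 2 = b) Y := by
        rw [eq_sub_iff_add_eq, eq_neg_iff_add_eq_zero, ← h₂]
        abel
      rw [this]
      exact sub_mem (neg_mem (Module.End.mem_eigenspace_iff.2 h₄)) h₃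
    simp only [LinearMap.comp_apply, LinearMap.smul_apply]
    rw [γ.scaling_inj h' hY, map_smul, smul_smul]
    refine (Module.End.mem_eigenspace_iff.1 h₅).trans ?_
    congr 1
    rw [show (j : ℤ) - 2 = -1 + (j - 1) by ring, zpow_add₀ two_ne_zero, zpow_neg_one]
  | one x =>
    have : γ.scaling.app _ 0 ((cobar P).one x) = (cobar P).one x := lift_one _ _ x
    rw [this, (cobar P).d_one, map_zero, smul_zero]
  | zero => simp only [map_zero, smul_zero]
  | add u v hu hv => simp only [map_add, hu, hv, smul_add]
  | smul c u hu => simp only [map_smul, hu, smul_comm c]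
  | map e u hu => rw [(cobar P).d_map, CollMap.app_map, CollMap.app_map, (cobar P).d_map, hu,
      map_smul]
  | @comp q r a b c h' u v hu hv =>
    rw [(cobar P).d_comp h' h rfl rfl (by omega) (by omega), scaling_comp,
      (cobar P).d_comp h' h rfl rfl (by omega) (by omega), map_add, map_smul, scaling_comp,
      scaling_comp, hu, hv]
    simp only [map_smul, LinearMap.smul_apply, smul_add, smul_comm (2⁻¹ : k)]

theorem d_mem_weight {n : ℤ} (h : a + 1 = b) {u : ((cobar P).tensor K).obj q a}
    (hu : u ∈ γ.weight K n q a) : ((cobar P).tensor K).d h u ∈ γ.weight K (n - 1) q b := by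
  have : (γ.scalingK K).app q b (((cobar P).tensor K).d h u) =
      (2⁻¹ : k) • ((cobar P).tensor K).d h ((γ.scalingK K).app q a u) := by
    clear hu
    induction u using tm_induction with
    | tm u z =>
      rw [d_tm, scalingK_tm, scalingK_tm, d_tm, scaling_d, map_smul, LinearMap.smul_apply]
    | add u v hu hv => simp only [map_add, hu, hv, smul_add]
  rw [mem_weight] at hu ⊢
  rw [this, hu, map_smul, smul_smul, zpow_sub₀ two_ne_zero, zpow_one, div_eq_inv_mul]

/-- A coboundary of weight `n` is the coboundary of a vector of weight `n + 1`. -/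
theorem exists_primitive_of_weight {n : ℤ} (h : a + 1 = b) {u : ((cobar P).tensor K).obj q a}
    (hu : ((cobar P).tensor K).d h u ∈ γ.weight K n q b) :
    ∃ y ∈ γ.weight K (n + 1) q a, ((cobar P).tensor K).d h y = ((cobar P).tensor K).d h u := by
  -- Here `y` is the component of `v` of weight `n + 1`; the coboundaries of the other components
  -- have weights different from `n`.
  have key : ∀ v ∈ ⨆ m : ℕ, γ.weight K m q a, ∃ y ∈ γ.weight K (n + 1) q a,
      ((cobar P).tensor K).d h (v - y) ∈ ⨆ (m : ℤ) (_ : m ≠ n), γ.weight K m q b := by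
    intro v hv
    induction hv using Submodule.iSup_induction' with
    | zero => exact ⟨0, zero_mem _, by simp⟩
    | add v v' _ _ hv hv' =>
      obtain ⟨y, hy, hy'⟩ := hv
      obtain ⟨z, hz, hz'⟩ := hv'
      refine ⟨y + z, add_mem hy hz, ?_⟩
      rw [add_sub_add_comm, map_add]
      exact add_mem hy' hz'
    | mem m v hv =>
      by_cases hm : (m : ℤ) = n + 1
      · exact ⟨v, hm ▸ hv, by simp⟩
      · refine ⟨0, zero_mem _, ?_⟩
        rw [sub_zero]
        exact Submodule.mem_iSup_of_mem ((m : ℤ) - 1)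
          (Submodule.mem_iSup_of_mem (by omega) (d_mem_weight h hv))
  obtain ⟨y, hy, hy'⟩ := key u ((iSup_weight q a).ge Submodule.mem_top)
  refine ⟨y, hy, ?_⟩
  have hz : ((cobar P).tensor K).d h (u - y) ∈ γ.weight K n q b := by
    rw [map_sub]
    refine sub_mem hu ?_
    have := d_mem_weight h hy
    rwa [add_sub_cancel_right] at this
  have := (Submodule.disjoint_def.1 (γ.iSupIndep_weight K q b n)) _ hz hy'
  rw [map_sub, sub_eq_zero] at this
  exact this.symm

end Grading

/-! ### Exact vectors -/

namespace DGOperad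

section exact

variable {k : Type w} [Field k] {Ξ : Type u} (O : DGOperad.{u, x, w} k Ξ) {q r : Corolla Ξ}
  {a b c : ℤ}

/-- The subspace of exact vectors. -/
def exact (q : Corolla Ξ) (a : ℤ) : Submodule k (O.obj q a) :=
  LinearMap.range (O.d (sub_add_cancel a 1))

variable {O}

theorem mem_exact (h : b + 1 = a) {u : O.obj q a} : u ∈ O.exact q a ↔ ∃ y, O.d h y = u := by
  obtain rfl : b = a - 1 := by omega
  rfl

theorem d_mem_exact (h : a + 1 = b) (u : O.obj q a) : O.d h u ∈ O.exact q b :=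
  (mem_exact h).2 ⟨u, rfl⟩

theorem map_mem_exact (e : q.Iso r) {u : O.obj q a} (hu : u ∈ O.exact q a) :
    O.map e u ∈ O.exact r a := by
  obtain ⟨y, rfl⟩ := (mem_exact (sub_add_cancel a 1)).1 hu
  rw [← O.d_map]
  exact d_mem_exact _ _

theorem comp_mem_exact_left (h : a + b = c) {u : O.obj (q.cons r.out) a}
    (hu : u ∈ O.exact _ a) {v : O.obj r b} (hv : O.d rfl v = 0) :
    O.comp h u v ∈ O.exact (q.graft r) c := by
  obtain ⟨y, rfl⟩ := (mem_exact (sub_add_cancel a 1)).1 hu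
  refine (mem_exact (sub_add_cancel c 1)).2 ⟨O.comp (by omega) y v, ?_⟩
  rw [O.d_comp _ _ (sub_add_cancel a 1) rfl h (by omega), hv]
  simp

theorem comp_mem_exact_right (h : a + b = c) {u : O.obj (q.cons r.out) a} (hu : O.d rfl u = 0)
    {v : O.obj r b} (hv : v ∈ O.exact r b) : O.comp h u v ∈ O.exact (q.graft r) c := by
  obtain ⟨y, rfl⟩ := (mem_exact (sub_add_cancel b 1)).1 hv
  refine (mem_exact (sub_add_cancel c 1)).2 ⟨ks k a • O.comp (by omega) u y, ?_⟩
  rw [map_smul, O.d_comp (b := b - 1) _ _ rfl (sub_add_cancel b 1) (by omega) h, hu]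
  simp [smul_smul, ks_mul_self]

theorem proj_eq_zero {x : O.cocycles q a} : O.proj q a x = 0 ↔ x.1 ∈ O.exact q a :=
  Submodule.Quotient.mk_eq_zero _

theorem app_mem_exact {A : DGOperad.{u, v, w} k Ξ} (Φ : CollMap A.toColl O.toColl)
    (hΦ : ∀ {q : Corolla Ξ} {a b : ℤ} (h : a + 1 = b) (u : A.obj q a),
      Φ.app q b (A.d h u) = O.d h (Φ.app q a u)) {u : A.obj q a} (hu : u ∈ A.exact q a) :
    Φ.app q a u ∈ O.exact q a := by
  obtain ⟨y, rfl⟩ := (mem_exact (sub_add_cancel a 1)).1 hu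
  rw [hΦ]
  exact d_mem_exact _ _

variable {K : Type y} [Field K] [Algebra k K]

theorem tm_mem_exact {u : O.obj q a} (hu : u ∈ O.exact q a) (z : K) :
    O.tm K u z ∈ (O.tensor K).exact q a := by
  obtain ⟨y, rfl⟩ := (mem_exact (sub_add_cancel a 1)).1 hu
  rw [← d_tm]
  exact d_mem_exact _ _

theorem scal_mem_exact {u : (O.tensor K).obj q a} (hu : u ∈ (O.tensor K).exact q a) (z : K) :
    O.scal K z u ∈ (O.tensor K).exact q a := by
  obtain ⟨y, rfl⟩ := (mem_exact (sub_add_cancel a 1)).1 hu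
  rw [scal_d]
  exact d_mem_exact _ _

theorem mem_exact_of_app_eq_zero {A : DGOperad.{u, v, w} k Ξ} {ρ : A.Hom O.cohomology}
    (hρ : ρ.IsQuasiIso) {u : A.obj q a} (hu : A.d rfl u = 0) (hu' : ρ.app q a u = 0) :
    u ∈ A.exact q a := by
  refine (proj_eq_zero (x := ⟨u, hu⟩)).1 ((hρ q a).1 ?_)
  rw [map_zero]
  refine (Submodule.Quotient.mk_eq_zero _).2 ?_
  have : ρ.onCocycles q a ⟨u, hu⟩ = 0 := Subtype.ext hu'
  rw [this]
  exact zero_mem _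

end exact

end DGOperad

/-! ### The cohomology of the cobar construction -/

namespace Grading

open Cobar DGOperad

variable {k : Type w} [Field k] [CharZero k] {Ξ : Type u} {P : DGPseudoCooperad.{u, v, w} k Ξ}
  {γ : Grading P} {O : DGOperad.{u, x, w} k Ξ} {ρ : (cobar P).Hom O.cohomology}
  {K : Type y} [Field K] [Algebra k K] {q r : Corolla Ξ} {a b c : ℤ}

/-- The scaling factor is `1` on `s 𝒢¹ P`, and `ρ` vanishes on the other generators. Hence the
cohomology, seen through `ρ`, cannot detect nonzero weights. -/
theorem app_scaling (hγ : γ.Compatible ρ) (u : (cobar P).obj q a) :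
    ρ.app q a (γ.scaling.app q a u) = ρ.app q a u := by
  induction u using Cobar.induction with
  | @inj q a b h X =>
    refine LinearMap.congr_fun (f := ρ.app q b ∘ₗ γ.scaling.app q b ∘ₗ (inj P).app h)
      (g := ρ.app q b ∘ₗ (inj P).app h) (γ.hom_ext fun j Y hY => ?_) X
    simp only [LinearMap.comp_apply]
    rw [γ.scaling_inj h hY, map_smul]
    rcases Nat.lt_or_ge j 2 with hj | hj
    · interval_cases j
      · rw [γ.zero, Submodule.mem_bot] at hY
        simp only [hY, map_zero, smul_zero]
      · simp
    · have : ρ.app q b ((inj P).app h Y) = 0 := hγ.2 j hj h Y hY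
      rw [this, smul_zero]
  | one x => exact congrArg _ (lift_one _ _ x)
  | zero => simp only [map_zero]
  | add u v hu hv => simp only [map_add, hu, hv]
  | smul c u hu => simp only [map_smul, hu]
  | map e u hu => rw [CollMap.app_map, ρ.app_map, ρ.app_map, hu]
  | comp h u v hu hv => rw [scaling_comp, ρ.app_comp, ρ.app_comp, hu, hv]

/-- The cohomology of `Cobar(P) ⊗ K` is concentrated in weight zero. -/
theorem mem_exact_of_weight (hρ : ρ.IsQuasiIso) (hγ : γ.Compatible ρ) {n : ℤ} (hn : n ≠ 0)
    {u : ((cobar P).tensor K).obj q a} (hu : u ∈ γ.weight K n q a)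
    (hd : ((cobar P).tensor K).d rfl u = 0) : u ∈ ((cobar P).tensor K).exact q a := by
  let B := Module.Basis.ofVectorSpace k K
  obtain ⟨s, hs⟩ := exists_eq_sum B u
  rw [hs]
  refine Submodule.sum_mem _ fun i _ => tm_mem_exact (mem_exact_of_app_eq_zero hρ ?_ ?_) _
  · rw [← crd_d, hd, map_zero]
  -- A coordinate `v` of `u` is scaled by `2 ^ n` while `ρ` is unchanged, so `(2 ^ n - 1) ρ(v) = 0`.
  · have h₁ := app_scaling hγ (((cobar P).crd K (B.coord i)).app q a u)
    rw [← scalingK_crd, mem_weight.1 hu, map_smul, map_smul] at h₁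
    have h₂ : (2 ^ n - 1 : k) ≠ 0 := by
      intro h
      refine hn (zpow_right_injective₀ (a := (2 : ℚ)) (by norm_num) (by norm_num)
        (Rat.cast_injective (α := k) ?_))
      push_cast
      exact sub_eq_zero.1 h
    refine (smul_right_injective _ h₂) ?_
    change (2 ^ n - 1 : k) • _ = (2 ^ n - 1 : k) • (0 : O.cohomology.obj q a)
    rw [smul_zero, sub_smul, one_smul]
    exact sub_eq_zero.2 h₁

variable {α : Conv P.toColl O.toColl 1} {β : Conv P.toColl (O.tensor K).toColl 1}

/-- Simultaneous representatives of the classes in `H(O)`. -/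
theorem exists_representatives (hγ : γ.Compatible ρ) (hα : γ.Lifts ρ α)
    (hβ : Conv.dif₁ β + Conv.mul₁ β β = 0) (hβα : γ.Agree 1 β α) (h : O.cohomology.obj q a) :
    ∃ (u : (cobar P).obj q a) (x : O.cocycles q a), (cobar P).d rfl u = 0 ∧
      γ.scaling.app q a u = u ∧ ρ.app q a u = h ∧ O.proj q a x = h ∧
      (lift (O.tensor K) β).app q a u - O.tm K x.1 1 ∈ (O.tensor K).exact q a := by
  -- Induction on the way in which the class is generated by `ρ(s 𝒢¹ P)`. On generators `β` is `α ⊗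
  -- 1` and `α` represents `ρ`; the operations preserve the agreement up to exact terms. In effect
  -- the morphism given by `β` and `ρ` act in the same way on cohomology.
  induction hγ.1 q a h with
  | @mem q b h hh =>
    obtain ⟨a, h, X, hX, rfl⟩ := hh
    obtain ⟨hz, hz'⟩ := hα h X hX
    refine ⟨(inj P).app h X, ⟨_, hz⟩, ?_, ?_, rfl, hz', ?_⟩
    -- On `𝒢¹ P` both `∂_P` and all splittings into two positive degrees vanish, so these generators
    -- are closed.
    · have h₁ := congrArg (fun f : Conv P.toColl (cobar P).toColl 2 =>
        f.app (by omega : a + 2 = b + 1) X) (inj_isMC (P := P))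
      simp only [Conv.add_app, Conv.zero_app] at h₁
      rw [Conv.dif_app _ _ _ h rfl rfl (by omega), γ.mul_van (V := (cobar P).toOperad) _ _ _
        (fun r₁ r₂ h₁ h₂ h₃ => by omega) _ _ _ _ X hX] at h₁
      have hdX := γ.d_mem 0 (rfl : a + 1 = a + 1) hX
      rw [γ.zero, Submodule.mem_bot] at hdX
      rwa [hdX, map_zero, smul_zero, sub_zero, add_zero] at h₁
    · rw [γ.scaling_inj h hX]
      simp
    · have : β.app h X = O.tm K (α.app h X) 1 := hβα h X hX
      rw [lift_inj, this, sub_self]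
      exact zero_mem _
  | zero => exact ⟨0, 0, by simp, by simp, by simp, map_zero _, by simp⟩
  | add _ _ ih ih' =>
    obtain ⟨u, x, h₁, h₂, h₃, h₄, h₅⟩ := ih
    obtain ⟨u', x', h₁', h₂', h₃', h₄', h₅'⟩ := ih'
    refine ⟨u + u', x + x', by rw [map_add, h₁, h₁', add_zero], by rw [map_add, h₂, h₂'],
      by rw [map_add, h₃, h₃'], by rw [map_add, h₄, h₄']; rfl, ?_⟩
    have := add_mem h₅ h₅'
    rwa [sub_add_sub_comm, ← map_add, ← LinearMap.add_apply, ← map_add] at this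
  | smul c _ ih =>
    obtain ⟨u, x, h₁, h₂, h₃, h₄, h₅⟩ := ih
    refine ⟨c • u, c • x, by rw [map_smul, h₁, smul_zero], by rw [map_smul, h₂],
      by rw [map_smul, h₃], by rw [map_smul, h₄]; rfl, ?_⟩
    have := Submodule.smul_mem _ c h₅
    rwa [smul_sub, ← map_smul, ← LinearMap.smul_apply, ← map_smul] at this
  | map e _ ih =>
    obtain ⟨u, x, h₁, h₂, h₃, h₄, h₅⟩ := ih
    refine ⟨(cobar P).map e u, O.cocyclesMap e x, by rw [(cobar P).d_map, h₁, map_zero],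
      by rw [CollMap.app_map, h₂], by rw [ρ.app_map, h₃], by rw [← h₄]; rfl, ?_⟩
    have := map_mem_exact e h₅
    rwa [map_sub, ← CollMap.app_map, map_tm] at this
  | one x =>
    refine ⟨(cobar P).one x, ⟨O.one x, O.d_one x rfl⟩, (cobar P).d_one x _, lift_one _ _ x,
      ρ.app_one x, rfl, ?_⟩
    have : (lift (O.tensor K) β).app _ 0 ((cobar P).one x) = O.tm K (O.one x) 1 := rfl
    rw [this, sub_self]
    exact zero_mem _
  | comp h _ _ ih ih' =>
    obtain ⟨u, x, h₁, h₂, h₃, h₄, h₅⟩ := ih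
    obtain ⟨u', x', h₁', h₂', h₃', h₄', h₅'⟩ := ih'
    refine ⟨(cobar P).comp h u u', O.cocyclesComp h x x', ?_, by rw [scaling_comp, h₂, h₂'],
      by rw [ρ.app_comp, h₃, h₃'], by rw [← h₄, ← h₄']; rfl, ?_⟩
    · rw [(cobar P).d_comp h rfl rfl rfl (by omega) (by omega), h₁, h₁']
      simp
    · have e₁ : (O.tensor K).d rfl ((lift (O.tensor K) β).app _ _ u') = 0 := by
        rw [← lift_d hβ, h₁', map_zero]
      have e₂ : (O.tensor K).d rfl (O.tm K x.1 1) = 0 := by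
        have : O.d rfl x.1 = 0 := x.2
        rw [d_tm, this, map_zero, LinearMap.zero_apply]
      -- The difference is telescoped as `(Fu - x) ∘ Fu' + x ∘ (Fu' - x')`, where `F` is the lift of
      -- `β`, and exact vectors are absorbed by composition with cocycles.
      have := add_mem (comp_mem_exact_left h h₅ e₁) (comp_mem_exact_right h e₂ h₅')
      rw [map_sub, map_sub, LinearMap.sub_apply, sub_add_sub_cancel, comp_tm, mul_one] at this
      rw [lift_comp]
      exact this

/-- The morphism of operads `Cobar(P) ⊗ K → O ⊗ K` corresponding to `β`. -/
abbrev liftK (β : Conv P.toColl (O.tensor K).toColl 1) :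
    CollMap ((cobar P).tensor K).toColl (O.tensor K).toColl := extend (lift (O.tensor K) β)

/-- Surjectivity on cohomology, with preimages of weight zero: the coordinates of `y` in a basis of
`K` are represented one by one through `exists_representatives`. -/
theorem exists_cocycle_liftK (hγ : γ.Compatible ρ) (hα : γ.Lifts ρ α)
    (hβ : Conv.dif₁ β + Conv.mul₁ β β = 0) (hβα : γ.Agree 1 β α)
    (y : (O.tensor K).obj q a) (hy : (O.tensor K).d rfl y = 0) :
    ∃ u ∈ γ.weight K 0 q a, ((cobar P).tensor K).d rfl u = 0 ∧
      (liftK β).app q a u - y ∈ (O.tensor K).exact q a := by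
  let B := Module.Basis.ofVectorSpace k K
  obtain ⟨s, hs⟩ := exists_eq_sum B y
  have hy' : ∀ i, O.d rfl ((O.crd K (B.coord i)).app q a y) = 0 := fun i => by
    rw [← crd_d, hy, map_zero]
  choose u x h₁ h₂ _ h₄ h₅ using fun i => exists_representatives hγ hα hβ hβα
    (O.proj q a ⟨_, hy' i⟩)
  refine ⟨∑ i ∈ s, (cobar P).tm K (u i) (B i),
    Submodule.sum_mem _ fun i _ => tm_mem_weight (by rw [h₂, zpow_zero, one_smul]) _, ?_, ?_⟩
  · rw [map_sum]
    refine Finset.sum_eq_zero fun i _ => ?_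
    rw [d_tm, h₁, map_zero, LinearMap.zero_apply]
  · rw [map_sum]
    conv => enter [2, 2]; rw [hs]
    rw [← Finset.sum_sub_distrib]
    refine Submodule.sum_mem _ fun i _ => ?_
    have e₁ := scal_mem_exact (h₅ i) (B i)
    have e₂ : (x i).1 - (O.crd K (B.coord i)).app q a y ∈ O.exact q a := by
      refine (proj_eq_zero (x := x i - ⟨_, hy' i⟩)).1 ?_
      rw [map_sub, h₄, sub_self]
    have := add_mem e₁ (tm_mem_exact e₂ (B i))
    rw [map_sub, scal_tm, mul_one, map_sub, LinearMap.sub_apply, sub_add_sub_cancel] at this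
    exact this

/-- Injectivity on cohomology. The image of `u` is cohomologous to a sum of `x i ⊗ B i` in which `x
i` represents `ρ` of the `i`-th coordinate of `u`. If this sum is exact then so is each `x i`
involved, and the coordinates of `u` are exact because `ρ` is a quasi-isomorphism. -/
theorem mem_exact_of_liftK (hρ : ρ.IsQuasiIso) (hγ : γ.Compatible ρ) (hα : γ.Lifts ρ α)
    (hβ : Conv.dif₁ β + Conv.mul₁ β β = 0) (hβα : γ.Agree 1 β α)
    {u : ((cobar P).tensor K).obj q a}
    (hu : ((cobar P).tensor K).d rfl u = 0)
    (hu' : (liftK β).app q a u ∈ (O.tensor K).exact q a) :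
    u ∈ ((cobar P).tensor K).exact q a := by
  let B := Module.Basis.ofVectorSpace k K
  obtain ⟨s, hs⟩ := exists_eq_sum B u
  have hd : ∀ i, (cobar P).d rfl (((cobar P).crd K (B.coord i)).app q a u) = 0 := fun i => by
    rw [← crd_d, hu, map_zero]
  choose u' x h₁ _ h₃ h₄ h₅ using fun i => exists_representatives hγ hα hβ hβα
    (ρ.app q a (((cobar P).crd K (B.coord i)).app q a u))
  have e₁ : ∀ i, (lift (O.tensor K) β).app q a (((cobar P).crd K (B.coord i)).app q a u) -
      O.tm K (x i).1 1 ∈ (O.tensor K).exact q a := by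
    intro i
    have : ((cobar P).crd K (B.coord i)).app q a u - u' i ∈ (cobar P).exact q a :=
      mem_exact_of_app_eq_zero hρ (by rw [map_sub, hd, h₁, sub_zero])
        (by rw [map_sub, h₃, sub_self])
    have := add_mem (app_mem_exact _ (lift_d hβ) this) (h₅ i)
    rwa [map_sub, sub_add_sub_cancel] at this
  have e₂ : ∑ i ∈ s, O.tm K (x i).1 (B i) ∈ (O.tensor K).exact q a := by
    have : (liftK β).app q a u - ∑ i ∈ s, O.tm K (x i).1 (B i) ∈ (O.tensor K).exact q a := by
      conv => enter [2, 1]; rw [hs]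
      rw [map_sum, ← Finset.sum_sub_distrib]
      refine Submodule.sum_mem _ fun i _ => ?_
      have := scal_mem_exact (e₁ i) (B i)
      rw [map_sub, scal_tm, mul_one] at this
      exact this
    simpa using sub_mem hu' this
  rw [hs]
  refine Submodule.sum_mem _ fun j hj => tm_mem_exact (mem_exact_of_app_eq_zero hρ (hd j) ?_) _
  -- The coordinate map commutes with the differential and isolates the single term `x j`.
  have e₃ := app_mem_exact (O.crd K (B.coord j)) (fun h u => crd_d _ h u) e₂
  rw [map_sum, Finset.sum_eq_single_of_mem j hj, crd_tm, B.coord_apply, B.repr_self,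
    Finsupp.single_eq_same, one_smul] at e₃
  · exact (h₄ j).symm.trans (proj_eq_zero.2 e₃)
  · intro i _ hi
    rw [crd_tm, B.coord_apply, B.repr_self, Finsupp.single_eq_of_ne (by simpa using hi.symm),
      zero_smul]

end Grading

/-! ### Leading terms of the twisted differential and choice of primitives. -/

namespace Conv

variable {k : Type w} [Field k] {Ξ : Type u} {P : DGPseudoCooperad.{u, v, w} k Ξ}
  {O : DGOperad.{u, x, w} k Ξ} {γ : Grading P} {β : Conv P.toColl O.toColl 1}

theorem twist_add (β f g : Conv P.toColl O.toColl 1) :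
    twist β (f + g) = twist β f + twist β g := by
  simp only [twist, map_add, LinearMap.add_apply]
  abel

theorem twist_sub (β f g : Conv P.toColl O.toColl 1) :
    twist β (f - g) = twist β f - twist β g := by
  simp only [twist, map_sub, LinearMap.sub_apply]
  abel

theorem twist_van {f : Conv P.toColl O.toColl 1} {j : ℕ} (hf : ∀ i ≤ j, f ∈ γ.van O.toColl 1 i) :
    twist β f ∈ γ.van O.toColl 2 j :=
  add_mem (add_mem (γ.dif_van _ (hf j le_rfl) (hf _ (Nat.sub_le j 1)))
    (γ.mul_van _ _ _ fun r₁ r₂ h h₁ h₂ => Or.inr (hf r₂ (by omega))))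
    (γ.mul_van _ _ _ fun r₁ r₂ h h₁ h₂ => Or.inl (hf r₁ (by omega)))

theorem dif_app_of_van {p p' : ℤ} (hp : p + 1 = p') {f : Conv P.toColl O.toColl p} {j : ℕ}
    (hf : f ∈ γ.van O.toColl p (j - 1)) {t : Corolla Ξ} {a b c : ℤ} (h : a + p' = c)
    (hb : a + p = b) (hc : b + 1 = c) {X : P.obj t a} (hX : X ∈ γ.G j t a) :
    (dif hp f).app h X = O.d hc (f.app hb X) := by
  rw [dif_app hp f h hb hc rfl (by omega)]
  rcases j with _ | j
  · rw [γ.zero, Submodule.mem_bot] at hX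
    simp [hX]
  · rw [hf _ _ _ _ _ (γ.d_mem j rfl hX), smul_zero, sub_zero]

/-- In the lowest degree where `f` may be nonzero only `∂_O ∘ f` survives: `∂_P` and both products
with `β` evaluate `f` in strictly lower degrees. -/
theorem twist_app_of_van {f : Conv P.toColl O.toColl 1} {j : ℕ}
    (hf : ∀ i < j, f ∈ γ.van O.toColl 1 i) {t : Corolla Ξ} {a b c : ℤ} (h : a + 2 = c)
    (hb : a + 1 = b) (hc : b + 1 = c) {X : P.obj t a} (hX : X ∈ γ.G j t a) :
    (twist β f).app h X = O.d hc (f.app hb X) := by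
  rcases Nat.eq_zero_or_pos j with rfl | hj
  · rw [γ.zero, Submodule.mem_bot] at hX
    simp [hX]
  · rw [twist, add_app, add_app, dif_app_of_van _ (hf _ (by omega)) h hb hc hX,
      γ.mul_van _ _ _ (fun r₁ r₂ h h₁ h₂ => Or.inr (hf r₂ (by omega))) _ _ _ _ _ hX,
      γ.mul_van _ _ _ (fun r₁ r₂ h h₁ h₂ => Or.inl (hf r₁ (by omega))) _ _ _ _ _ hX,
      add_zero, add_zero]

/-- By the Bianchi identity the lowest component of the twisted differential of `f` takes values in
cocycles, so its values represent obstruction classes. -/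
theorem d_twist_of_van [CharZero k] (hβ : dif₁ β + mul₁ β β = 0) {f : Conv P.toColl O.toColl 1}
    {j : ℕ} (hf : ∀ i < j, twist β f ∈ γ.van O.toColl 2 i) {t : Corolla Ξ} {a b c : ℤ}
    (h : a + 2 = b) (hc : b + 1 = c) {X : P.obj t a} (hX : X ∈ γ.G j t a) :
    O.d hc ((twist β f).app h X) = 0 := by
  rcases Nat.eq_zero_or_pos j with rfl | hj
  · rw [γ.zero, Submodule.mem_bot] at hX
    simp [hX]
  · have h₃ : (2 : ℤ) + 1 = 3 := by norm_num
    rw [← dif_app_of_van h₃ (hf _ (by omega)) (by omega : a + 3 = c) h hc hX, dif_twist hβ,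
      sub_app,
      γ.mul_van _ _ _ (fun r₁ r₂ h h₁ h₂ => Or.inl (hf r₁ (by omega))) _ _ _ _ _ hX,
      γ.mul_van _ _ _ (fun r₁ r₂ h h₁ h₂ => Or.inr (hf r₂ (by omega))) _ _ _ _ _ hX,
      sub_zero]

theorem br_van (κ : Conv P.toColl O.toColl 0) {p : ℤ} (f : Conv P.toColl O.toColl p) {j : ℕ}
    (H : ∀ r₁ r₂, r₁ + r₂ = j → 1 ≤ r₁ → 1 ≤ r₂ →
      κ ∈ γ.van O.toColl 0 r₁ ∨ f ∈ γ.van O.toColl p r₂) :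
    br κ p f ∈ γ.van O.toColl p j := by
  rw [br_apply]
  exact sub_mem (γ.mul_van _ _ _ fun r₁ r₂ h h₁ h₂ => (H r₂ r₁ (by omega) h₂ h₁).symm)
    (γ.mul_van _ _ _ H)

theorem push_twist {O' : DGOperad.{u, y, w} k Ξ} (Φ : CollMap O.toColl O'.toColl)
    (hd : ∀ {q : Corolla Ξ} {a b : ℤ} (h : a + 1 = b) (u : O.obj q a),
      Φ.app q b (O.d h u) = O'.d h (Φ.app q a u))
    (hc : ∀ {q r : Corolla Ξ} {a b c : ℤ} (h : a + b = c) (u : O.obj (q.cons r.out) a)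
      (v : O.obj r b), Φ.app _ c (O.comp h u v) = O'.comp h (Φ.app _ _ u) (Φ.app _ _ v))
    (β f : Conv P.toColl O.toColl 1) : push Φ (twist β f) = twist (push Φ β) (push Φ f) := by
  rw [twist, map_add, map_add, push_dif Φ hd,
    push_mul_hom (V := O.toOperad) (V' := O'.toOperad) Φ hc,
    push_mul_hom (V := O.toOperad) (V' := O'.toOperad) Φ hc, twist]

theorem push_isMC {O' : DGOperad.{u, y, w} k Ξ} (Φ : CollMap O.toColl O'.toColl)
    (hd : ∀ {q : Corolla Ξ} {a b : ℤ} (h : a + 1 = b) (u : O.obj q a),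
      Φ.app q b (O.d h u) = O'.d h (Φ.app q a u))
    (hc : ∀ {q r : Corolla Ξ} {a b c : ℤ} (h : a + b = c) (u : O.obj (q.cons r.out) a)
      (v : O.obj r b), Φ.app _ c (O.comp h u v) = O'.comp h (Φ.app _ _ u) (Φ.app _ _ v))
    (hβ : dif₁ β + mul₁ β β = 0) : dif₁ (push Φ β) + mul₁ (push Φ β) (push Φ β) = 0 := by
  rw [← push_mul_hom (V := O.toOperad) (V' := O'.toOperad) Φ hc, ← push_dif Φ hd, ← map_add, hβ,
    map_zero]

theorem push_van {V : Coll.{u, x, w} k Ξ} {V' : Coll.{u, y, w} k Ξ} (Φ : CollMap V V') {p : ℤ}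
    {f : Conv P.toColl V p} {j : ℕ} (hf : f ∈ γ.van V p j) : push Φ f ∈ γ.van V' p j :=
  fun t a b h X hX => by
    change Φ.app t b (f.app h X) = 0
    rw [hf _ _ _ h X hX, map_zero]

/-- Equivariant choice of primitives on `𝒢ʲ P`. -/
theorem exists_primitive [CharZero k] (γ : Grading P) (W : ∀ q a, Submodule k (O.obj q a))
    (hW : ∀ {q r : Corolla Ξ} (e : q.Iso r) {a : ℤ}, ∀ u ∈ W q a, O.map e u ∈ W r a) {p p' : ℤ}
    (hp : p + 1 = p') (f : Conv P.toColl O.toColl p') (j : ℕ)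
    (hf : ∀ {q : Corolla Ξ} {a b c : ℤ} (_ : a + p = b) (hc : b + 1 = c) (h : a + p' = c),
      ∀ X ∈ γ.G j q a, ∃ y ∈ W q b, O.d hc y = f.app h X) :
    ∃ g : Conv P.toColl O.toColl p, (∀ i, i ≠ j → g ∈ γ.van O.toColl p i) ∧
      ∀ {q : Corolla Ξ} {a b c : ℤ} (hb : a + p = b) (hc : b + 1 = c) (h : a + p' = c),
      ∀ X ∈ γ.G j q a, g.app hb X ∈ W q b ∧ O.d hc (g.app hb X) = f.app h X := by
  -- Extending the component on `𝒢ʲ P` by zero makes the relation solvable on all of `P`, as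
  -- `exists_conv` requires.
  let f' := γ.restr j f
  let L : ∀ (q : Corolla Ξ) (a b : ℤ), Submodule k (P.obj q a × O.obj q b) := fun q a b =>
    { carrier := {z | z.2 ∈ W q b ∧ ∀ (h : a + p' = b + 1), O.d rfl z.2 = f'.app h z.1}
      zero_mem' := ⟨zero_mem _, fun h => by simp⟩
      add_mem' := fun hz hz' => ⟨add_mem hz.1 hz'.1, fun h => by
        rw [Prod.snd_add, Prod.fst_add, map_add, map_add, hz.2 h, hz'.2 h]⟩
      smul_mem' := fun c z hz => ⟨Submodule.smul_mem _ c hz.1, fun h => by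
        rw [Prod.smul_snd, Prod.smul_fst, map_smul, map_smul, hz.2 h]⟩ }
  obtain ⟨g, hg⟩ := exists_conv (P := P.toColl) (V := O.toColl) (p := p) L (fun q a b h X => by
      have h' : a + p' = b + 1 := by omega
      obtain ⟨y, hy, hy'⟩ := (Submodule.mem_map (f := O.d (rfl : b + 1 = b + 1))).1
        (γ.restr_mem (f := f) h' ((W q b).map (O.d rfl)) (fun X hX => hf h rfl h' X hX) X)
      exact ⟨y, hy, fun _ => hy'⟩) (fun e a b z hz => ⟨hW e _ hz.1, fun h => by
        rw [O.d_map, hz.2 h, f'.app_map]⟩)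
  refine ⟨γ.restr j g, fun i hi => γ.restr_van hi g, fun {q a b c} hb hc h X hX => ?_⟩
  subst hc
  rw [γ.restr_app g hb hX, ← γ.restr_app f h hX]
  exact ⟨(hg hb X).1, (hg hb X).2 h⟩

end Conv

/-! ### Homogeneous cocycles and the transfer of deformations to the cobar construction. -/

namespace Grading

open Cobar DGOperad Conv

variable {k : Type w} [Field k] [CharZero k] {Ξ : Type u} {P : DGPseudoCooperad.{u, v, w} k Ξ}
  {γ : Grading P} {O : DGOperad.{u, x, w} k Ξ} {ρ : (cobar P).Hom O.cohomology}
  {K : Type y} [Field K] [Algebra k K] {q r : Corolla Ξ} {a b c : ℤ}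
  {α : Conv P.toColl O.toColl 1} {β : Conv P.toColl (O.tensor K).toColl 1}

variable (P K) in
/-- The map `P → Cobar(P) ⊗ K`, `X ↦ s X ⊗ 1`. -/
def injK : Conv P.toColl ((cobar P).tensor K).toColl 1 := push ((cobar P).inc K) (inj P)

theorem injK_isMC : dif₁ (injK P K) + mul₁ (injK P K) (injK P K) = 0 :=
  push_isMC _ inc_d inc_comp inj_isMC

theorem injK_mem_weight (h : a + 1 = b) {j : ℕ} {X : P.obj q a} (hX : X ∈ γ.G j q a) :
    (injK P K).app h X ∈ γ.weight K ((j : ℤ) - 1) q b :=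
  inj_mem_weight h hX 1

theorem liftK_d (hβ : dif₁ β + mul₁ β β = 0) (h : a + 1 = b)
    (u : ((cobar P).tensor K).obj q a) :
    (liftK β).app q b (((cobar P).tensor K).d h u) = (O.tensor K).d h ((liftK β).app q a u) :=
  extend_d _ (lift_d hβ) h u

theorem liftK_comp (β : Conv P.toColl (O.tensor K).toColl 1) (h : a + b = c)
    (u : ((cobar P).tensor K).obj (q.cons r.out) a) (v : ((cobar P).tensor K).obj r b) :
    (liftK β).app _ c (((cobar P).tensor K).comp h u v) =
      (O.tensor K).comp h ((liftK β).app _ a u) ((liftK β).app _ b v) :=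
  extend_comp _ (lift_comp _ β) h u v

theorem push_liftK_injK (β : Conv P.toColl (O.tensor K).toColl 1) :
    push (liftK β) (injK P K) = β :=
  Conv.ext_app fun h X => by
    change (liftK β).app _ _ (((cobar P).inc K).app _ _ ((inj P).app h X)) = _
    rw [extend_inc, lift_inj]

/-- `D` maps `𝒢ʲ P` to the vectors of weight `j - m`. -/
def IsHomogeneous (γ : Grading P) (m : ℕ) (D : Conv P.toColl ((cobar P).tensor K).toColl 1) :
    Prop :=
  ∀ (j : ℕ) {q : Corolla Ξ} {a b : ℤ} (h : a + 1 = b), ∀ X ∈ γ.G j q a,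
    D.app h X ∈ γ.weight K ((j : ℤ) - m) q b

theorem IsHomogeneous.van {m : ℕ} {D : Conv P.toColl ((cobar P).tensor K).toColl 1}
    (hD : γ.IsHomogeneous m D) {j : ℕ} (hj : j < m) : D ∈ γ.van _ 1 j :=
  fun _ _ _ h X hX => eq_zero_of_weight (by omega) (hD j h X hX)

/-- All terms have the same weight: the differential lowers the weight by one, and `(r₁ - 1) + (r₂ -
m) = j - m - 1` for products over `r₁ + r₂ = j`. -/
theorem IsHomogeneous.twist {m : ℕ} {D : Conv P.toColl ((cobar P).tensor K).toColl 1}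
    (hD : γ.IsHomogeneous m D) {j : ℕ} (h : a + 2 = b) {X : P.obj q a} (hX : X ∈ γ.G j q a) :
    (Conv.twist (injK P K) D).app h X ∈ γ.weight K ((j : ℤ) - m - 1) q b := by
  rw [Conv.twist, add_app, add_app]
  refine add_mem (add_mem ?_ ?_) ?_
  · rw [dif_app _ _ h rfl (by omega) rfl (by omega)]
    refine sub_mem (d_mem_weight _ (hD j _ X hX)) (Submodule.smul_mem _ _ ?_)
    rcases j with _ | j
    · rw [γ.zero, Submodule.mem_bot] at hX
      simp [hX]
    · have := hD j (by omega : a + 1 + 1 = b) _ (γ.d_mem j rfl hX)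
      rwa [show ((j + 1 : ℕ) : ℤ) - m - 1 = j - m by push_cast; ring]
  · exact mul_mem_weight _ _ _ (fun r₁ r₂ hr _ _ => Or.inr (Or.inr
      ⟨(r₁ : ℤ) - 1, (r₂ : ℤ) - m, by omega,
        fun h X hX => injK_mem_weight h hX, hD r₂⟩)) h hX
  · exact mul_mem_weight _ _ _ (fun r₁ r₂ hr _ _ => Or.inr (Or.inr
      ⟨(r₁ : ℤ) - m, (r₂ : ℤ) - 1, by omega, hD r₁,
        fun h X hX => injK_mem_weight h hX⟩)) h hX

/-- The inductive step in the extension of a homogeneous vector on `𝒢ᵐ P` to a cocycle. -/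
theorem IsHomogeneous.exists_succ (hρ : ρ.IsQuasiIso) (hγ : γ.Compatible ρ) {m n : ℕ}
    {D : Conv P.toColl ((cobar P).tensor K).toColl 1} (hD : γ.IsHomogeneous m D)
    (hT : ∀ j ≤ m + n, Conv.twist (injK P K) D ∈ γ.van _ 2 j)
    (hE : ∀ {q : Corolla Ξ} {a b : ℤ} (h : a + 2 = b), ∀ X ∈ γ.G (m + n + 1) q a,
      (Conv.twist (injK P K) D).app h X ∈ ((cobar P).tensor K).exact q b) :
    ∃ D' : Conv P.toColl ((cobar P).tensor K).toColl 1, (γ.IsHomogeneous m D' ∧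
      (∀ j ≤ m + (n + 1), Conv.twist (injK P K) D' ∈ γ.van _ 2 j) ∧
      ∀ {q : Corolla Ξ} {a b : ℤ} (h : a + 2 = b), ∀ X ∈ γ.G (m + (n + 1) + 1) q a,
        (Conv.twist (injK P K) D').app h X ∈ ((cobar P).tensor K).exact q b) ∧
      ∀ j, j ≠ m + n + 1 → D' - D ∈ γ.van _ 1 j := by
  -- The primitive is taken in weight `n + 1`, so that subtracting it keeps `D` homogeneous.
  obtain ⟨E, hE₁, hE₂⟩ := exists_primitive γ
    (fun q b => γ.weight K (((m + n + 1 : ℕ) : ℤ) - m) q b) (fun e _ u hu => map_mem_weight e hu)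
    (by norm_num : (1 : ℤ) + 1 = 2) (Conv.twist (injK P K) D) (m + n + 1)
    (fun {q a b c} hb hc h X hX => by
      obtain ⟨y, hy⟩ := (mem_exact hc).1 (hE h X hX)
      have := hD.twist h hX
      rw [← hy] at this ⊢
      obtain ⟨y', hy', e⟩ := exists_primitive_of_weight hc this
      exact ⟨y', by rwa [sub_add_cancel] at hy', e⟩)
  have h₁ : γ.IsHomogeneous m (D - E) := by
    intro j q a b h X hX
    rw [sub_app]
    refine sub_mem (hD j h X hX) ?_
    by_cases hj : j = m + n + 1
    · subst hj
      exact (hE₂ h rfl (by omega) X hX).1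
    · rw [hE₁ j hj _ _ _ h X hX]
      exact zero_mem _
  have h₂ : ∀ j ≤ m + (n + 1), Conv.twist (injK P K) (D - E) ∈ γ.van _ 2 j := by
    intro j hj
    rw [twist_sub]
    rcases Nat.lt_or_ge j (m + n + 1) with hj' | hj'
    · exact sub_mem (hT j (by omega)) (twist_van fun i hi => hE₁ i (by omega))
    · obtain rfl : j = m + n + 1 := by omega
      intro t a b h X hX
      rw [sub_app, twist_app_of_van (fun i hi => hE₁ i (by omega)) h rfl (by omega) hX,
        (hE₂ rfl _ h X hX).2, sub_self]
  refine ⟨D - E, ⟨h₁, h₂, fun {q a b} h X hX => ?_⟩, fun j hj => ?_⟩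
  -- This weight equals `n + 1`, which is nonzero. Only the obstruction on `𝒢^{m+1} P` has weight
  -- zero, and its exactness has to be assumed at the start of the recursion.
  · refine mem_exact_of_weight hρ hγ (n := ((m + (n + 1) + 1 : ℕ) : ℤ) - m - 1) (by omega)
      (h₁.twist h hX) ?_
    exact d_twist_of_van injK_isMC (fun i hi => h₂ i (by omega)) h rfl hX
  · rw [sub_sub_cancel_left]
    exact neg_mem (hE₁ j hj)

/-- Extension of a homogeneous vector on `𝒢ᵐ P` to a cocycle of the twisted differential. -/
theorem IsHomogeneous.exists_cocycle (hρ : ρ.IsQuasiIso) (hγ : γ.Compatible ρ) {m : ℕ}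
    {D₀ : Conv P.toColl ((cobar P).tensor K).toColl 1} (hD : γ.IsHomogeneous m D₀)
    (hT : ∀ j ≤ m, Conv.twist (injK P K) D₀ ∈ γ.van _ 2 j)
    (hE : ∀ {q : Corolla Ξ} {a b : ℤ} (h : a + 2 = b), ∀ X ∈ γ.G (m + 1) q a,
      (Conv.twist (injK P K) D₀).app h X ∈ ((cobar P).tensor K).exact q b) :
    ∃ D : Conv P.toColl ((cobar P).tensor K).toColl 1, γ.IsHomogeneous m D ∧
      Conv.twist (injK P K) D = 0 ∧ ∀ j ≤ m, D - D₀ ∈ γ.van _ 1 j := by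
  let Q : ℕ → Conv P.toColl ((cobar P).tensor K).toColl 1 → Prop := fun n D =>
    γ.IsHomogeneous m D ∧ (∀ j ≤ m + n, Conv.twist (injK P K) D ∈ γ.van _ 2 j) ∧
      ∀ {q : Corolla Ξ} {a b : ℤ} (h : a + 2 = b), ∀ X ∈ γ.G (m + n + 1) q a,
        (Conv.twist (injK P K) D).app h X ∈ ((cobar P).tensor K).exact q b
  choose step hs₁ hs₂ using fun (n : ℕ) (D : {D // Q n D}) =>
    D.2.1.exists_succ hρ hγ D.2.2.1 D.2.2.2
  let S : ∀ n, {D // Q n D} := fun n =>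
    Nat.rec ⟨D₀, hD, hT, hE⟩ (fun n D => ⟨step n D, hs₁ n D⟩) n
  -- Passing from stage `n` to stage `n + 1` changes only the component of degree `m + n + 1`, so
  -- the components of degree at most `m + n` are final at stage `n`.
  have hS : ∀ (n i : ℕ), ∀ j ≤ m + n, (S (n + i)).1 - (S n).1 ∈ γ.van _ 1 j := by
    intro n i j hj
    induction i with
    | zero => simp
    | succ i ih =>
      have h : (S (n + (i + 1))).1 - (S (n + i)).1 ∈ γ.van _ 1 j :=
        hs₂ (n + i) (S (n + i)) j (by omega)
      simpa using add_mem h ih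
  let D := γ.glue fun j => (S j).1
  have hDS : ∀ n, ∀ j ≤ n, D - (S n).1 ∈ γ.van _ 1 j := by
    intro n j hj t a b h X hX
    have := hS j (n - j) j (by omega) _ _ _ h X hX
    rw [Nat.add_sub_cancel' hj, sub_app, sub_eq_zero] at this
    rw [sub_app, γ.glue_app _ h hX, this, sub_self]
  refine ⟨D, fun j q a b h X hX => ?_, γ.eq_zero_of_van fun j => ?_, fun j hj => ?_⟩
  · rw [γ.glue_app _ h hX]
    exact (S j).2.1 j h X hX
  · have := add_mem (twist_van (β := injK P K) (fun i hi => hDS j i hi))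
      ((S j).2.2.1 j (by omega))
    rwa [← twist_add, sub_add_cancel] at this
  · have h₁ := hDS j j le_rfl
    have h₂ := hS 0 j j (by omega)
    rw [zero_add] at h₂
    have h₃ : (S 0).1 = D₀ := rfl
    rw [h₃] at h₂
    simpa using add_mem h₁ h₂

/-- The first nonzero component of an infinitesimal deformation of `β` is induced, up to a gauge
transformation, by an infinitesimal deformation of the cobar construction. -/
theorem exists_infinitesimal (hρ : ρ.IsQuasiIso) (hγ : γ.Compatible ρ) (hα : γ.Lifts ρ α)
    (hβ : dif₁ β + mul₁ β β = 0) (hβα : γ.Agree 1 β α) {m : ℕ}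
    {ω : Conv P.toColl (O.tensor K).toColl 1} (hω : ∀ j < m, ω ∈ γ.van _ 1 j)
    (hT : ∀ j ≤ m + 1, twist β ω ∈ γ.van _ 2 j) :
    ∃ (D : Conv P.toColl ((cobar P).tensor K).toColl 1) (κ : Conv P.toColl (O.tensor K).toColl 0),
      γ.IsHomogeneous m D ∧ twist (injK P K) D = 0 ∧ (∀ j, j ≠ m → κ ∈ γ.van _ 0 j) ∧
      dif (zero_add 1) κ + push (liftK β) D - ω ∈ γ.van _ 1 m := by
  have hdω : ∀ {q : Corolla Ξ} {a b : ℤ} (h : a + 1 = b), ∀ X ∈ γ.G m q a,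
      (O.tensor K).d rfl (ω.app h X) = 0 := by
    intro q a b h X hX
    rw [← twist_app_of_van (β := β) hω (by omega) h rfl hX]
    exact hT m (by omega) _ _ _ _ X hX
  -- The relation pairing `X` with the cocycles of weight zero whose image represents the class of
  -- the component `ω_m` at `X`.
  let L : ∀ (q : Corolla Ξ) (a b : ℤ), Submodule k (P.obj q a × ((cobar P).tensor K).obj q b) :=
    fun q a b =>
    { carrier := {z | z.2 ∈ γ.weight K 0 q b ∧ ((cobar P).tensor K).d rfl z.2 = 0 ∧
        ∀ (h : a + 1 = b), (liftK β).app q b z.2 - (γ.restr m ω).app h z.1 ∈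
          (O.tensor K).exact q b}
      zero_mem' := ⟨zero_mem _, by simp, fun h => by simp⟩
      add_mem' := fun {z z'} hz hz' => ⟨add_mem hz.1 hz'.1, by
        rw [Prod.snd_add, map_add, hz.2.1, hz'.2.1, add_zero], fun h => by
        rw [Prod.snd_add, Prod.fst_add, map_add, map_add, add_sub_add_comm]
        exact add_mem (hz.2.2 h) (hz'.2.2 h)⟩
      smul_mem' := fun c z hz => ⟨Submodule.smul_mem _ c hz.1, by
        rw [Prod.smul_snd, map_smul, hz.2.1, smul_zero], fun h => by
        rw [Prod.smul_snd, Prod.smul_fst, map_smul, map_smul, ← smul_sub]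
        exact Submodule.smul_mem _ c (hz.2.2 h)⟩ }
  obtain ⟨D', hD'⟩ := exists_conv (P := P.toColl) (V := ((cobar P).tensor K).toColl) (p := 1) L
    (fun q a b h X => by
      have h₁ : (γ.restr m ω).app h X ∈ LinearMap.ker ((O.tensor K).d (rfl : b + 1 = b + 1)) :=
        γ.restr_mem h _ (fun X hX => hdω h X hX) X
      obtain ⟨y, hy, hy', hy''⟩ := exists_cocycle_liftK hγ hα hβ hβα _ h₁
      exact ⟨y, hy, hy', fun _ => hy''⟩)
    (fun {q r} e {a b} z hz => ⟨map_mem_weight e hz.1, by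
      rw [((cobar P).tensor K).d_map, hz.2.1, map_zero], fun h => by
      rw [CollMap.app_map, app_map, ← map_sub]
      exact map_mem_exact e (hz.2.2 h)⟩)
  let D₀ := γ.restr m D'
  have hD₀ : ∀ {q : Corolla Ξ} {a b : ℤ} (h : a + 1 = b), ∀ X ∈ γ.G m q a,
      D₀.app h X ∈ γ.weight K 0 q b ∧ ((cobar P).tensor K).d rfl (D₀.app h X) = 0 ∧
        (liftK β).app q b (D₀.app h X) - ω.app h X ∈ (O.tensor K).exact q b := by
    intro q a b h X hX
    rw [γ.restr_app D' h hX, ← γ.restr_app ω h hX]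
    exact ⟨(hD' h X).1, (hD' h X).2.1, (hD' h X).2.2 h⟩
  have hD₀' : ∀ j, j ≠ m → D₀ ∈ γ.van _ 1 j := fun j hj => γ.restr_van hj D'
  -- `κ` accounts for the exact discrepancy between `ω` and the image of `D₀` on `𝒢ᵐ P`.
  obtain ⟨κ, hκ, hκ'⟩ := exists_primitive γ (fun q b => (⊤ : Submodule k ((O.tensor K).obj q b)))
    (fun _ _ _ _ => trivial) (zero_add 1) (ω - push (liftK β) D₀) m
    (fun {q a b c} hb hc h X hX => by
      obtain ⟨y, hy⟩ := (mem_exact hc).1 ((hD₀ h X hX).2.2)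
      refine ⟨-y, trivial, ?_⟩
      rw [map_neg, hy, neg_sub]
      rfl)
  have hm₀ : ∀ j ≤ m, twist (injK P K) D₀ ∈ γ.van _ 2 j := by
    intro j hj
    rcases hj.lt_or_eq with hj | rfl
    · exact twist_van fun i hi => hD₀' i (by omega)
    · intro t a b h X hX
      rw [twist_app_of_van (fun i hi => hD₀' i (by omega)) h rfl (by omega) hX]
      obtain rfl : b = a + 1 + 1 := by omega
      exact (hD₀ rfl X hX).2.1
  have hdκ : dif (zero_add 1) κ + push (liftK β) D₀ - ω ∈ γ.van _ 1 m := by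
    intro t a b h X hX
    rcases Nat.eq_zero_or_pos m with rfl | hm
    · exact γ.mem_van_zero _ _ _ _ h X hX
    rw [sub_app, add_app, dif_app_of_van _ (hκ _ (by omega)) h (add_zero a) h hX,
      (hκ' (add_zero a) h h X hX).2, sub_app, sub_add_cancel, sub_self]
  have hom : γ.IsHomogeneous m D₀ := by
    intro j q a b h X hX
    by_cases hj : j = m
    · subst hj
      rw [sub_self]
      exact (hD₀ h X hX).1
    · rw [hD₀' j hj _ _ _ h X hX]
      exact zero_mem _
  -- The remaining input is exactness of the weight zero obstruction on `𝒢^{m+1} P`. As the morphism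
  -- is injective on cohomology, it may be checked after applying it.
  obtain ⟨D, hD₁, hD₂, hD₃⟩ := hom.exists_cocycle hρ hγ hm₀ (fun {q a b} h X hX => by
    refine mem_exact_of_liftK hρ hγ hα hβ hβα
      (d_twist_of_van injK_isMC (fun i hi => hm₀ i (by omega)) h rfl hX) ?_
    have e₁ : (liftK β).app q b ((twist (injK P K) D₀).app h X) =
        (twist β (push (liftK β) D₀)).app h X := by
      have := push_twist (liftK β) (liftK_d hβ) (liftK_comp β) (injK P K) D₀
      rw [push_liftK_injK] at this
      rw [← this]
      rfl
    -- Removing from `ω` the gauge direction of `κ` and the image of `D₀` leaves a vector `η` that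
    -- vanishes through degree `m`. On `𝒢^{m+1} P` its twisted differential is thus an honest
    -- coboundary, the gauge direction contributes nothing, and that of `ω` is zero by assumption.
    let η := ω - (dif (zero_add 1) κ + br κ 1 β) - push (liftK β) D₀
    have hη : ∀ i < m + 1, η ∈ γ.van _ 1 i := by
      intro i hi
      have hbr : br κ 1 β ∈ γ.van _ 1 i :=
        br_van κ β fun r₁ r₂ h h₁ h₂ => Or.inl (hκ r₁ (by omega))
      rcases Nat.lt_or_ge i m with hi' | hi'
      · exact sub_mem (sub_mem (hω i hi') (add_mem
          (γ.dif_van _ (hκ i (by omega)) (hκ _ (by omega))) hbr)) (push_van _ (hD₀' i (by omega)))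
      · obtain rfl : i = m := by omega
        have := neg_mem (add_mem hdκ hbr)
        convert this using 1
        simp only [η]
        abel
    have e₂ : twist β (push (liftK β) D₀) = twist β ω - twist β η := by
      simp only [η, twist_sub, twist_gauge hβ]
      abel
    rw [e₁, e₂, sub_app, hT (m + 1) le_rfl _ _ _ h X hX, zero_sub,
      twist_app_of_van hη h rfl (by omega) hX]
    exact neg_mem (d_mem_exact _ _))
  refine ⟨D, κ, hD₁, hD₂, hκ, ?_⟩
  have := add_mem hdκ (push_van (liftK β) (hD₃ m le_rfl))
  rw [map_sub] at this
  convert this using 1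
  abel

end Grading

/-! ### Evaluation of flows and gauge transformations. -/

namespace Conv

variable {k : Type w} [Field k] {Ξ : Type u} {P : DGPseudoCooperad.{u, v, w} k Ξ}
  {O : DGOperad.{u, x, w} k Ξ} {γ : Grading P}

/-- Through degree `m` the sum of the series is visible only to first order, because all
coefficients from `b 2` on vanish there. -/
theorem exists_sum_of_van {m : ℕ} {b : ℕ → Conv P.toColl O.toColl 1}
    (hb : ∀ n, 1 ≤ n → ∀ j ≤ n, b n ∈ γ.van O.toColl 1 j)
    (hb' : ∀ n, 2 ≤ n → ∀ j ≤ m, b n ∈ γ.van O.toColl 1 j)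
    (hc : ∀ n, dif₁ (b n) +
      ∑ i ∈ Finset.HasAntidiagonal.antidiagonal n, mul₁ (b i.1) (b i.2) = 0) :
    ∃ β : Conv P.toColl O.toColl 1, dif₁ β + mul₁ β β = 0 ∧
      ∀ j ≤ m, β - (b 0 + b 1) ∈ γ.van O.toColl 1 j := by
  obtain ⟨β, hβ, hβ'⟩ := exists_sum γ hb hc
  refine ⟨β, hβ, fun j hj => ?_⟩
  rcases j with _ | j
  · exact γ.mem_van_zero _
  · have h₁ := hβ' (j + 1)
    rw [Finset.sum_range_succ', Finset.sum_range_succ'] at h₁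
    have h₂ : ∑ n ∈ Finset.range j, b (n + 1 + 1) ∈ γ.van O.toColl 1 (j + 1) :=
      Submodule.sum_mem _ fun n _ => hb' _ (by omega) _ hj
    convert add_mem h₁ h₂ using 1
    abel

/-- Gauge transformations. -/
theorem exists_gauge [CharZero k] {β : Conv P.toColl O.toColl 1} (hβ : dif₁ β + mul₁ β β = 0)
    {m : ℕ} (hm : 2 ≤ m) {κ : Conv P.toColl O.toColl 0} (hκ : ∀ j < m, κ ∈ γ.van O.toColl 0 j) :
    ∃ β' : Conv P.toColl O.toColl 1, dif₁ β' + mul₁ β' β' = 0 ∧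
      ∀ j ≤ m, β' - (β + dif (zero_add 1) κ) ∈ γ.van O.toColl 1 j := by
  obtain ⟨b, h₀, h₁, h₂, h₃⟩ := exists_flow dif₁ mul₁ (br κ 1) (br κ 2) (dif (zero_add 1) κ)
    (dif_br κ) (br_mul κ) (dif_dif _ _ κ) β hβ
  -- `κ` starts in degree `m` and the other factor in degree at least one, so the bracket starts in
  -- degree `m + 1`.
  have hbr : ∀ f : Conv P.toColl O.toColl 1, ∀ j ≤ m, br κ 1 f ∈ γ.van O.toColl 1 j :=
    fun f j hj => br_van κ f fun r₁ r₂ h h₁ h₂ => Or.inl (hκ r₁ (by omega))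
  -- For `n = 1` this needs `m ≥ 2`, so that `∂κ` vanishes on `𝒢¹ P`; every further bracket with `κ`
  -- gains at least one degree.
  have hb : ∀ n, 1 ≤ n → ∀ j ≤ n, b n ∈ γ.van O.toColl 1 j := by
    intro n hn
    induction n, hn using Nat.le_induction with
    | base =>
      intro j hj
      rw [h₁]
      exact add_mem (γ.dif_van _ (hκ j (by omega)) (hκ _ (by omega))) (hbr _ j (by omega))
    | succ n hn ih =>
      intro j hj
      rw [h₂ n hn]
      exact Submodule.smul_mem _ _ (br_van κ _ fun r₁ r₂ h h₁ h₂ => Or.inr (ih r₂ (by omega)))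
  obtain ⟨β', hβ', h⟩ := exists_sum_of_van (m := m) hb (fun n hn j hj => by
    obtain ⟨n, rfl⟩ := Nat.exists_eq_add_of_le' hn
    rw [h₂ (n + 1) (by omega)]
    exact Submodule.smul_mem _ _ (hbr _ j hj)) h₃
  refine ⟨β', hβ', fun j hj => ?_⟩
  have := add_mem (h j hj) (hbr β j hj)
  rw [h₀, h₁] at this
  convert this using 1
  abel

end Conv

/-! ### Derivations of the cobar construction and their exponentials. -/

namespace Grading

open Cobar DGOperad Conv

variable {k : Type w} [Field k] [CharZero k] {Ξ : Type u} {P : DGPseudoCooperad.{u, v, w} k Ξ}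
  {γ : Grading P} {K : Type y} [Field K] [Algebra k K]

/-- This identifies a derivation along the lift of `injK` with a derivation along the inclusion,
which can then be extended linearly over `K`. -/
theorem lift_injK {q : Corolla Ξ} {a : ℤ} (u : (cobar P).obj q a) :
    (lift ((cobar P).tensor K) (injK P K)).app q a u = ((cobar P).inc K).app q a u := by
  induction u using Cobar.induction with
  | inj h X => rfl
  | one x => rfl
  | zero => simp only [map_zero]
  | add u v hu hv => simp only [map_add, hu, hv]
  | smul c u hu => simp only [map_smul, hu]
  | map e u hu => rw [CollMap.app_map, CollMap.app_map, hu]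
  | comp h u v hu hv => rw [lift_comp, inc_comp, hu, hv]

/-- A homogeneous cocycle `D` extends to a derivation of `Cobar(P) ⊗ K` which commutes with the
differential. -/
theorem IsHomogeneous.exists_derivation {m : ℕ}
    {D : Conv P.toColl ((cobar P).tensor K).toColl 1} (hD : γ.IsHomogeneous m D)
    (hT : Conv.twist (injK P K) D = 0) :
    ∃ Φ : CollMap ((cobar P).tensor K).toColl ((cobar P).tensor K).toColl,
      push Φ (injK P K) = D ∧
      (∀ {q : Corolla Ξ} {a b : ℤ} (h : a + 1 = b) (u : ((cobar P).tensor K).obj q a),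
        Φ.app q b (((cobar P).tensor K).d h u) = ((cobar P).tensor K).d h (Φ.app q a u)) ∧
      (∀ {q r : Corolla Ξ} {a b c : ℤ} (h : a + b = c)
        (u : ((cobar P).tensor K).obj (q.cons r.out) a) (v : ((cobar P).tensor K).obj r b),
        Φ.app _ c (((cobar P).tensor K).comp h u v) =
          ((cobar P).tensor K).comp h (Φ.app _ a u) v +
            ((cobar P).tensor K).comp h u (Φ.app _ b v)) ∧
      ∀ {q : Corolla Ξ} {a n : ℤ}, ∀ u ∈ γ.weight K n q a,
        Φ.app q a u ∈ γ.weight K (n + 1 - m) q a := by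
  obtain ⟨G, G_sus, G_one, G_comp'⟩ := ColOp.exists_derivation ((cobar P).tensor K).toOperad
    (injK P K) D
  let Γ : CollMap (cobar P).toColl ((cobar P).tensor K).toColl := G
  have G_inj : push Γ (inj P) = D := Conv.ext_app G_sus
  have G_comp : ∀ {q r : Corolla Ξ} {a b c : ℤ} (h : a + b = c)
      (u : (cobar P).obj (q.cons r.out) a) (v : (cobar P).obj r b),
      Γ.app _ c ((cobar P).comp h u v) =
        ((cobar P).tensor K).comp h (Γ.app _ a u) (((cobar P).inc K).app _ b v) +
          ((cobar P).tensor K).comp h (((cobar P).inc K).app _ a u) (Γ.app _ b v) := by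
    intro q r a b c h u v
    rw [← lift_injK, ← lift_injK]
    exact G_comp' h u v
  -- On generators, commuting with the differentials is the vanishing of the twisted differential of
  -- `D`; the operations then propagate it.
  have G_d : ∀ {q : Corolla Ξ} {a b : ℤ} (h : a + 1 = b) (u : (cobar P).obj q a),
      Γ.app q b ((cobar P).d h u) = ((cobar P).tensor K).d h (Γ.app q a u) := by
    intro q a b h u
    induction u using Cobar.induction generalizing b with
    | @inj q a a' h' X =>
      have h₁ := congrArg (fun f : Conv P.toColl ((cobar P).tensor K).toColl 2 =>
        f.app (by omega : a + 2 = b) X) hT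
      have h₂ := congrArg (fun f => (push Γ f).app (by omega : a + 2 = b) X) (inj_isMC (P := P))
      simp only [Conv.twist, map_add, map_zero, Conv.add_app, Conv.zero_app] at h₁ h₂
      rw [push_mul_der (V := (cobar P).toOperad) (V' := ((cobar P).tensor K).toOperad) Γ
        ((cobar P).inc K) G_comp, G_inj] at h₂
      rw [Conv.dif_app _ _ _ h' h rfl (by omega)] at h₁
      change Γ.app q b (Conv.app _ _ X) + _ = _ at h₂
      rw [Conv.dif_app _ _ _ h' h rfl (by omega), map_sub, map_smul] at h₂
      have e : ∀ {a b : ℤ} (h : a + 1 = b) (X : P.obj q a),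
        Γ.app q b ((inj P).app h X) = D.app h X := G_sus
      rw [e] at h₂ ⊢
      rw [Conv.add_app, ← add_assoc, add_right_comm] at h₂
      exact sub_left_injective (add_left_injective _ (add_left_injective _ (h₂.trans h₁.symm)))
    | one x =>
      have : Γ.app _ 0 ((cobar P).one x) = 0 := G_one x
      rw [(cobar P).d_one, this, map_zero, map_zero]
    | zero => simp only [map_zero]
    | add u v hu hv => simp only [map_add, hu, hv]
    | smul c u hu => simp only [map_smul, hu]
    | map e u hu =>
      rw [(cobar P).d_map, Γ.app_map, Γ.app_map, ((cobar P).tensor K).d_map, hu]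
    | @comp q r a b c h' u v hu hv =>
      rw [(cobar P).d_comp h' h rfl rfl (by omega) (by omega), map_add, map_smul, G_comp, G_comp,
        G_comp, map_add, ((cobar P).tensor K).d_comp h' h rfl rfl (by omega) (by omega),
        ((cobar P).tensor K).d_comp h' h rfl rfl (by omega) (by omega), hu, hv, inc_d, inc_d,
        smul_add]
      abel
  -- A generator `s X` with `X ∈ 𝒢ʲ P` has weight `j - 1` and is sent to weight `j - m`, so the
  -- derivation shifts weights by `1 - m`.
  have G_scaling : ∀ {q : Corolla Ξ} {a : ℤ} (u : (cobar P).obj q a),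
      (γ.scalingK K).app q a (Γ.app q a u) =
        (2 ^ (1 - m : ℤ) : k) • Γ.app q a (γ.scaling.app q a u) := by
    intro q a u
    induction u using Cobar.induction with
    | @inj q a b h X =>
      refine LinearMap.congr_fun (f := (γ.scalingK K).app q b ∘ₗ Γ.app q b ∘ₗ (inj P).app h)
        (g := (2 ^ (1 - m : ℤ) : k) • Γ.app q b ∘ₗ γ.scaling.app q b ∘ₗ (inj P).app h)
        (γ.hom_ext fun j Y hY => ?_) X
      simp only [LinearMap.comp_apply, LinearMap.smul_apply]
      have e : Γ.app q b ((inj P).app h Y) = D.app h Y := G_sus h Y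
      rw [γ.scaling_inj h hY, map_smul, e, mem_weight.1 (hD j h Y hY), smul_smul,
        ← zpow_add₀ two_ne_zero]
      congr 2
      ring
    | one x =>
      have h₁ : Γ.app _ 0 ((cobar P).one x) = 0 := G_one x
      have h₂ : γ.scaling.app _ 0 ((cobar P).one x) = (cobar P).one x := lift_one _ _ x
      rw [h₂, h₁, map_zero, smul_zero]
    | zero => simp only [map_zero, smul_zero]
    | add u v hu hv => simp only [map_add, hu, hv, smul_add]
    | smul c u hu => simp only [map_smul, hu, smul_comm c]
    | map e u hu => rw [Γ.app_map, CollMap.app_map, CollMap.app_map, Γ.app_map, hu, map_smul]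
    | comp h u v hu hv =>
      have e : ∀ {q : Corolla Ξ} {a : ℤ} (u : (cobar P).obj q a),
          (γ.scalingK K).app q a (((cobar P).inc K).app q a u) =
            ((cobar P).inc K).app q a (γ.scaling.app q a u) := fun u => γ.scalingK_tm u 1
      rw [scaling_comp, G_comp, G_comp, map_add, scalingK_comp, scalingK_comp, hu, hv, e, e,
        map_smul, map_smul, LinearMap.smul_apply, smul_add]
  refine ⟨extend Γ, ?_, extend_d Γ G_d, extend_derivation Γ G_comp, ?_⟩
  · refine Conv.ext_app fun h X => ?_
    change (extend Γ).app _ _ (((cobar P).inc K).app _ _ ((inj P).app h X)) = _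
    rw [extend_inc]
    exact G_sus h X
  · intro q a n u hu
    have key : (γ.scalingK K).app q a ((extend Γ).app q a u) =
        (2 ^ (1 - m : ℤ) : k) • (extend Γ).app q a ((γ.scalingK K).app q a u) := by
      clear hu
      induction u using tm_induction with
      | tm u z =>
        have : ∀ u : ((cobar P).tensor K).obj q a,
            (γ.scalingK K).app q a ((cobar P).scal K z u) =
              (cobar P).scal K z ((γ.scalingK K).app q a u) := fun u => extend_scal _ u z
        rw [scalingK_tm, extend_tm, extend_tm, this, G_scaling, map_smul]
      | add u v hu hv => simp only [map_add, hu, hv, smul_add]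
    rw [mem_weight] at hu ⊢
    rw [key, hu, map_smul, smul_smul, ← zpow_add₀ two_ne_zero]
    congr 2
    ring

/-- The deformation of the cobar construction with a given infinitesimal deformation. -/
theorem IsHomogeneous.exists_deformation {m : ℕ} (hm : 2 ≤ m)
    {D : Conv P.toColl ((cobar P).tensor K).toColl 1} (hD : γ.IsHomogeneous m D)
    (hT : Conv.twist (injK P K) D = 0) :
    ∃ φ : Conv P.toColl ((cobar P).tensor K).toColl 1, dif₁ φ + mul₁ φ φ = 0 ∧
      ∀ j ≤ m, φ - (injK P K + D) ∈ γ.van _ 1 j := by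
  obtain ⟨Φ, hΦ, hΦ_d, hΦ_comp, hΦ_weight⟩ := hD.exists_derivation hT
  -- The identity is needed as the map along which `Φ` is a derivation.
  let I : CollMap ((cobar P).tensor K).toColl ((cobar P).tensor K).toColl :=
    ⟨fun _ _ => LinearMap.id, fun _ _ _ => rfl⟩
  have hI : ∀ f : Conv P.toColl ((cobar P).tensor K).toColl 1, push I f = f := fun _ => rfl
  obtain ⟨b, h₀, h₁, h₂, h₃⟩ := exists_flow dif₁ mul₁
    (push Φ : Conv P.toColl ((cobar P).tensor K).toColl 1 →ₗ[k] _) (push Φ) 0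
    (fun f => by rw [← push_dif Φ hΦ_d]; simp)
    (fun f g => by
      rw [map_add, push_mul_der (V := ((cobar P).tensor K).toOperad)
        (V' := ((cobar P).tensor K).toOperad) Φ I hΦ_comp,
        push_mul_der (V := ((cobar P).tensor K).toOperad)
        (V' := ((cobar P).tensor K).toOperad) Φ I hΦ_comp]
      simp only [hI])
    (map_zero _) (injK P K) injK_isMC
  rw [hΦ, zero_add] at h₁
  -- `b n` is `Φⁿ / n!` applied to `injK`: the initial weight is `j - 1`, and each application of
  -- `Φ` shifts it by `1 - m`.
  have hb : ∀ n : ℕ, 1 ≤ n → ∀ (j : ℕ) {q : Corolla Ξ} {a c : ℤ} (h : a + 1 = c),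
      ∀ X ∈ γ.G j q a, (b n).app h X ∈ γ.weight K ((j : ℤ) - 1 + n * (1 - m)) q c := by
    intro n hn
    induction n, hn using Nat.le_induction with
    | base =>
      intro j q a c h X hX
      rw [h₁]
      have := hD j h X hX
      rwa [show (j : ℤ) - 1 + ((1 : ℕ) : ℤ) * (1 - m) = j - m by push_cast; ring]
    | succ n hn ih =>
      intro j q a c h X hX
      rw [h₂ n hn]
      have := hΦ_weight _ (ih j h X hX)
      rw [show (j : ℤ) - 1 + n * (1 - m) + 1 - m = j - 1 + ((n + 1 : ℕ) : ℤ) * (1 - m) by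
        push_cast; ring] at this
      exact Submodule.smul_mem _ _ this
  -- For `j ≤ n` with `n ≥ 1` the weight is at most `n (2 - m) - 1`; for `j ≤ m` with `n ≥ 2` it is
  -- at most `(m - 1)(1 - n)`. Both bounds are negative because `m ≥ 2`.
  obtain ⟨φ, hφ, h⟩ := exists_sum_of_van (γ := γ) (m := m) (b := b) (fun n hn j hj t a c h X hX =>
      eq_zero_of_weight (by nlinarith) (hb n hn j h X hX))
    (fun n hn j hj t a c h X hX => eq_zero_of_weight (by nlinarith) (hb n (by omega) j h X hX)) h₃
  rw [h₀, h₁] at h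
  exact ⟨φ, hφ, h⟩

end Grading

end ColOp

end

/-! ### Comparison of `β` with the sprout and assembly of the deformation. -/

theorem mainTheorem11 {Ξ : Type*} (O : ColOp.DGOperad ℚ Ξ) (P : ColOp.DGPseudoCooperad ℚ Ξ)
    (ρ : (ColOp.cobar P).Hom O.cohomology) (hρ : ρ.IsQuasiIso)
    (γ : ColOp.Grading P) (hP : γ.IsFinite)
    (hO : ∀ (q : ColOp.Corolla Ξ) (a : ℤ), FiniteDimensional ℚ (O.obj q a))
    (hγ : γ.Compatible ρ)
    (K : Type*) [Field K] [Algebra ℚ K]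
    (n m : ℕ) (hm : 2 ≤ m) (hmn : m < n)
    (α : ColOp.Conv P.toColl O.toColl 1)
    (hα : ∀ j, n < j → ∀ {q : ColOp.Corolla Ξ} {a b : ℤ} (h : a + 1 = b), ∀ X ∈ γ.G j q a,
      α.app h X = 0)
    (hα_sprout : γ.IsSprout n α) (hα_lifts : γ.Lifts ρ α)
    (β : ColOp.Conv P.toColl (O.tensor K).toColl 1) (hβ : β.IsMC)
    (hβα : ∀ j, 1 ≤ j → j ≤ m - 1 → γ.Agree j β α) :
    ∃ β' : ColOp.Conv P.toColl (O.tensor K).toColl 1,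
      β'.IsMC ∧ ∀ j, 1 ≤ j → j ≤ m → γ.Agree j β' α := by
  rw [ColOp.Conv.isMC_iff] at hβ
  let αK := ColOp.Conv.push (O.inc K) α
  let ω := αK - β
  have hω : ∀ j < m, ω ∈ γ.van _ 1 j := by
    intro j hj
    rcases Nat.eq_zero_or_pos j with rfl | hj'
    · exact γ.mem_van_zero _
    · intro t a b h X hX
      exact sub_eq_zero.2 (hβα j hj' (by omega) h X hX).symm
  -- Degree `m + 1` is within reach because `m < n`. This extra degree beyond `m` makes the weight
  -- zero obstruction vanish.
  have hT : ∀ j ≤ m + 1, ColOp.Conv.twist β ω ∈ γ.van _ 2 j := by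
    intro j hj
    have h₁ : ColOp.Conv.push (O.inc K) α.curv ∈ γ.van _ 2 j :=
      ColOp.Conv.push_van _ fun t a b h X hX => hα_sprout j (by omega) h X hX
    have h₂ : ColOp.Conv.mul₁ ω ω ∈ γ.van _ 2 j :=
      γ.mul_van _ _ _ fun r₁ r₂ h h₁ h₂ => by
        -- If `r₁ ≥ m` then `r₂ ≤ 1 < m`, so one factor always vanishes.
        rcases Nat.lt_or_ge r₁ m with h' | h'
        · exact Or.inl (hω r₁ h')
        · exact Or.inr (hω r₂ (by omega))
    rw [ColOp.Conv.curv_eq, map_add, ColOp.Conv.push_dif _ ColOp.DGOperad.inc_d,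
      ColOp.Conv.push_mul_hom (V := O.toOperad) (V' := (O.tensor K).toOperad) _
        ColOp.DGOperad.inc_comp] at h₁
    -- Expansion of the curvature of `β + ω` around `β`: constant, linear and quadratic part in `ω`.
    have e : ColOp.Conv.dif₁ αK + ColOp.Conv.mul₁ αK αK - ColOp.Conv.mul₁ ω ω =
        ColOp.Conv.dif₁ β + ColOp.Conv.mul₁ β β + ColOp.Conv.twist β ω := by
      have : αK = β + ω := (add_sub_cancel β αK).symm
      rw [this, ColOp.Conv.twist]
      simp only [map_add, LinearMap.add_apply]
      abel
    rw [hβ, zero_add] at e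
    rw [← e]
    exact sub_mem h₁ h₂
  obtain ⟨D, κ, hD, hD', hκ, hDκ⟩ := ColOp.Grading.exists_infinitesimal hρ hγ hα_lifts hβ
    (hβα 1 le_rfl (by omega)) hω hT
  obtain ⟨φ, hφ, hφ'⟩ := hD.exists_deformation hm hD'
  -- The deformation of the cobar construction is carried to `O ⊗ K` by the morphism of `β` and then
  -- corrected by the gauge transformation of `κ`.
  obtain ⟨β', hβ', h⟩ := ColOp.Conv.exists_gauge (γ := γ)
    (ColOp.Conv.push_isMC (ColOp.Grading.liftK β) (ColOp.Grading.liftK_d hβ)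
      (ColOp.Grading.liftK_comp β) hφ) hm (fun j hj => hκ j hj.ne)
  refine ⟨β', (ColOp.Conv.isMC_iff _).2 hβ', fun j _ hj q a b h' X hX => ?_⟩
  have h₁ := ColOp.Conv.push_van (ColOp.Grading.liftK β) (hφ' j hj)
  rw [map_sub, map_add, ColOp.Grading.push_liftK_injK] at h₁
  have h₂ : ColOp.Conv.dif (zero_add 1) κ + ColOp.Conv.push (ColOp.Grading.liftK β) D - ω ∈
      γ.van _ 1 j := by
    rcases hj.lt_or_eq with hj | rfl
    · exact sub_mem (add_mem (γ.dif_van _ (hκ j hj.ne) (hκ _ (by omega)))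
        (ColOp.Conv.push_van _ (hD.van hj))) (hω j hj)
    · exact hDκ
  -- With `F = liftK β`, the three differences are `β' - (Fφ + ∂κ)`, `Fφ - (β + FD)` and `∂κ + FD -
  -- ω`; they telescope to `β' - β - ω = β' - αK`.
  have h₃ : β' - αK ∈ γ.van _ 1 j := by
    convert add_mem (add_mem (h j hj) h₁) h₂ using 1
    simp only [ω]
    abel
  exact sub_eq_zero.1 (h₃ _ _ _ h' X hX)
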